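/- Let $$A_1=\begin{pmatrix}1&0\\0&0\end{pmatrix},\quad A_2=\begin{pmatrix}-1&0\\0&-1\end{pmatrix},\quad A_3=\begin{pmatrix}-1&0\\0&1\end{pmatrix},\qquad K_3=\{A_1,A_2,A_3\}.$$ For a set $K$ of matrices put $K^{(0)}=K$ and $K^{(j+1)}=K^{(j)}\cup\{\lambda A+(1-\lambda)B:\ A,B\in K^{(j)},\ \operatorname{rank}(A-B)=1,\ \lambda\in[0,1]\}$. Call $\chi=(\chi_1,\chi_2,\chi_3)$ a phase if $\chi_j\in BV(\mathbb T^2;\{0,1\})$, where $\mathbb T^2=\mathbb R^2/\mathbb Z^2$, and $\chi_1+\chi_2+\chi_3=1$. Identify $\chi$ with the matrix field $\sum_j\chi_jA_j=\operatorname{diag}(\chi_{1,1},\chi_{2,2})$, so that $\chi_{1,1}=\chi_1-\chi_2-\chi_3$ and $\chi_{2,2}=\chi_3-\chi_2$. For $\varepsilon>0$ and $u\in W^{1,2}_{loc}(\mathbb R^2;\mathbb R^2)$ with $[0,1]^2$-periodic gradient set $$E_{\varepsilon,3}(u,\chi)=\int_{[0,1]^2}|\nabla u-\chi|^2\,dx+\varepsilon\sum_{j=1}^3\|D\chi_j\|_{TV(\mathbb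 T^2)},$$ $$E_\varepsilon(\chi)=\inf\{E_{\varepsilon,3}(u,\chi):\ u\in W^{1,2}_{loc}(\mathbb R^2;\mathbb R^2),\ \nabla u\ [0,1]^2\text{-periodic}\},$$ $$E_\varepsilon(F)=\inf_{\chi\text{ phase}}\ \inf\{E_{\varepsilon,3}(u,\chi):\ u\in W^{1,2}_{loc}(\mathbb R^2;\mathbb R^2),\ \nabla u\ [0,1]^2\text{-periodic},\ \langle\nabla u\rangle=F\},$$ where $\langle\cdot\rangle$ is the mean over $[0,1]^2$. Let $\theta_1=\int_{[0,1]^2}\chi_1$, and for a measurable function $f$ of $x_2$ only let $$D(\chi,f)=\|\chi_{1,1}-\langle\chi_{1,1}\rangle\|_{L^2([0,1]^2)}^2+\|\chi_{2,2}-f\|_{L^2([0,1]^2)}^2 .$$ 1. (Scaling.) For every $F\in K_3^{(2)}\setminus K_3^{(1)}$ there are constants $c,C>0$, depending only on $F$, such that for every $\varepsilon\in(0,1)$ $$c\,\varepsilon^{2/3}\le E_\varepsilon(F)\le C\,\varepsilon^{2/3}.$$ 2. (Rigidity.) There is a universal constant $C>0$ such that for every phase $\chi$ and every $\varepsilon>0$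 there is a measurable function $f_2$ of $x_2$ only, with values in $\{0,1,-1\}$, such that $D(\chi,f_2)\le C\varepsilon^{-2/3}E_\varepsilon(\chi)$. 3. (Dichotomy.) For every $C_0>0$ there is $C>0$ such that for every phase $\chi$ and every $\varepsilon>0$: (i) if $1-\theta_1\le C_0\,\varepsilon^{-2/3}E_\varepsilon(\chi)$, then $D(\chi,0)\le C\varepsilon^{-2/3}E_\varepsilon(\chi)$; (ii) if $\theta_1\le C_0\,\varepsilon^{-2/3}E_\varepsilon(\chi)$, then $D(\chi,f_2)\le C\varepsilon^{-2/3}E_\varepsilon(\chi)$ for some measurable function $f_2$ of $x_2$ only with values in $\{1,-1\}$. -/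

import Mathlib

open MeasureTheory Set
open scoped ContDiff ENNReal Matrix

noncomputable section

namespace ThreeWell

/-- The Euclidean plane. -/
abbrev Plane : Type := EuclideanSpace ℝ (Fin 2)

/-- Real two-by-two matrices. -/
abbrev Mat2 : Type := Matrix (Fin 2) (Fin 2) ℝ

/-- The standard basis vectors of the plane. -/
def basisVec (j : Fin 2) : Plane := EuclideanSpace.single j (1 : ℝ)

/-- The closed unit square `[0,1]²`, a period cell of the torus; it has area one. -/
def unitSquare : Set Plane := {x | ∀ i, x i ∈ Icc (0 : ℝ) 1}

/-! ### Laminates -/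

/-- The sets `K^(j)` of laminates of order at most `j` of a set `K` of matrices. -/
def laminates {m n : ℕ} (K : Set (Matrix (Fin m) (Fin n) ℝ)) :
    ℕ → Set (Matrix (Fin m) (Fin n) ℝ)
  | 0 => K
  | j + 1 => laminates K j ∪
      {M | ∃ A ∈ laminates K j, ∃ B ∈ laminates K j, (A - B).rank = 1 ∧
        ∃ t ∈ Icc (0 : ℝ) 1, M = t • A + (1 - t) • B}

/-- The three wells `A₁, A₂, A₃` (indexed by `0, 1, 2`). -/
def well : Fin 3 → Mat2 :=
  ![!![1, 0; 0, 0], !![-1, 0; 0, -1], !![-1, 0; 0, 1]]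

/-- The set of wells `K₃ = {A₁, A₂, A₃}`. -/
def K3 : Set Mat2 := range well

/-! ### Periodic phase indicators and their surface energy -/

/-- The divergence of a vector field on the plane. -/
def divergence (φ : Plane → Plane) (x : Plane) : ℝ :=
  ∑ i, fderiv ℝ φ x (basisVec i) i

/-- The total variation `‖Df‖_TV` on the torus of a `[0,1]²`-periodic function `f`, by duality
with smooth periodic vector fields of length at most one. -/
def torusTV (f : Plane → ℝ) : ℝ≥0∞ :=
  ⨆ φ : {φ : Plane → Plane // ContDiff ℝ ∞ φ ∧ (∀ j x, φ (x + basisVec j) = φ x) ∧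
      ∀ x, ‖φ x‖ ≤ 1},
    ENNReal.ofReal (∫ x in unitSquare, f x * divergence φ.1 x)

/-- Phase indicators `χ₁, χ₂, χ₃ ∈ BV(𝕋²; {0,1})` with `χ₁ + χ₂ + χ₃ = 1`, as periodic functions
on the plane. -/
structure IsPhase (χ : Fin 3 → Plane → ℝ) : Prop where
  measurable : ∀ j, Measurable (χ j)
  periodic : ∀ j i x, χ j (x + basisVec i) = χ j x
  zero_or_one : ∀ j x, χ j x = 0 ∨ χ j x = 1
  sum_eq_one : ∀ x, ∑ j, χ j x = 1
  finite_tv : ∀ j, torusTV (χ j) < ⊤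

/-- The matrix field `χ = ∑ⱼ χⱼ Aⱼ = diag(χ₁ - χ₂ - χ₃, -χ₂ + χ₃)`. -/
def phaseMatrix (χ : Fin 3 → Plane → ℝ) (x : Plane) : Mat2 := ∑ j, χ j x • well j

/-! ### Deformations and the energy -/

/-- `G` is the weak gradient of `u`, that is `G i j = ∂ⱼ uᵢ` in the sense of distributions. -/
def HasWeakGradient (u : Plane → Plane) (G : Plane → Mat2) : Prop :=
  ∀ i j, ∀ φ : Plane → ℝ, ContDiff ℝ ∞ φ → HasCompactSupport φ →
    ∫ x, u x i * fderiv ℝ φ x (basisVec j) = - ∫ x, G x i j * φ x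

/-- `u ∈ W^{1,2}_loc(ℝ²; ℝ²)` with weak gradient `G`, and `G` is `[0,1]²`-periodic. -/
structure IsDeformation (u : Plane → Plane) (G : Plane → Mat2) : Prop where
  memLp : ∀ S : Set Plane, IsCompact S → MemLp u 2 (volume.restrict S)
  grad_memLp : ∀ S : Set Plane, IsCompact S →
    ∀ i j, MemLp (fun x => G x i j) 2 (volume.restrict S)
  weakGradient : HasWeakGradient u G
  periodic : ∀ j, ∀ᵐ x, G (x + basisVec j) = G x

/-- The total energy `∫_{[0,1]²} |∇u - χ|² dx + ε ∑ⱼ ‖Dχⱼ‖_TV` of a deformation with gradient `G`,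
with the Euclidean norm of matrices. -/
def energy (ε : ℝ) (G : Plane → Mat2) (χ : Fin 3 → Plane → ℝ) : ℝ≥0∞ :=
  (∫⁻ x in unitSquare, ENNReal.ofReal (∑ i, ∑ j, (G x i j - phaseMatrix χ x i j) ^ 2)) +
    ENNReal.ofReal ε * ∑ j, torusTV (χ j)

/-- `E_ε(χ)`: the infimum of the energy over all deformations with periodic gradient. -/
def phaseEnergy (ε : ℝ) (χ : Fin 3 → Plane → ℝ) : ℝ≥0∞ :=
  ⨅ (u : Plane → Plane) (G : Plane → Mat2) (_ : IsDeformation u G), energy ε G χ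

/-- `E_ε(F)`: the infimum of the energy over all phase indicators and all deformations with
periodic gradient of mean `F`. -/
def meanEnergy (ε : ℝ) (F : Mat2) : ℝ≥0∞ :=
  ⨅ (χ : Fin 3 → Plane → ℝ) (_ : IsPhase χ) (u : Plane → Plane) (G : Plane → Mat2)
    (_ : IsDeformation u G) (_ : ∀ i j, ∫ x in unitSquare, G x i j = F i j), energy ε G χ

/-- `‖χ₁₁ - ⟨χ₁₁⟩‖² + ‖χ₂₂ - f‖²` in `L²([0,1]²)`, where `f` is a function of `x₂` only. -/
def rigidityDefect (χ : Fin 3 → Plane → ℝ) (f : ℝ → ℝ) : ℝ≥0∞ :=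
  (∫⁻ x in unitSquare, ENNReal.ofReal
      ((phaseMatrix χ x 0 0 - ∫ y in unitSquare, phaseMatrix χ y 0 0) ^ 2)) +
    ∫⁻ x in unitSquare, ENNReal.ofReal ((phaseMatrix χ x 1 1 - f (x 1)) ^ 2)

/-- The volume fraction `θ₁ = ∫ χ₁`. -/
def theta1 (χ : Fin 3 → Plane → ℝ) : ℝ := ∫ x in unitSquare, χ 0 x

end ThreeWell

end

open Filter Topology Pointwise

namespace ThreeWell

/-! ### The unit square as a period cell -/

/-! Rigidity rests on one interpolation argument, applied to each row of ∇u. In the second row ∂₂u₂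
is close to χ₂₂ and ∂₁u₂ is close to 0 in L², with squared error at most the elastic energy δ. Take
the increment of ∂₂u₂ under a shift t ≤ 1 in x₁ and average it over a segment of length h in x₂.
Since ∂₁∂₂u₂ = ∂₂∂₁u₂, the average only involves ∂₁u₂ at the two ends of the segment, so its square
is of order δ/h². Removing the average from χ₂₂ costs h times the total variation. The choice h =
ε^(1/3) makes both costs at most a multiple of ε^(-2/3) times the energy E (`curlFree_sq_sub_le`,
`shift_le_of_curlFree`). Thus χ₂₂ hardly depends on x₁ and, by the first row, χ₁₁ hardly depends on
x₂. On the wells χ₁₁ = 1 - 2χ₂₂², so χ₁₁ hardly depends on x₁ either and is nearly constant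
(`IsPhase.variance_diagOne_le`). The function f₂ is a vertical slice of χ₂₂ (`exists_slice_le`,
`IsPhase.rigidity`).

As χ₁₁ = ±1, its variance is 1 - ⟨χ₁₁⟩². For F of order exactly two, ⟨∂₁u₁⟩ = F₁₁ lies strictly
between -1 and 1 and ⟨χ₁₁⟩ is close to it when E is small, so the variance stays away from 0 and E ≥
cε^(2/3) (`meanEnergy_ge`). The dichotomy follows from rigidity and elementary pointwise
inequalities, since χ₂₂ vanishes exactly where χ₁ = 1.

The wells A₂, A₃ are the only rank-one connected pair, so the laminates of order exactly two are
diag(1 - 2L, 0) with 0 < L < 1 (`eq_of_mem_laminates_two`). For the upper bound the first well fills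
the complement of a vertical strip of width L, and the strip carries a mixture of the other two,
branching towards its sides. Generation k has period 2^(-n-k) and lives at distance about L·3^(-k)
from the sides. The elastic energy of the generations sums like 4^(-n)(3/4)^k and the surface energy
like ε2^n(2/3)^k. Stopping after 2n generations leaves an end layer of width about 9^(-n), whose
energy is also at most of order 4^(-n). The total 4^(-n) + ε2^n is of order ε^(2/3) when 2^(-n) is
comparable to ε^(1/3) (`energy_branching_le`, `exists_scale`). -/

theorem unitSquare_eq_preimage :
    unitSquare = (WithLp.ofLp : Plane → Fin 2 → ℝ) ⁻¹' (univ.pi fun _ => Icc (0 : ℝ) 1) := by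
  ext x; simp only [unitSquare, mem_ofPred_eq, mem_preimage, Set.mem_pi, mem_univ, true_imp_iff]

theorem isClosed_unitSquare : IsClosed unitSquare := by
  rw [unitSquare_eq_preimage]
  exact (isClosed_set_pi fun _ _ => isClosed_Icc).preimage (PiLp.continuous_ofLp 2 _)

theorem measurableSet_unitSquare : MeasurableSet unitSquare := isClosed_unitSquare.measurableSet

theorem isCompact_unitSquare : IsCompact unitSquare := by
  have h : unitSquare = (WithLp.toLp 2 : (Fin 2 → ℝ) → Plane) '' (univ.pi fun _ => Icc (0 : ℝ) 1) := by
    ext x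
    simp only [unitSquare_eq_preimage, mem_preimage, mem_image]
    exact ⟨fun hx => ⟨_, hx, rfl⟩, fun ⟨y, hy, hyx⟩ => by rw [← hyx]; exact hy⟩
  rw [h]
  exact (isCompact_univ_pi fun _ => isCompact_Icc).image (PiLp.continuous_toLp 2 _)

theorem volume_unitSquare : volume unitSquare = 1 := by
  rw [unitSquare_eq_preimage, (PiLp.volume_preserving_ofLp (Fin 2)).measure_preimage
    (MeasurableSet.univ_pi fun _ => measurableSet_Icc).nullMeasurableSet]
  rw [volume_pi_pi]; simp

instance : IsProbabilityMeasure (volume.restrict unitSquare) :=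
  ⟨by rw [Measure.restrict_apply_univ, volume_unitSquare]⟩

/-- The half-open period cell. -/
def cell : Set Plane := {x | ∀ i, x i ∈ Ico (0 : ℝ) 1}

theorem cell_eq_fundamentalDomain :
    cell = ZSpan.fundamentalDomain (EuclideanSpace.basisFun (Fin 2) ℝ).toBasis := by
  ext x; simp [cell, ZSpan.mem_fundamentalDomain]

theorem cell_ae_eq_unitSquare : (cell : Set Plane) =ᵐ[volume] unitSquare := by
  have h1 : cell = (WithLp.ofLp : Plane → Fin 2 → ℝ) ⁻¹' (univ.pi fun _ => Ico (0 : ℝ) 1) := by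
    ext x; simp [cell, Set.mem_pi]
  rw [unitSquare_eq_preimage, h1]
  exact (PiLp.volume_preserving_ofLp (Fin 2)).quasiMeasurePreserving.preimage_ae_eq
    (by rw [pi_univ_Icc]; exact Measure.univ_pi_Ico_ae_eq_Icc)

theorem restrict_cell : volume.restrict cell = volume.restrict unitSquare :=
  Measure.restrict_congr_set cell_ae_eq_unitSquare

theorem vadd_eq_of_periodic {α : Type*} {f : Plane → α} (hf : ∀ j x, f (x + basisVec j) = f x)
    (g : Submodule.span ℤ (range (EuclideanSpace.basisFun (Fin 2) ℝ).toBasis)) (x : Plane) :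
    f (g +ᵥ x) = f x := by
  obtain ⟨g, hg⟩ := g
  change f (g + x) = f x
  induction hg using Submodule.span_induction generalizing x with
  | mem y hy =>
    obtain ⟨j, rfl⟩ := hy
    rw [add_comm]
    simpa [basisVec] using hf j x
  | zero => simp
  | add y z _ _ hy hz => rw [add_assoc, hy, hz]
  | smul n y _ hy =>
    induction n using Int.induction_on generalizing x with
    | zero => simp
    | succ n ih => rw [add_smul, one_smul, add_assoc, ih, hy]
    | pred n ih => rw [← hy, sub_smul, one_smul, ← ih x]; congr 1; abel

instance : VAddInvariantMeasure
    (Submodule.span ℤ (range (EuclideanSpace.basisFun (Fin 2) ℝ).toBasis)) Plane volume :=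
  ⟨fun c _ hs => by
    exact (measurePreserving_add_left volume (c : Plane)).measure_preimage
      hs.nullMeasurableSet⟩

theorem isAddFundamentalDomain_shift (v : Plane) :
    IsAddFundamentalDomain
      (Submodule.span ℤ (range (EuclideanSpace.basisFun (Fin 2) ℝ).toBasis)) (v +ᵥ cell)
      (volume : Measure Plane) := by
  rw [cell_eq_fundamentalDomain]
  exact (ZSpan.isAddFundamentalDomain _ volume).vadd_of_comm v

/-- A translate of the half-open cell is again a fundamental domain of ℤ², and a periodic function
has the same integral over any two of these. -/
theorem setLIntegral_add_right {f : Plane → ℝ≥0∞} (hf : ∀ j x, f (x + basisVec j) = f x)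
    (v : Plane) : ∫⁻ x in unitSquare, f (x + v) = ∫⁻ x in unitSquare, f x := by
  have h := (isAddFundamentalDomain_shift v).setLIntegral_eq (isAddFundamentalDomain_shift 0) f
    (vadd_eq_of_periodic hf)
  rw [zero_vadd, restrict_cell] at h
  rw [← h, ← restrict_cell]
  have h2 := (measurePreserving_add_right volume v).setLIntegral_comp_emb
    (measurableEmbedding_addRight v) f cell
  rw [h2]
  congr 3
  ext x
  simp [add_comm]

theorem setIntegral_add_right {f : Plane → ℝ} (hf : ∀ j x, f (x + basisVec j) = f x)
    (v : Plane) : ∫ x in unitSquare, f (x + v) = ∫ x in unitSquare, f x := by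
  have h := (isAddFundamentalDomain_shift v).setIntegral_eq (isAddFundamentalDomain_shift 0)
    (vadd_eq_of_periodic hf)
  rw [zero_vadd, restrict_cell] at h
  rw [← h, ← restrict_cell]
  have h2 := (measurePreserving_add_right volume v).setIntegral_preimage_emb
    (measurableEmbedding_addRight v) f (v +ᵥ cell)
  rw [← h2]
  congr 2
  ext x
  simp [mem_vadd_set_iff_neg_vadd_mem, add_comm]

/-! ### Iterated integrals -/

/-- The point of the plane with the given coordinates. -/
def point (p : ℝ × ℝ) : Plane := WithLp.toLp 2 ![p.1, p.2]

@[simp] theorem point_zero (p : ℝ × ℝ) : point p 0 = p.1 := rfl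
@[simp] theorem point_one (p : ℝ × ℝ) : point p 1 = p.2 := rfl

theorem measurePreserving_point : MeasurePreserving point := by
  have h := (PiLp.volume_preserving_toLp (Fin 2)).comp
    (volume_preserving_finTwoArrow ℝ).symm
  exact h

theorem continuous_point : Continuous point := by
  refine (PiLp.continuous_toLp 2 _).comp ?_
  exact continuous_pi fun i => by fin_cases i <;> simp <;> fun_prop

theorem measurableEmbedding_point : MeasurableEmbedding point :=
  (MeasurableEquiv.toLp 2 (Fin 2 → ℝ)).measurableEmbedding.comp
    (MeasurableEquiv.finTwoArrow (α := ℝ)).symm.measurableEmbedding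

theorem point_preimage_unitSquare : point ⁻¹' unitSquare = Icc 0 1 ×ˢ Icc 0 1 := by
  ext p
  simp only [unitSquare, mem_preimage, mem_ofPred_eq, Fin.forall_fin_two, point_zero, point_one,
    mem_prod]

theorem setLIntegral_unitSquare {f : Plane → ℝ≥0∞} (hf : Measurable f) :
    ∫⁻ x in unitSquare, f x = ∫⁻ s in Icc (0 : ℝ) 1, ∫⁻ t in Icc (0 : ℝ) 1, f (point (s, t)) := by
  have h2 := measurePreserving_point.setLIntegral_comp_preimage_emb measurableEmbedding_point f
    unitSquare
  rw [← h2, point_preimage_unitSquare, Measure.volume_eq_prod, ← Measure.prod_restrict,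
    lintegral_prod]
  exact (hf.comp continuous_point.measurable).aemeasurable

theorem integrable_point {f : Plane → ℝ} (hf : IntegrableOn f unitSquare) :
    Integrable (fun p => f (point p))
      ((volume.restrict (Icc (0 : ℝ) 1)).prod (volume.restrict (Icc (0 : ℝ) 1))) := by
  rw [Measure.prod_restrict, ← Measure.volume_eq_prod, ← point_preimage_unitSquare]
  exact (measurePreserving_point.integrableOn_comp_preimage measurableEmbedding_point).2 hf

theorem setIntegral_unitSquare {f : Plane → ℝ} (hf : IntegrableOn f unitSquare) :
    ∫ x in unitSquare, f x = ∫ s in Icc (0 : ℝ) 1, ∫ t in Icc (0 : ℝ) 1, f (point (s, t)) := by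
  have h2 := measurePreserving_point.setIntegral_preimage_emb measurableEmbedding_point f
    unitSquare
  rw [← h2, ← integral_prod _ (integrable_point hf), Measure.prod_restrict,
    ← Measure.volume_eq_prod, point_preimage_unitSquare]

/-! ### Mollification of periodic functions -/

/-- Variation and curl conditions are only known against smooth periodic test functions, whereas the
estimates need the test function to be an increment of a phase. Mollification bridges the two: it
keeps periods and sup bounds and converges almost everywhere. -/
theorem exists_smooth_periodic_approx {g : Plane → ℝ} (hg : Measurable g)
    (hper : ∀ j x, g (x + basisVec j) = g x) {M : ℝ} (hM : ∀ x, |g x| ≤ M) :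
    ∃ ψ : ℕ → Plane → ℝ, (∀ n, ContDiff ℝ ∞ (ψ n)) ∧
      (∀ n j x, ψ n (x + basisVec j) = ψ n x) ∧ (∀ n x, |ψ n x| ≤ M) ∧
      ∀ᵐ x, Tendsto (fun n => ψ n x) atTop (𝓝 (g x)) := by
  have hloc : LocallyIntegrable g volume :=
    (memLp_top_of_bound hg.aestronglyMeasurable M (.of_forall hM)).locallyIntegrable le_top
  -- The inner and outer radii keep the fixed ratio 2, as Lebesgue differentiation for the
  -- convolutions requires (`K = 2` below).
  let φ : ℕ → ContDiffBump (0 : Plane) := fun n =>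
    ⟨(1 / 2) ^ (n + 1), (1 / 2) ^ n, by positivity, by
      rw [pow_succ]; linarith [show (0 : ℝ) < (1 / 2) ^ n by positivity]⟩
  have hφ : Tendsto (fun n => (φ n).rOut) atTop (𝓝 0) :=
    tendsto_pow_atTop_nhds_zero_of_lt_one (by norm_num) (by norm_num)
  refine ⟨fun n => MeasureTheory.convolution ((φ n).normed volume) g
    (ContinuousLinearMap.lsmul ℝ ℝ) volume, fun n => ?_, fun n j x => ?_, fun n x => ?_, ?_⟩
  · exact (φ n).hasCompactSupport_normed.contDiff_convolution_left _ (φ n).contDiff_normed hloc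
  · simp only [convolution_def]
    refine integral_congr_ae (.of_forall fun t => ?_)
    simp only [ContinuousLinearMap.lsmul_apply]
    rw [show x + basisVec j - t = x - t + basisVec j by abel, hper]
  · simp only [convolution_def, ContinuousLinearMap.lsmul_apply, smul_eq_mul]
    rw [← Real.norm_eq_abs]
    calc ‖∫ t, (φ n).normed volume t * g (x - t)‖
        ≤ ∫ t, (φ n).normed volume t * M := by
          refine norm_integral_le_of_norm_le ((φ n).integrable_normed.mul_const M)
            (.of_forall fun t => ?_)
          rw [norm_mul, Real.norm_of_nonneg ((φ n).nonneg_normed t)]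
          exact mul_le_mul_of_nonneg_left (hM _) ((φ n).nonneg_normed t)
      _ = M := by rw [integral_mul_const, (φ n).integral_normed, one_mul]
  · refine ContDiffBump.ae_convolution_tendsto_right_of_locallyIntegrable (K := 2) hφ
      (.of_forall fun n => ?_) hloc
    change (1 / 2 : ℝ) ^ n ≤ 2 * (1 / 2) ^ (n + 1)
    rw [pow_succ]; linarith

/-! ### Smooth periodic test functions -/

/-- Smooth functions on the torus, as periodic functions on the plane. -/
structure SmoothPeriodic (ψ : Plane → ℝ) : Prop where
  smooth : ContDiff ℝ ∞ ψ
  periodic : ∀ j x, ψ (x + basisVec j) = ψ x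

theorem exists_bound_of_periodic {f : Plane → ℝ} (hf : Continuous f)
    (hper : ∀ j x, f (x + basisVec j) = f x) : ∃ M, 0 ≤ M ∧ ∀ x, |f x| ≤ M := by
  obtain ⟨M, hM⟩ := isCompact_unitSquare.exists_bound_of_continuousOn hf.continuousOn
  have key : ∀ x, |f x| ≤ M := fun x => by
    obtain ⟨v, hv, -⟩ := ZSpan.exist_unique_vadd_mem_fundamentalDomain
      (EuclideanSpace.basisFun (Fin 2) ℝ).toBasis x
    rw [← cell_eq_fundamentalDomain] at hv
    rw [← vadd_eq_of_periodic hper v x]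
    exact hM _ fun i => Ico_subset_Icc_self (hv i)
  exact ⟨M, (abs_nonneg _).trans (key 0), key⟩

namespace SmoothPeriodic

variable {ψ φ : Plane → ℝ}

theorem continuous (hψ : SmoothPeriodic ψ) : Continuous ψ := hψ.smooth.continuous

theorem differentiable (hψ : SmoothPeriodic ψ) : Differentiable ℝ ψ :=
  hψ.smooth.differentiable (by simp)

theorem exists_bound (hψ : SmoothPeriodic ψ) : ∃ M, 0 ≤ M ∧ ∀ x, |ψ x| ≤ M :=
  exists_bound_of_periodic hψ.continuous hψ.periodic

theorem fderiv_apply (hψ : SmoothPeriodic ψ) (v : Plane) :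
    SmoothPeriodic fun x => fderiv ℝ ψ x v where
  smooth := (hψ.smooth.fderiv_right (by simp)).clm_apply contDiff_const
  periodic j x := by
    rw [← fderiv_comp_add_right]
    congr 2
    exact funext (hψ.periodic j)

theorem comp_add_right (hψ : SmoothPeriodic ψ) (v : Plane) :
    SmoothPeriodic fun x => ψ (x + v) where
  smooth := hψ.smooth.comp (contDiff_id.add contDiff_const)
  periodic j x := by rw [add_right_comm, hψ.periodic]

theorem const_mul (hψ : SmoothPeriodic ψ) (c : ℝ) : SmoothPeriodic fun x => c * ψ x where
  smooth := contDiff_const.mul hψ.smooth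
  periodic j x := by rw [hψ.periodic]

theorem memLp (hψ : SmoothPeriodic ψ) (p : ℝ≥0∞) : MemLp ψ p (volume.restrict unitSquare) := by
  obtain ⟨M, -, hM⟩ := hψ.exists_bound
  exact .of_bound hψ.continuous.aestronglyMeasurable M (.of_forall hM)

theorem mul_integrable (hψ : SmoothPeriodic ψ) {f : Plane → ℝ} (hf : IntegrableOn f unitSquare) :
    IntegrableOn (fun x => f x * ψ x) unitSquare := by
  obtain ⟨M, -, hM⟩ := hψ.exists_bound
  exact hf.mul_bdd hψ.continuous.aestronglyMeasurable (.of_forall hM)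

theorem continuous_pairing (hψ : SmoothPeriodic ψ) {f : Plane → ℝ}
    (hf : IntegrableOn f unitSquare) :
    Continuous fun v => ∫ x in unitSquare, f x * ψ (x + v) := by
  obtain ⟨M, -, hM⟩ := hψ.exists_bound
  refine continuous_of_dominated (bound := fun x => |f x| * M) (fun v => ?_) (fun v => ?_) ?_ ?_
  · exact hf.aestronglyMeasurable.mul (hψ.comp_add_right v).continuous.aestronglyMeasurable
  · refine .of_forall fun x => ?_
    rw [norm_mul]
    exact mul_le_mul_of_nonneg_left (hM _) (norm_nonneg _)
  · exact hf.norm.mul_const M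
  · refine .of_forall fun x => ?_
    have := hψ.continuous
    fun_prop

/-- The shift acts on the smooth factor, so `f` itself need only be integrable. -/
theorem hasDerivAt_pairing (hψ : SmoothPeriodic ψ) {f : Plane → ℝ}
    (hf : IntegrableOn f unitSquare) (w v : Plane) (s : ℝ) :
    HasDerivAt (fun s : ℝ => ∫ x in unitSquare, f x * ψ (x + (w + s • v)))
      (∫ x in unitSquare, f x * fderiv ℝ ψ (x + (w + s • v)) v) s := by
  obtain ⟨M, -, hM⟩ := (hψ.fderiv_apply v).exists_bound
  refine (hasDerivAt_integral_of_dominated_loc_of_deriv_le (bound := fun x => |f x| * M)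
    (F := fun (s : ℝ) x => f x * ψ (x + (w + s • v)))
    (F' := fun (s : ℝ) x => f x * fderiv ℝ ψ (x + (w + s • v)) v) (s := univ) univ_mem (.of_forall fun s => ?_) ?_ ?_ ?_ ?_ ?_).2
  · exact ((hψ.comp_add_right (w + s • v)).mul_integrable hf).aestronglyMeasurable
  · exact (hψ.comp_add_right (w + s • v)).mul_integrable hf
  · exact (((hψ.fderiv_apply v).comp_add_right (w + s • v)).mul_integrable hf).aestronglyMeasurable
  · refine .of_forall fun x t _ => ?_
    rw [norm_mul]
    exact mul_le_mul_of_nonneg_left (hM _) (norm_nonneg _)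
  · exact hf.norm.mul_const M
  · refine .of_forall fun x t _ => ?_
    have h1 : HasDerivAt (fun t : ℝ => x + (w + t • v)) v t := by
      simpa using (((hasDerivAt_id t).smul_const v).const_add w).const_add x
    exact ((hψ.differentiable _).hasFDerivAt.comp_hasDerivAt t h1).const_mul (f x)

end SmoothPeriodic

theorem setIntegral_comp_mul {f ψ : Plane → ℝ} (hf : ∀ j x, f (x + basisVec j) = f x)
    (hψ : ∀ j x, ψ (x + basisVec j) = ψ x) (v : Plane) :
    ∫ x in unitSquare, f (x + v) * ψ x = ∫ x in unitSquare, f x * ψ (x - v) := by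
  rw [← setIntegral_add_right (f := fun x => f x * ψ (x - v)) _ v]
  · simp
  · intro j x
    simp only [hf, add_sub_right_comm, hψ]

theorem abs_setIntegral_mul_le {f g : Plane → ℝ} (hf : MemLp f 2 (volume.restrict unitSquare))
    (hg : MemLp g 2 (volume.restrict unitSquare)) :
    |∫ x in unitSquare, f x * g x| ≤
      √(∫ x in unitSquare, f x ^ 2) * √(∫ x in unitSquare, g x ^ 2) := by
  have h := integral_mul_norm_le_Lp_mul_Lq (μ := volume.restrict unitSquare) (f := f) (g := g)
    Real.HolderConjugate.two_two (by simpa using hf) (by simpa using hg)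
  simp only [Real.rpow_two, ← Real.sqrt_eq_rpow, Real.norm_eq_abs, sq_abs] at h
  refine le_trans ?_ h
  simp only [← abs_mul]
  exact abs_integral_le_integral_abs

/-! ### Functions with a bounded derivative in the sense of measures -/

/-- The partial derivative `∂ⱼf` is a measure of total variation at most `T` on the torus. -/
def DerivBound (f : Plane → ℝ) (j : Fin 2) (T : ℝ) : Prop :=
  ∀ ψ, SmoothPeriodic ψ → (∀ x, |ψ x| ≤ 1) →
    |∫ x in unitSquare, f x * fderiv ℝ ψ x (basisVec j)| ≤ T

theorem DerivBound.le_mul {f : Plane → ℝ} {j : Fin 2} {T M : ℝ} (h : DerivBound f j T)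
    {ψ : Plane → ℝ} (hψ : SmoothPeriodic ψ) (hM : 0 < M) (hb : ∀ x, |ψ x| ≤ M) :
    |∫ x in unitSquare, f x * fderiv ℝ ψ x (basisVec j)| ≤ M * T := by
  have h1 := h _ (hψ.const_mul M⁻¹) fun x => by
    rw [abs_mul, abs_of_pos (inv_pos.2 hM), inv_mul_le_one₀ hM]; exact hb x
  have h2 : ∀ x, fderiv ℝ (fun x => M⁻¹ * ψ x) x (basisVec j) =
      M⁻¹ * fderiv ℝ ψ x (basisVec j) := fun x => by
    rw [fderiv_const_mul (hψ.differentiable x)]; rfl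
  simp only [h2, mul_left_comm _ M⁻¹] at h1
  rwa [integral_const_mul, abs_mul, abs_of_pos (inv_pos.2 hM), inv_mul_le_iff₀ hM] at h1

theorem DerivBound.sub {f g : Plane → ℝ} {j : Fin 2} {S T : ℝ} (hf : DerivBound f j S)
    (hg : DerivBound g j T) (hfi : IntegrableOn f unitSquare) (hgi : IntegrableOn g unitSquare) :
    DerivBound (fun x => f x - g x) j (S + T) := fun ψ hψ hb => by
  have hd := hψ.fderiv_apply (basisVec j)
  simp only [sub_mul]
  rw [integral_sub (hd.mul_integrable hfi) (hd.mul_integrable hgi)]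
  exact (abs_sub _ _).trans (add_le_add (hf ψ hψ hb) (hg ψ hψ hb))

theorem DerivBound.comp_add_right {f : Plane → ℝ} {j : Fin 2} {T : ℝ} (h : DerivBound f j T)
    (hf : ∀ j x, f (x + basisVec j) = f x) (v : Plane) :
    DerivBound (fun x => f (x + v)) j T := fun ψ hψ hb => by
  rw [setIntegral_comp_mul hf (hψ.fderiv_apply _).periodic]
  have h1 := h _ (hψ.comp_add_right (-v)) fun x => hb _
  simp only [fderiv_comp_add_right] at h1
  simpa only [sub_eq_add_neg] using h1

/-- Shifting the test function changes the pairing by at most the total variation times the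
length of the shift. -/
theorem DerivBound.abs_pairing_sub_le {f : Plane → ℝ} {j : Fin 2} {T M : ℝ}
    (h : DerivBound f j T) (hf : IntegrableOn f unitSquare)
    {ψ : Plane → ℝ} (hψ : SmoothPeriodic ψ) (hM : 0 < M) (hb : ∀ x, |ψ x| ≤ M) {c : ℝ}
    (s : ℝ) (hs : 0 ≤ s) (hc : |c| = 1) :
    |(∫ x in unitSquare, f x * ψ (x + (s * c) • basisVec j)) - ∫ x in unitSquare, f x * ψ x| ≤
      M * T * s := by
  have h1 := norm_image_sub_le_of_norm_deriv_le_segment' (a := 0) (b := s) (C := M * T)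
    (fun t _ => (hψ.hasDerivAt_pairing hf 0 (c • basisVec j) t).hasDerivWithinAt)
    (fun t _ => ?_) s (right_mem_Icc.2 hs)
  · simpa [smul_smul] using h1
  · have h2 := h.le_mul (hψ.comp_add_right (0 + t • (c • basisVec j))) hM fun x => hb _
    simp only [fderiv_comp_add_right] at h2
    simp only [map_smul, smul_eq_mul, mul_left_comm _ c]
    rw [integral_const_mul, norm_mul, Real.norm_eq_abs, hc, one_mul]
    exact h2

theorem integrableOn_of_bounded {f : Plane → ℝ} (hf : Measurable f) {M : ℝ}
    (hM : ∀ x, |f x| ≤ M) : IntegrableOn f unitSquare :=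
  Integrable.of_bound hf.aestronglyMeasurable M (.of_forall hM)

/-- A bound on the pairings of `g` with smooth `ψ` becomes in the limit a bound on the squared L²
norm of `g`: this is testing with `g` itself. -/
theorem tendsto_pairing {g : Plane → ℝ} (hg : Measurable g) {M : ℝ} (hM : ∀ x, |g x| ≤ M)
    {ψ : ℕ → Plane → ℝ} (hψ : ∀ n, Continuous (ψ n)) (hb : ∀ n x, |ψ n x| ≤ M)
    (hlim : ∀ᵐ x, Tendsto (fun n => ψ n x) atTop (𝓝 (g x))) :
    Tendsto (fun n => ∫ x in unitSquare, g x * ψ n x) atTop (𝓝 (∫ x in unitSquare, g x ^ 2)) ∧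
    Tendsto (fun n => ∫ x in unitSquare, ψ n x ^ 2) atTop (𝓝 (∫ x in unitSquare, g x ^ 2)) := by
  have hM0 : 0 ≤ M := (abs_nonneg _).trans (hM 0)
  constructor
  · refine tendsto_integral_of_dominated_convergence (fun _ => M * M) (fun n => ?_) (integrable_const _)
      (fun n => .of_forall fun x => ?_) ?_
    · exact (hg.mul (hψ n).measurable).aestronglyMeasurable
    · rw [norm_mul]; exact mul_le_mul (hM x) (hb n x) (norm_nonneg _) hM0
    · filter_upwards [ae_restrict_of_ae hlim] with x hx
      rw [sq]; exact hx.const_mul _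
  · refine tendsto_integral_of_dominated_convergence (fun _ => M ^ 2) (fun n => ?_) (integrable_const _)
      (fun n => .of_forall fun x => ?_) ?_
    · exact ((hψ n).measurable.pow_const 2).aestronglyMeasurable
    · rw [norm_pow]; exact pow_le_pow_left₀ (norm_nonneg _) (hb n x) 2
    · filter_upwards [ae_restrict_of_ae hlim] with x hx
      exact hx.pow 2

/-- A translation estimate for functions of bounded variation. -/
theorem DerivBound.setIntegral_sq_sub_le {f : Plane → ℝ} {j : Fin 2} {T : ℝ}
    (h : DerivBound f j T) (hf : Measurable f) (hper : ∀ j x, f (x + basisVec j) = f x)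
    (hb : ∀ x, |f x| ≤ 1) {s : ℝ} (hs : 0 ≤ s) :
    ∫ x in unitSquare, (f (x + s • basisVec j) - f x) ^ 2 ≤ 2 * T * s := by
  have hfi := integrableOn_of_bounded hf hb
  have hgm : Measurable fun x => f (x + s • basisVec j) - f x :=
    (hf.comp (measurable_add_const _)).sub hf
  have hgb : ∀ x, |f (x + s • basisVec j) - f x| ≤ 2 := fun x =>
    (abs_sub _ _).trans (by linarith [hb x, hb (x + s • basisVec j)])
  -- The test function approximates the increment itself, whose sup bound 2 is the factor in the
  -- conclusion.
  obtain ⟨ψ, hψs, hψp, hψb, hlim⟩ := exists_smooth_periodic_approx hgm (fun i x => by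
    simp only [add_right_comm _ (basisVec i), hper]) hgb
  refine le_of_tendsto (tendsto_pairing hgm hgb (fun n => (hψs n).continuous) hψb hlim).1
    (.of_forall fun n => ?_)
  have hψ : SmoothPeriodic (ψ n) := ⟨hψs n, hψp n⟩
  have h1 := h.abs_pairing_sub_le hfi hψ two_pos (hψb n) s hs (c := -1) (by simp)
  have h2 : ∫ x in unitSquare, (f (x + s • basisVec j) - f x) * ψ n x =
      (∫ x in unitSquare, f x * ψ n (x + (s * -1) • basisVec j)) -
        ∫ x in unitSquare, f x * ψ n x := by
    simp only [sub_mul]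
    rw [integral_sub _ (hψ.mul_integrable hfi), setIntegral_comp_mul hper hψ.periodic]
    · simp [sub_eq_add_neg]
    · exact hψ.mul_integrable (integrableOn_of_bounded (hf.comp (measurable_add_const _))
        fun x => hb _)
  rw [h2]
  exact (le_abs_self _).trans h1

/-! ### The rigidity estimate for a curl-free pair -/

theorem SmoothPeriodic.abs_pairing_le {f ψ : Plane → ℝ} (hψ : SmoothPeriodic ψ)
    (hf : MemLp f 2 (volume.restrict unitSquare)) {δ : ℝ} (hδ : ∫ x in unitSquare, f x ^ 2 ≤ δ)
    (v : Plane) :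
    |∫ x in unitSquare, f x * ψ (x + v)| ≤ √δ * √(∫ x in unitSquare, ψ x ^ 2) := by
  refine (abs_setIntegral_mul_le hf ((hψ.comp_add_right v).memLp 2)).trans ?_
  rw [setIntegral_add_right (f := fun x => ψ x ^ 2) fun j x => by rw [hψ.periodic]]
  gcongr

theorem integrableOn_unitSquare_of_memLp {f : Plane → ℝ}
    (hf : MemLp f 2 (volume.restrict unitSquare)) : IntegrableOn f unitSquare :=
  hf.integrable (by norm_num)

/-- For a curl-free pair `(p, q)` the increments of `p` in direction `i`, averaged over a segment of
length `h` in direction `j`, are controlled by `q`. -/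
theorem curlFree_average_le {p q ψ : Plane → ℝ} {i j : Fin 2} {δ h t : ℝ}
    (hp : IntegrableOn p unitSquare) (hq : MemLp q 2 (volume.restrict unitSquare))
    (hcurl : ∀ ψ, SmoothPeriodic ψ → ∫ x in unitSquare, p x * fderiv ℝ ψ x (basisVec i) =
      ∫ x in unitSquare, q x * fderiv ℝ ψ x (basisVec j))
    (hqδ : ∫ x in unitSquare, q x ^ 2 ≤ δ) (ht : 0 ≤ t) (hψ : SmoothPeriodic ψ) :
    ∫ r in (0 : ℝ)..h, ((∫ x in unitSquare, p x * ψ (x + (r • basisVec j + t • -basisVec i))) -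
      ∫ x in unitSquare, p x * ψ (x + r • basisVec j)) ≤
      2 * t * (√δ * √(∫ x in unitSquare, ψ x ^ 2)) := by
  have hqi := integrableOn_unitSquare_of_memLp hq
  have hKc := (hψ.fderiv_apply (basisVec j)).continuous_pairing hqi
  set K : Plane → ℝ := fun v => ∫ x in unitSquare, q x * fderiv ℝ ψ (x + v) (basisVec j) with hK
  set m := √δ * √(∫ x in unitSquare, ψ x ^ 2)
  -- The shift in direction `i` is written as the integral of its derivative, and the curl condition
  -- replaces ∂ᵢ paired with `p` by ∂ⱼ paired with `q`.
  have h1 : ∀ r : ℝ, (∫ x in unitSquare, p x * ψ (x + (r • basisVec j + t • -basisVec i))) -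
      ∫ x in unitSquare, p x * ψ (x + r • basisVec j) =
      ∫ s in (0 : ℝ)..t, -K (r • basisVec j + s • -basisVec i) := fun r => by
    have hd : ∀ s, HasDerivAt
        (fun s : ℝ => ∫ x in unitSquare, p x * ψ (x + (r • basisVec j + s • -basisVec i)))
        (-K (r • basisVec j + s • -basisVec i)) s := fun s => by
      convert hψ.hasDerivAt_pairing hp (r • basisVec j) (-basisVec i) s using 1
      have := hcurl _ (hψ.comp_add_right (r • basisVec j + s • -basisVec i))
      simp only [fderiv_comp_add_right] at this
      simp only [map_neg, mul_neg, integral_neg, hK]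
      rw [this]
    have := intervalIntegral.integral_eq_sub_of_hasDerivAt (a := 0) (b := t) (fun s _ => hd s)
      (Continuous.intervalIntegrable (by fun_prop) _ _)
    rw [this]; simp
  simp only [h1]
  rw [intervalIntegral_intervalIntegral_swap]
  -- After exchanging the integrals, the one over `r` is that of an exact derivative. Only the two
  -- ends of the segment remain, so the bound does not grow with `h`; this gains the factor 1/h
  -- after averaging.
  · have h2 : ∀ s : ℝ, ∫ r in (0 : ℝ)..h, -K (r • basisVec j + s • -basisVec i) =
        -((∫ x in unitSquare, q x * ψ (x + (s • -basisVec i + h • basisVec j))) -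
          ∫ x in unitSquare, q x * ψ (x + (s • -basisVec i + (0 : ℝ) • basisVec j))) := fun s => by
      rw [intervalIntegral.integral_neg]
      congr 1
      refine intervalIntegral.integral_eq_sub_of_hasDerivAt (f := fun r : ℝ =>
        ∫ x in unitSquare, q x * ψ (x + (s • -basisVec i + r • basisVec j))) (fun r _ => ?_)
        (Continuous.intervalIntegrable (by fun_prop) _ _)
      have := hψ.hasDerivAt_pairing hqi (s • -basisVec i) (basisVec j) r
      rw [hK]
      rwa [add_comm (r • basisVec j)]
    have h3 : ∀ s ∈ uIoc (0 : ℝ) t, ‖∫ r in (0 : ℝ)..h, -K (r • basisVec j + s • -basisVec i)‖ ≤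
        m + m := fun s _ => by
      rw [h2, norm_neg]
      exact (abs_sub _ _).trans (add_le_add (hψ.abs_pairing_le hq hqδ _)
        (hψ.abs_pairing_le hq hqδ _))
    have h4 := intervalIntegral.norm_integral_le_of_norm_le_const h3
    rw [sub_zero, abs_of_nonneg ht] at h4
    refine (le_abs_self _).trans (h4.trans_eq (by ring))
  · have : Continuous (Function.uncurry fun r s : ℝ => -K (r • basisVec j + s • -basisVec i)) := by
      unfold Function.uncurry; fun_prop
    refine (this.continuousOn.integrableOn_compact
      (isCompact_uIcc.prod isCompact_uIcc)).mono_set (prod_mono uIoc_subset_uIcc uIoc_subset_uIcc)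

/-- Three errors add up. Moving the test function by at most `h` in direction `j` costs `4Th`, since
the increment has variation at most `2T` and `|ψ| ≤ 2`. Replacing `f` by `p` in both terms of the
increment costs `2√δ‖ψ‖`. The averaged increment of `p` costs `(2t/h)√δ‖ψ‖`. -/
theorem curlFree_pairing_le {f p q ψ : Plane → ℝ} {i j : Fin 2} {T δ h t : ℝ}
    (hf : Measurable f) (hper : ∀ j x, f (x + basisVec j) = f x) (hb : ∀ x, |f x| ≤ 1)
    (hT : DerivBound f j T) (hp : MemLp p 2 (volume.restrict unitSquare))
    (hq : MemLp q 2 (volume.restrict unitSquare))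
    (hcurl : ∀ ψ, SmoothPeriodic ψ → ∫ x in unitSquare, p x * fderiv ℝ ψ x (basisVec i) =
      ∫ x in unitSquare, q x * fderiv ℝ ψ x (basisVec j))
    (hpδ : ∫ x in unitSquare, (f x - p x) ^ 2 ≤ δ) (hqδ : ∫ x in unitSquare, q x ^ 2 ≤ δ)
    (hh : 0 < h) (ht : 0 ≤ t) (hψ : SmoothPeriodic ψ) (hψb : ∀ x, |ψ x| ≤ 2) :
    ∫ x in unitSquare, (f (x + t • basisVec i) - f x) * ψ x ≤
      4 * T * h + (2 + 2 * t / h) * (√δ * √(∫ x in unitSquare, ψ x ^ 2)) := by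
  have hfi := integrableOn_of_bounded hf hb
  have hfs : IntegrableOn (fun x => f (x + t • basisVec i)) unitSquare :=
    integrableOn_of_bounded (hf.comp (measurable_add_const _)) fun x => hb _
  have hpi := integrableOn_unitSquare_of_memLp hp
  have hfp : MemLp (fun x => f x - p x) 2 (volume.restrict unitSquare) :=
    (MemLp.of_bound hf.aestronglyMeasurable 1 (.of_forall hb)).sub hp
  have hgi : IntegrableOn (fun x => f (x + t • basisVec i) - f x) unitSquare := hfs.sub hfi
  set m := √δ * √(∫ x in unitSquare, ψ x ^ 2)
  have hgT : DerivBound (fun x => f (x + t • basisVec i) - f x) j (T + T) :=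
    (hT.comp_add_right hper _).sub hT hfs hfi
  set A : ℝ → ℝ := fun r => ∫ x in unitSquare,
    (f (x + t • basisVec i) - f x) * ψ (x + r • basisVec j)
  set B : ℝ → ℝ := fun r =>
    (∫ x in unitSquare, p x * ψ (x + (r • basisVec j + t • -basisVec i))) -
      ∫ x in unitSquare, p x * ψ (x + r • basisVec j)
  have hAB : ∀ r, A r ≤ B r + 2 * m := fun r => by
    have hψr := hψ.comp_add_right (r • basisVec j)
    have hψt := hψ.comp_add_right (r • basisVec j + t • -basisVec i)
    have e1 : A r = (∫ x in unitSquare, f x * ψ (x + (r • basisVec j + t • -basisVec i))) -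
        ∫ x in unitSquare, f x * ψ (x + r • basisVec j) := by
      simp only [A, sub_mul]
      rw [integral_sub (hψr.mul_integrable hfs) (hψr.mul_integrable hfi),
        setIntegral_comp_mul hper hψr.periodic]
      congr 3
      ext x
      congr 2
      rw [smul_neg]; abel
    have e2 : ∀ v, ∫ x in unitSquare, f x * ψ (x + v) =
        (∫ x in unitSquare, (f x - p x) * ψ (x + v)) + ∫ x in unitSquare, p x * ψ (x + v) := by
      intro v
      have hv := hψ.comp_add_right v
      rw [← integral_add (hv.mul_integrable (f := fun x => f x - p x) (hfi.sub hpi)) (hv.mul_integrable hpi)]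
      simp only [sub_mul, sub_add_cancel]
    have b1 := abs_le.1 (hψ.abs_pairing_le hfp hpδ (r • basisVec j + t • -basisVec i))
    have b2 := abs_le.1 (hψ.abs_pairing_le hfp hpδ (r • basisVec j))
    rw [e1, e2, e2]
    simp only [B]
    linarith [b1.2, b2.1]
  have hA0 : ∀ r ∈ Icc 0 h, A 0 - 2 * (T + T) * h - 2 * m ≤ B r := fun r hr => by
    have h1 := abs_le.1 (hgT.abs_pairing_sub_le hgi hψ two_pos hψb r hr.1 (c := 1) (by simp))
    have h0 : 0 ≤ T + T := (abs_nonneg _).trans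
      (hgT (fun _ => 0) ⟨contDiff_const, fun _ _ => rfl⟩ (by simp))
    have h2 : 2 * (T + T) * r ≤ 2 * (T + T) * h := by gcongr; exact hr.2
    have h3 : A 0 = ∫ x in unitSquare, (f (x + t • basisVec i) - f x) * ψ x := by simp [A]
    have h4 := h1.1
    rw [← h3, mul_one] at h4
    change _ ≤ A r - A 0 at h4
    linarith [hAB r]
  have hBc : Continuous B := by
    have := hψ.continuous_pairing hpi
    exact (this.comp (by fun_prop)).sub (this.comp (by fun_prop))
  have hint : h * (A 0 - 2 * (T + T) * h - 2 * m) ≤ ∫ r in (0 : ℝ)..h, B r := by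
    have := intervalIntegral.integral_mono_on hh.le (intervalIntegrable_const (μ := volume))
      (hBc.intervalIntegrable 0 h) hA0
    rwa [intervalIntegral.integral_const, sub_zero, smul_eq_mul] at this
  have hfin := hint.trans (curlFree_average_le hpi hq hcurl hqδ ht hψ)
  have h3 : A 0 = ∫ x in unitSquare, (f (x + t • basisVec i) - f x) * ψ x := by simp [A]
  rw [← h3]
  have h5 : A 0 - 2 * (T + T) * h - 2 * m ≤ 2 * t / h * m := by
    rw [div_mul_eq_mul_div, le_div_iff₀ hh]; linarith
  linarith

/-- The increments of `f` in direction `i` are controlled by the distance of `f` to a component `p`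
of a curl-free pair, by the other component `q` of that pair, and by the variation of `f` in
direction `j`. -/
theorem curlFree_sq_sub_le {f p q : Plane → ℝ} {i j : Fin 2} {T δ h t : ℝ}
    (hf : Measurable f) (hper : ∀ j x, f (x + basisVec j) = f x) (hb : ∀ x, |f x| ≤ 1)
    (hT : DerivBound f j T) (hp : MemLp p 2 (volume.restrict unitSquare))
    (hq : MemLp q 2 (volume.restrict unitSquare))
    (hcurl : ∀ ψ, SmoothPeriodic ψ → ∫ x in unitSquare, p x * fderiv ℝ ψ x (basisVec i) =
      ∫ x in unitSquare, q x * fderiv ℝ ψ x (basisVec j))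
    (hpδ : ∫ x in unitSquare, (f x - p x) ^ 2 ≤ δ) (hqδ : ∫ x in unitSquare, q x ^ 2 ≤ δ)
    (hh : 0 < h) (ht : 0 ≤ t) :
    ∫ x in unitSquare, (f (x + t • basisVec i) - f x) ^ 2 ≤
      8 * T * h + (2 + 2 * t / h) ^ 2 * δ := by
  have hgm : Measurable fun x => f (x + t • basisVec i) - f x :=
    (hf.comp (measurable_add_const _)).sub hf
  have hgb : ∀ x, |f (x + t • basisVec i) - f x| ≤ 2 := fun x =>
    (abs_sub _ _).trans (by linarith [hb x, hb (x + t • basisVec i)])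
  obtain ⟨ψ, hψs, hψp, hψb, hlim⟩ := exists_smooth_periodic_approx hgm (fun k x => by
    simp only [add_right_comm _ (basisVec k), hper]) hgb
  obtain ⟨l1, l2⟩ := tendsto_pairing hgm hgb (fun n => (hψs n).continuous) hψb hlim
  -- With ψ tending to the increment, the squared norm X satisfies X ≤ 4Th + (2 + 2t/h)√δ√X.
  have key := le_of_tendsto_of_tendsto' l1
    (((l2.sqrt.const_mul (√δ)).const_mul (2 + 2 * t / h)).const_add (4 * T * h))
    fun n => curlFree_pairing_le hf hper hb hT hp hq hcurl hpδ hqδ hh ht ⟨hψs n, hψp n⟩ (hψb n)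
  set X := ∫ x in unitSquare, (f (x + t • basisVec i) - f x) ^ 2
  have hX : 0 ≤ X := integral_nonneg fun x => sq_nonneg _
  have hδ : 0 ≤ δ := (integral_nonneg fun x => sq_nonneg _).trans hqδ
  have e1 := Real.sq_sqrt hX
  have e2 := Real.sq_sqrt hδ
  rw [← e2]
  rw [← e1] at key ⊢
  rw [Real.sqrt_sq (Real.sqrt_nonneg X)] at key
  -- Young's inequality absorbs half of X into the left side, which doubles `4Th` to `8Th`.
  nlinarith [sq_nonneg (√X - (2 + 2 * t / h) * √δ)]

/-! ### Passing between integrals over the plane and over the torus -/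

theorem basisVec_apply (i j : Fin 2) : basisVec j i = if i = j then 1 else 0 := by
  simp [basisVec]

/-- The interval [-1, 1) meets just two integer translates of [0, 1), so unfolding in one coordinate
gives two terms, and in both coordinates four. -/
theorem integral_eq_setIntegral_strip (j : Fin 2) {F : Plane → ℝ} (hF : Integrable F)
    (h0 : ∀ x, F x ≠ 0 → x j ∈ Ico (-1 : ℝ) 1) :
    ∫ x, F x = ∫ x in {x : Plane | x j ∈ Ico (0 : ℝ) 1}, (F x + F (x - basisVec j)) := by
  set S : Set Plane := {x | x j ∈ Ico (0 : ℝ) 1} with hS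
  have hSm : MeasurableSet S := by
    have : Measurable fun x : Plane => x j := by fun_prop
    exact this measurableSet_Ico
  have hF' : Integrable fun x => F (x - basisVec j) := hF.comp_sub_right _
  have h1 : ∀ x, F x = S.indicator F x +
      S.indicator (fun y => F (y - basisVec j)) (x + basisVec j) := fun x => by
    by_cases hx : F x = 0
    · simp [Set.indicator_apply, hx]
    · have hb := h0 x hx
      have hj : (x + basisVec j) j = x j + 1 := by simp [basisVec_apply]
      rcases lt_or_ge (x j) 0 with h | h
      · have a1 : x ∉ S := fun hxS => absurd hxS.1 (not_le.2 h)
        have a2 : x + basisVec j ∈ S := by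
          rw [hS, mem_ofPred_eq, hj]; constructor <;> linarith [hb.1]
        simp [a1, a2]
      · have a1 : x ∈ S := ⟨h, hb.2⟩
        have a2 : x + basisVec j ∉ S := fun hxS => by
          rw [hS, mem_ofPred_eq, hj] at hxS; linarith [hxS.2]
        simp [a1, a2]
  calc ∫ x, F x = ∫ x, (S.indicator F x +
        S.indicator (fun y => F (y - basisVec j)) (x + basisVec j)) := integral_congr_ae (.of_forall h1)
    _ = (∫ x, S.indicator F x) + ∫ x, S.indicator (fun y => F (y - basisVec j)) x := by
        rw [integral_add (hF.indicator hSm) ((hF'.indicator hSm).comp_add_right _),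
          integral_add_right_eq_self]
    _ = _ := by
        rw [integral_indicator hSm, integral_indicator hSm, integral_add hF.integrableOn
          hF'.integrableOn]

theorem integral_eq_setIntegral_cell {F : Plane → ℝ} (hF : Integrable F)
    (h0 : ∀ x, F x ≠ 0 → ∀ i, x i ∈ Ico (-1 : ℝ) 1) :
    ∫ x, F x = ∫ x in unitSquare, (F x + F (x - basisVec 0) +
      (F (x - basisVec 1) + F (x - basisVec 1 - basisVec 0))) := by
  have hSm : ∀ j, MeasurableSet {x : Plane | x j ∈ Ico (0 : ℝ) 1} := fun j => by
    have : Measurable fun x : Plane => x j := by fun_prop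
    exact this measurableSet_Ico
  have hcell : cell = {x : Plane | x 1 ∈ Ico (0 : ℝ) 1} ∩ {x : Plane | x 0 ∈ Ico (0 : ℝ) 1} := by
    ext x; simp only [cell, Fin.forall_fin_two, mem_inter_iff, mem_ofPred_eq, and_comm]
  rw [integral_eq_setIntegral_strip 0 hF fun x hx => h0 x hx 0, ← integral_indicator (hSm 0),
    integral_eq_setIntegral_strip 1, ← restrict_cell, hcell, ← setIntegral_indicator (hSm 0)]
  · refine setIntegral_congr_fun (hSm 1) fun x _ => ?_
    have h : x - basisVec 1 ∈ {x : Plane | x 0 ∈ Ico (0 : ℝ) 1} ↔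
        x ∈ {x : Plane | x 0 ∈ Ico (0 : ℝ) 1} := by simp [basisVec_apply]
    simp only [Set.indicator_apply, h]
    split_ifs <;> simp
  · exact (hF.add (hF.comp_sub_right _)).indicator (hSm 0)
  · intro x hx
    by_contra h1
    have a1 : F x = 0 := by by_contra h; exact h1 (h0 x h 1)
    have a2 : F (x - basisVec 0) = 0 := by
      by_contra h; have := h0 _ h 1; simp [basisVec_apply] at this; exact h1 this
    simp [Set.indicator_apply, a1, a2] at hx


/-- A smooth cutoff function, with values `0` below `1/4` and `1` above `3/4`. -/
noncomputable def step (s : ℝ) : ℝ := Real.smoothTransition (2 * s - 1 / 2)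

theorem contDiff_step : ContDiff ℝ ∞ step :=
  Real.smoothTransition.contDiff.comp ((contDiff_const.mul contDiff_id).sub contDiff_const)

theorem step_of_le {s : ℝ} (h : s ≤ 1 / 4) : step s = 0 :=
  Real.smoothTransition.zero_of_nonpos (by linarith)

theorem step_of_ge {s : ℝ} (h : 3 / 4 ≤ s) : step s = 1 :=
  Real.smoothTransition.one_of_one_le (by linarith)

/-- A smooth cutoff function whose integer translates form a partition of unity. -/
noncomputable def hat (s : ℝ) : ℝ := step (s + 1) - step s

theorem contDiff_hat : ContDiff ℝ ∞ hat :=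
  (contDiff_step.comp (contDiff_id.add contDiff_const)).sub contDiff_step

theorem hat_ne_zero {s : ℝ} (h : hat s ≠ 0) : s ∈ Icc (-3 / 4 : ℝ) (3 / 4) := by
  contrapose! h
  rw [mem_Icc, not_and_or, not_le, not_le] at h
  rcases h with h | h
  · rw [hat, step_of_le (by linarith), step_of_le (by linarith), sub_zero]
  · rw [hat, step_of_ge (by linarith), step_of_ge (by linarith), sub_self]

/-- The identity holds on an open neighbourhood of [0, 1], so that it may be differentiated at the
end points too. -/
theorem hat_add_hat {s : ℝ} (h : s ∈ Ioo (-1 / 4 : ℝ) (5 / 4)) : hat s + hat (s - 1) = 1 := by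
  rw [hat, hat, step_of_ge (s := s + 1) (by linarith [h.1]), step_of_le (s := s - 1)
    (by linarith [h.2])]
  simp

/-- A smooth function with compact support whose translates by integer vectors form a partition of
unity. -/
noncomputable def planeHat (x : Plane) : ℝ := hat (x 0) * hat (x 1)

theorem contDiff_planeHat : ContDiff ℝ ∞ planeHat := by
  have h : ∀ i : Fin 2, ContDiff ℝ ∞ fun x : Plane => hat (x i) := fun i =>
    contDiff_hat.comp (by fun_prop)
  exact (h 0).mul (h 1)

theorem tsupport_planeHat_subset :
    tsupport planeHat ⊆ {x | ∀ i, x i ∈ Icc (-3 / 4 : ℝ) (3 / 4)} := by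
  refine closure_minimal (fun x h i => ?_) ?_
  · have h0 := left_ne_zero_of_mul h
    have h1 := right_ne_zero_of_mul h
    fin_cases i
    · exact hat_ne_zero h0
    · exact hat_ne_zero h1
  · rw [ofPred_forall]
    exact isClosed_iInter fun i => isClosed_Icc.preimage (by fun_prop : Continuous fun x : Plane => x i)

theorem hasCompactSupport_planeHat : HasCompactSupport planeHat := by
  refine HasCompactSupport.intro' (K := (WithLp.toLp 2 : (Fin 2 → ℝ) → Plane) ''
    (univ.pi fun _ => Icc (-3 / 4 : ℝ) (3 / 4))) ?_ ?_ ?_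
  · exact (isCompact_univ_pi fun _ => isCompact_Icc).image (PiLp.continuous_toLp 2 _)
  · exact ((isCompact_univ_pi fun _ => isCompact_Icc).image
      (PiLp.continuous_toLp 2 _)).isClosed
  · intro x hx
    by_contra h
    exact hx ⟨x.ofLp, fun i _ => tsupport_planeHat_subset (subset_tsupport _ h) i, rfl⟩

theorem sum_planeHat {x : Plane} (h : ∀ i, x i ∈ Ioo (-1 / 4 : ℝ) (5 / 4)) :
    planeHat x + planeHat (x - basisVec 0) +
      (planeHat (x - basisVec 1) + planeHat (x - basisVec 1 - basisVec 0)) = 1 := by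
  simp only [planeHat, PiLp.sub_apply, basisVec_apply]
  norm_num
  have h0 := hat_add_hat (h 0)
  have h1 := hat_add_hat (h 1)
  calc _ = (hat (x 0) + hat (x 0 - 1)) * (hat (x 1) + hat (x 1 - 1)) := by ring
    _ = 1 := by rw [h0, h1, one_mul]

theorem integral_mul_eq_setIntegral_mul {P w q : Plane → ℝ} (hP : LocallyIntegrable P)
    (hper : ∀ j, ∀ᵐ x, P (x + basisVec j) = P x) (hw : Continuous w) (hwc : HasCompactSupport w)
    (hws : ∀ x, w x ≠ 0 → ∀ i, x i ∈ Ico (-1 : ℝ) 1)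
    (hq : ∀ x ∈ unitSquare, w x + w (x - basisVec 0) +
      (w (x - basisVec 1) + w (x - basisVec 1 - basisVec 0)) = q x) :
    ∫ x, P x * w x = ∫ x in unitSquare, P x * q x := by
  have hint : Integrable fun x => P x * w x := by
    simpa using hP.integrable_smul_right_of_hasCompactSupport hw hwc
  rw [integral_eq_setIntegral_cell hint fun x hx => hws x (right_ne_zero_of_mul hx)]
  have hsub : ∀ j v, ∀ᵐ x, P (x - v - basisVec j) = P (x - v) := fun j v => by
    have := (measurePreserving_sub_right volume (v + basisVec j)).quasiMeasurePreserving.ae (hper j)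
    filter_upwards [this] with x hx
    rw [← sub_sub, sub_add_cancel] at hx
    exact hx.symm
  refine setIntegral_congr_ae measurableSet_unitSquare ?_
  filter_upwards [hsub 0 0, hsub 1 0, hsub 0 (basisVec 1)] with x h0 h1 h2 hx
  rw [sub_zero] at h0 h1
  rw [h2, h0, h1, ← hq x hx]; ring

/-- Every smooth periodic function is the periodization of a test function with compact support;
this turns integrals against test functions into integrals over the torus. -/
theorem SmoothPeriodic.exists_periodization {ψ : Plane → ℝ} (hψ : SmoothPeriodic ψ) :
    ∃ θ : Plane → ℝ, ContDiff ℝ ∞ θ ∧ HasCompactSupport θ ∧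
      ∀ P : Plane → ℝ, LocallyIntegrable P → (∀ j, ∀ᵐ x, P (x + basisVec j) = P x) →
        (∫ x, P x * θ x = ∫ x in unitSquare, P x * ψ x) ∧
        ∀ v, ∫ x, P x * fderiv ℝ θ x v = ∫ x in unitSquare, P x * fderiv ℝ ψ x v := by
  set θ : Plane → ℝ := fun x => planeHat x * ψ x with hθ
  have hθs : ContDiff ℝ ∞ θ := contDiff_planeHat.mul hψ.smooth
  have hθc : HasCompactSupport θ := hasCompactSupport_planeHat.mul_right
  have hψm : ∀ j x, ψ (x - basisVec j) = ψ x := fun j x => by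
    rw [← hψ.periodic j, sub_add_cancel]
  have hsum : ∀ x : Plane, (∀ i, x i ∈ Ioo (-1 / 4 : ℝ) (5 / 4)) → θ x + θ (x - basisVec 0) +
      (θ (x - basisVec 1) + θ (x - basisVec 1 - basisVec 0)) = ψ x := fun x hx => by
    simp only [hθ, hψm, ← add_mul, sum_planeHat hx, one_mul]
  -- Every point of the closed square has a neighbourhood where the translates of θ sum to ψ, hence
  -- the derivatives sum to that of ψ as well.
  have hnhds : ∀ x ∈ unitSquare, ∀ᶠ y in 𝓝 x, ∀ i, y i ∈ Ioo (-1 / 4 : ℝ) (5 / 4) := by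
    intro x hx
    rw [eventually_all]
    intro i
    have hc : Continuous fun y : Plane => y i := by fun_prop
    exact hc.continuousAt.eventually (Ioo_mem_nhds (by linarith [(hx i).1]) (by linarith [(hx i).2]))
  have hbox : ∀ x ∈ tsupport θ, ∀ i, x i ∈ Ico (-1 : ℝ) 1 := fun x hx i =>
    Icc_subset_Ico (by norm_num) (by norm_num)
      (tsupport_planeHat_subset (tsupport_mul_subset_left hx) i)
  refine ⟨θ, hθs, hθc, fun P hP hper => ⟨?_, fun v => ?_⟩⟩
  · exact integral_mul_eq_setIntegral_mul hP hper hθs.continuous hθc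
      (fun x hx => hbox x (subset_tsupport _ hx))
      fun x hx => hsum x (hnhds x hx).self_of_nhds
  · refine integral_mul_eq_setIntegral_mul hP hper
      ((hθs.continuous_fderiv (by simp)).clm_apply continuous_const) (hθc.fderiv_apply ℝ v)
      (fun x hx => hbox x (support_fderiv_subset ℝ
        fun h => hx (by rw [h]; rfl))) fun x hx => ?_
    · have hd := hθs.differentiable (by simp)
      have h1 : HasFDerivAt (fun x => θ x + θ (x - basisVec 0) +
          (θ (x - basisVec 1) + θ (x - basisVec 1 - basisVec 0)))
          (fderiv ℝ θ x + fderiv ℝ θ (x - basisVec 0) +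
          (fderiv ℝ θ (x - basisVec 1) + fderiv ℝ θ (x - basisVec 1 - basisVec 0))) x := by
        have hs : ∀ u, HasFDerivAt (fun x => θ (x - u)) (fderiv ℝ θ (x - u)) x := fun u =>
          (hasFDerivAt_comp_sub u).2 (hd (x - u)).hasFDerivAt
        have h3 := hs (basisVec 1 + basisVec 0)
        simp only [← sub_sub] at h3
        exact ((hd x).hasFDerivAt.add (hs _)).add ((hs _).add h3)
      have h2 := (h1.congr_of_eventuallyEq ((hnhds x hx).mono fun y hy => (hsum y hy).symm)).fderiv
      rw [h2]; rfl

/-! ### Deformations with periodic gradient -/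

theorem locallyIntegrable_of_memLp {f : Plane → ℝ}
    (hf : ∀ S : Set Plane, IsCompact S → MemLp f 2 (volume.restrict S)) : LocallyIntegrable f := by
  rw [locallyIntegrable_iff]
  intro S hS
  have := isFiniteMeasure_restrict.2 (hS.measure_lt_top (μ := volume)).ne
  exact (hf S hS).integrable (by norm_num)

namespace IsDeformation

variable {u : Plane → Plane} {G : Plane → Mat2}

theorem locallyIntegrable (h : IsDeformation u G) (i j : Fin 2) :
    LocallyIntegrable fun x => G x i j :=
  locallyIntegrable_of_memLp fun S hS => h.grad_memLp S hS i j

theorem memLp_unitSquare (h : IsDeformation u G) (i j : Fin 2) :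
    MemLp (fun x => G x i j) 2 (volume.restrict unitSquare) :=
  h.grad_memLp _ isCompact_unitSquare i j

/-- The rows of the gradient are curl-free on the torus. -/
theorem setIntegral_mul_fderiv_comm (h : IsDeformation u G) {ψ : Plane → ℝ}
    (hψ : SmoothPeriodic ψ) (i j k : Fin 2) :
    ∫ x in unitSquare, G x i j * fderiv ℝ ψ x (basisVec k) =
      ∫ x in unitSquare, G x i k * fderiv ℝ ψ x (basisVec j) := by
  obtain ⟨θ, hθs, hθc, hθ⟩ := hψ.exists_periodization
  have hper : ∀ i k j, ∀ᵐ x, G (x + basisVec j) i k = G x i k := fun i k j => by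
    filter_upwards [h.periodic j] with x hx
    rw [hx]
  rw [← (hθ _ (h.locallyIntegrable i j) (hper i j)).2, ← (hθ _ (h.locallyIntegrable i k) (hper i k)).2]
  have hd : ∀ k, ContDiff ℝ ∞ fun x => fderiv ℝ θ x (basisVec k) := fun k =>
    (hθs.fderiv_right (by simp)).clm_apply contDiff_const
  -- First derivatives of θ serve as test functions: both sides are then minus the integral of uᵢ
  -- against the same mixed second derivative of θ.
  have h1 := h.weakGradient i j _ (hd k) (hθc.fderiv_apply ℝ _)
  have h2 := h.weakGradient i k _ (hd j) (hθc.fderiv_apply ℝ _)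
  have hsymm : ∀ x, fderiv ℝ (fun x => fderiv ℝ θ x (basisVec k)) x (basisVec j) =
      fderiv ℝ (fun x => fderiv ℝ θ x (basisVec j)) x (basisVec k) := fun x => by
    have hdd : DifferentiableAt ℝ (fderiv ℝ θ) x :=
      (hθs.fderiv_right (m := ∞) (by simp)).differentiable (by simp) x
    rw [fderiv_clm_apply hdd (differentiableAt_const _),
      fderiv_clm_apply hdd (differentiableAt_const _)]
    simp only [fderiv_fun_const, Pi.zero_apply, ContinuousLinearMap.comp_zero, zero_add,
      ContinuousLinearMap.flip_apply]
    exact (hθs.contDiffAt.isSymmSndFDerivAt (by simp; exact WithTop.coe_le_coe.2 (le_top (a := (2 : ℕ∞))))).eq _ _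
  simp only [hsymm] at h1
  linarith [h1.symm.trans h2]

end IsDeformation

/-! ### Phase indicators -/

theorem divergence_smul_basisVec {ψ : Plane → ℝ} (hψ : Differentiable ℝ ψ) (j : Fin 2) (x : Plane) :
    divergence (fun x => ψ x • basisVec j) x = fderiv ℝ ψ x (basisVec j) := by
  have h : fderiv ℝ (fun x => ψ x • basisVec j) x = (fderiv ℝ ψ x).smulRight (basisVec j) :=
    fderiv_smul_const (hψ x) _
  simp only [divergence, h, ContinuousLinearMap.smulRight_apply, PiLp.smul_apply, basisVec_apply]
  simp

namespace IsPhase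

variable {χ : Fin 3 → Plane → ℝ}

theorem abs_le_one (h : IsPhase χ) (k : Fin 3) (x : Plane) : |χ k x| ≤ 1 := by
  rcases h.zero_or_one k x with h | h <;> simp [h]

theorem integrableOn (h : IsPhase χ) (k : Fin 3) : IntegrableOn (χ k) unitSquare :=
  integrableOn_of_bounded (h.measurable k) (h.abs_le_one k)

theorem derivBound (h : IsPhase χ) (k : Fin 3) (j : Fin 2) :
    DerivBound (χ k) j (torusTV (χ k)).toReal := by
  have key : ∀ ψ, SmoothPeriodic ψ → (∀ x, |ψ x| ≤ 1) →
      ∫ x in unitSquare, χ k x * fderiv ℝ ψ x (basisVec j) ≤ (torusTV (χ k)).toReal := by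
    intro ψ hψ hb
    rw [← ENNReal.ofReal_le_iff_le_toReal (h.finite_tv k).ne]
    have := le_iSup (fun φ : {φ : Plane → Plane // ContDiff ℝ ∞ φ ∧
        (∀ j x, φ (x + basisVec j) = φ x) ∧ ∀ x, ‖φ x‖ ≤ 1} =>
        ENNReal.ofReal (∫ x in unitSquare, χ k x * divergence φ.1 x))
      ⟨fun x => ψ x • basisVec j, hψ.smooth.smul contDiff_const,
        fun i x => by simp only [hψ.periodic], fun x => by
          rw [norm_smul, basisVec, PiLp.norm_single]; simpa using hb x⟩
    simp only [divergence_smul_basisVec hψ.differentiable] at this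
    exact this
  intro ψ hψ hb
  refine abs_le.2 ⟨?_, key ψ hψ hb⟩
  -- `torusTV` sees only positive values of the pairing; the lower bound comes from the test
  -- function -ψ.
  have h1 := key _ (hψ.const_mul (-1)) (fun x => by simpa using hb x)
  have h2 : ∀ x, fderiv ℝ (fun x => -1 * ψ x) x (basisVec j) = -fderiv ℝ ψ x (basisVec j) :=
    fun x => by rw [fderiv_const_mul (hψ.differentiable x)]; simp
  simp only [h2, mul_neg, integral_neg] at h1
  linarith

end IsPhase

/-! ### Translation estimates for phases -/

/-- The first diagonal entry of the matrix field of a phase. -/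
def diagOne (χ : Fin 3 → Plane → ℝ) (x : Plane) : ℝ := χ 0 x - χ 1 x - χ 2 x

/-- The second diagonal entry of the matrix field of a phase. -/
def diagTwo (χ : Fin 3 → Plane → ℝ) (x : Plane) : ℝ := χ 2 x - χ 1 x

/-- The sum of the total variations of the indicators of a phase. -/
noncomputable def totalTV (χ : Fin 3 → Plane → ℝ) : ℝ := ∑ j, (torusTV (χ j)).toReal

/-- The elastic energy, as a real number. -/
noncomputable def elastic (G : Plane → Mat2) (χ : Fin 3 → Plane → ℝ) : ℝ :=
  ∫ x in unitSquare, ∑ i, ∑ j, (G x i j - phaseMatrix χ x i j) ^ 2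

theorem phaseMatrix_zero_zero (χ : Fin 3 → Plane → ℝ) (x : Plane) :
    phaseMatrix χ x 0 0 = diagOne χ x := by
  simp [phaseMatrix, Fin.sum_univ_three, well, Matrix.add_apply, diagOne]
  ring

theorem phaseMatrix_one_one (χ : Fin 3 → Plane → ℝ) (x : Plane) :
    phaseMatrix χ x 1 1 = diagTwo χ x := by
  simp [phaseMatrix, Fin.sum_univ_three, well, Matrix.add_apply, diagTwo]
  ring

theorem phaseMatrix_zero_one (χ : Fin 3 → Plane → ℝ) (x : Plane) : phaseMatrix χ x 0 1 = 0 := by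
  simp [phaseMatrix, Fin.sum_univ_three, well, Matrix.add_apply]

theorem phaseMatrix_one_zero (χ : Fin 3 → Plane → ℝ) (x : Plane) : phaseMatrix χ x 1 0 = 0 := by
  simp [phaseMatrix, Fin.sum_univ_three, well, Matrix.add_apply]

theorem totalTV_nonneg (χ : Fin 3 → Plane → ℝ) : 0 ≤ totalTV χ :=
  Finset.sum_nonneg fun _ _ => ENNReal.toReal_nonneg

namespace IsPhase

variable {χ : Fin 3 → Plane → ℝ}

theorem cases (h : IsPhase χ) (x : Plane) :
    (χ 0 x = 1 ∧ χ 1 x = 0 ∧ χ 2 x = 0) ∨ (χ 0 x = 0 ∧ χ 1 x = 1 ∧ χ 2 x = 0) ∨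
      (χ 0 x = 0 ∧ χ 1 x = 0 ∧ χ 2 x = 1) := by
  have hs := h.sum_eq_one x
  simp only [Fin.sum_univ_three] at hs
  rcases h.zero_or_one 0 x with h0 | h0 <;> rcases h.zero_or_one 1 x with h1 | h1 <;>
    rcases h.zero_or_one 2 x with h2 | h2 <;> rw [h0, h1, h2] at hs <;> norm_num at hs <;>
    simp [h0, h1, h2]

theorem measurable_diagOne (h : IsPhase χ) : Measurable (diagOne χ) :=
  ((h.measurable 0).sub (h.measurable 1)).sub (h.measurable 2)

theorem measurable_diagTwo (h : IsPhase χ) : Measurable (diagTwo χ) :=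
  (h.measurable 2).sub (h.measurable 1)

theorem diagOne_periodic (h : IsPhase χ) (j : Fin 2) (x : Plane) :
    diagOne χ (x + basisVec j) = diagOne χ x := by simp only [diagOne, h.periodic]

theorem diagTwo_periodic (h : IsPhase χ) (j : Fin 2) (x : Plane) :
    diagTwo χ (x + basisVec j) = diagTwo χ x := by simp only [diagTwo, h.periodic]

theorem diagTwo_cases (h : IsPhase χ) (x : Plane) :
    diagTwo χ x = 0 ∨ diagTwo χ x = 1 ∨ diagTwo χ x = -1 := by
  rcases h.cases x with ⟨h0, h1, h2⟩ | ⟨h0, h1, h2⟩ | ⟨h0, h1, h2⟩ <;> simp [diagTwo, h1, h2]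

theorem abs_diagTwo_le (h : IsPhase χ) (x : Plane) : |diagTwo χ x| ≤ 1 := by
  rcases h.diagTwo_cases x with h | h | h <;> simp [h]

/-- This nonlinear relation between the two entries, valid only on the wells, is what transfers
invariance in x₁ from χ₂₂ to χ₁₁. -/
theorem diagOne_eq (h : IsPhase χ) (x : Plane) : diagOne χ x = 1 - 2 * diagTwo χ x ^ 2 := by
  rcases h.cases x with ⟨h0, h1, h2⟩ | ⟨h0, h1, h2⟩ | ⟨h0, h1, h2⟩ <;>
    norm_num [diagOne, diagTwo, h0, h1, h2]

theorem diagOne_eq_two_mul (h : IsPhase χ) (x : Plane) : diagOne χ x = 2 * χ 0 x - 1 := by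
  rcases h.cases x with ⟨h0, h1, h2⟩ | ⟨h0, h1, h2⟩ | ⟨h0, h1, h2⟩ <;>
    norm_num [diagOne, h0, h1, h2]

theorem diagOne_sq (h : IsPhase χ) (x : Plane) : diagOne χ x ^ 2 = 1 := by
  rcases h.cases x with ⟨h0, h1, h2⟩ | ⟨h0, h1, h2⟩ | ⟨h0, h1, h2⟩ <;>
    simp [diagOne, h0, h1, h2]

theorem abs_diagOne_le (h : IsPhase χ) (x : Plane) : |diagOne χ x| ≤ 1 :=
  (sq_le_one_iff_abs_le_one _).1 (h.diagOne_sq x).le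

theorem integrableOn_diagOne (h : IsPhase χ) : IntegrableOn (diagOne χ) unitSquare :=
  integrableOn_of_bounded h.measurable_diagOne h.abs_diagOne_le

/-- Since 2|a² - b²| = 2|a - b||a + b| and |a + b| ≤ 1 for distinct a, b in {0, 1, -1}, the constant
is 2² = 4. -/
theorem diagOne_sub_sq_le (h : IsPhase χ) (x y : Plane) :
    (diagOne χ x - diagOne χ y) ^ 2 ≤ 4 * (diagTwo χ x - diagTwo χ y) ^ 2 := by
  rw [h.diagOne_eq, h.diagOne_eq]
  rcases h.diagTwo_cases x with hx | hx | hx <;> rcases h.diagTwo_cases y with hy | hy | hy <;>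
    rw [hx, hy] <;> norm_num

theorem derivBound_diagOne (h : IsPhase χ) (j : Fin 2) : DerivBound (diagOne χ) j (totalTV χ) := by
  have := ((h.derivBound 0 j).sub (h.derivBound 1 j) (h.integrableOn 0) (h.integrableOn 1)).sub
    (h.derivBound 2 j) ((h.integrableOn 0).sub (h.integrableOn 1)) (h.integrableOn 2)
  rw [totalTV, Fin.sum_univ_three]
  exact this

theorem derivBound_diagTwo (h : IsPhase χ) (j : Fin 2) : DerivBound (diagTwo χ) j (totalTV χ) := by
  intro ψ hψ hb
  refine ((h.derivBound 2 j).sub (h.derivBound 1 j) (h.integrableOn 2) (h.integrableOn 1)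
    ψ hψ hb).trans ?_
  rw [totalTV, Fin.sum_univ_three]
  linarith [ENNReal.toReal_nonneg (a := torusTV (χ 0))]

theorem memLp_phaseMatrix (h : IsPhase χ) (i j : Fin 2) :
    MemLp (fun x => phaseMatrix χ x i j) 2 (volume.restrict unitSquare) := by
  fin_cases i <;> fin_cases j <;> simp only [Fin.zero_eta, Fin.mk_one]
  · simp only [phaseMatrix_zero_zero]
    exact .of_bound h.measurable_diagOne.aestronglyMeasurable 1 (.of_forall h.abs_diagOne_le)
  · simp [phaseMatrix_zero_one]
  · simp [phaseMatrix_one_zero]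
  · simp only [phaseMatrix_one_one]
    exact .of_bound h.measurable_diagTwo.aestronglyMeasurable 1 (.of_forall h.abs_diagTwo_le)

end IsPhase

/-! ### The elastic energy as a real number -/

section Elastic

variable {χ : Fin 3 → Plane → ℝ} {u : Plane → Plane} {G : Plane → Mat2}

theorem integrableOn_elastic_term (h : IsPhase χ) (hu : IsDeformation u G) (i j : Fin 2) :
    IntegrableOn (fun x => (G x i j - phaseMatrix χ x i j) ^ 2) unitSquare :=
  ((hu.memLp_unitSquare i j).sub (h.memLp_phaseMatrix i j)).integrable_sq

theorem integral_elastic_term_le (h : IsPhase χ) (hu : IsDeformation u G) (i j : Fin 2) :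
    ∫ x in unitSquare, (G x i j - phaseMatrix χ x i j) ^ 2 ≤ elastic G χ := by
  refine integral_mono (integrableOn_elastic_term h hu i j) (integrable_finsetSum _ fun i _ =>
    integrable_finsetSum _ fun j _ => integrableOn_elastic_term h hu i j) fun x => ?_
  have h1 : ∀ i j, 0 ≤ (G x i j - phaseMatrix χ x i j) ^ 2 := fun i j => sq_nonneg _
  exact (Finset.single_le_sum (f := fun j => (G x i j - phaseMatrix χ x i j) ^ 2)
    (fun j _ => h1 i j) (Finset.mem_univ j)).trans
    (Finset.single_le_sum (f := fun i => ∑ j, (G x i j - phaseMatrix χ x i j) ^ 2)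
      (fun i _ => Finset.sum_nonneg fun j _ => h1 i j) (Finset.mem_univ i))

theorem elastic_nonneg (G : Plane → Mat2) (χ : Fin 3 → Plane → ℝ) : 0 ≤ elastic G χ :=
  integral_nonneg fun _ => Finset.sum_nonneg fun _ _ => Finset.sum_nonneg fun _ _ => sq_nonneg _

theorem energy_eq_ofReal (h : IsPhase χ) (hu : IsDeformation u G) {ε : ℝ} (hε : 0 ≤ ε) :
    energy ε G χ = ENNReal.ofReal (elastic G χ + ε * totalTV χ) := by
  rw [ENNReal.ofReal_add (elastic_nonneg G χ) (mul_nonneg hε (totalTV_nonneg χ)), energy, elastic,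
    ofReal_integral_eq_lintegral_ofReal, ENNReal.ofReal_mul hε, totalTV,
    ENNReal.ofReal_sum_of_nonneg fun _ _ => ENNReal.toReal_nonneg]
  · simp only [ENNReal.ofReal_toReal (h.finite_tv _).ne]
  · exact integrable_finsetSum _ fun i _ => integrable_finsetSum _ fun j _ =>
      integrableOn_elastic_term h hu i j
  · exact .of_forall fun _ => Finset.sum_nonneg fun _ _ => Finset.sum_nonneg fun _ _ => sq_nonneg _

end Elastic

/-- With h = ε^(1/3) the two costs of `curlFree_sq_sub_le` balance: hT = ε^(-2/3)·εT and δ/h² =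
ε^(-2/3)δ. For h ≤ 1 and t ≤ 1 one has 2 + 2t/h ≤ 4/h, whence the constant 16. -/
theorem shift_le_of_curlFree {f p q : Plane → ℝ} {i j : Fin 2} {T δ ε t : ℝ}
    (hf : Measurable f) (hper : ∀ j x, f (x + basisVec j) = f x) (hb : ∀ x, |f x| ≤ 1)
    (hT0 : 0 ≤ T) (hT : ∀ j, DerivBound f j T) (hp : MemLp p 2 (volume.restrict unitSquare))
    (hq : MemLp q 2 (volume.restrict unitSquare))
    (hcurl : ∀ ψ, SmoothPeriodic ψ → ∫ x in unitSquare, p x * fderiv ℝ ψ x (basisVec i) =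
      ∫ x in unitSquare, q x * fderiv ℝ ψ x (basisVec j))
    (hpδ : ∫ x in unitSquare, (f x - p x) ^ 2 ≤ δ) (hqδ : ∫ x in unitSquare, q x ^ 2 ≤ δ)
    (hε : 0 < ε) (ht : t ∈ Icc (0 : ℝ) 1) :
    ∫ x in unitSquare, (f (x + t • basisVec i) - f x) ^ 2 ≤
      16 * ε ^ (-(2 / 3) : ℝ) * (δ + ε * T) := by
  have hδ : 0 ≤ δ := (integral_nonneg fun x => sq_nonneg _).trans hqδ
  set h := ε ^ (1 / 3 : ℝ) with hh
  have hh0 : 0 < h := Real.rpow_pos_of_pos hε _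
  have h3 : ε = h ^ 3 := by
    rw [hh, ← Real.rpow_natCast, ← Real.rpow_mul hε.le]; norm_num
  have h2 : ε ^ (-(2 / 3) : ℝ) = (h ^ 2)⁻¹ := by
    rw [Real.rpow_neg hε.le, hh, ← Real.rpow_natCast, ← Real.rpow_mul hε.le]; norm_num
  rw [h2]
  have e1 : 16 * (h ^ 2)⁻¹ * (δ + ε * T) = 16 * δ / h ^ 2 + 16 * (h * T) := by
    rw [h3]; field_simp
  rw [e1]
  rcases le_total h 1 with hle | hge
  · refine (curlFree_sq_sub_le hf hper hb (hT j) hp hq hcurl hpδ hqδ hh0 ht.1).trans ?_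
    have e2 : 2 + 2 * t / h ≤ 4 / h := by
      rw [add_div' _ _ _ hh0.ne', div_le_div_iff_of_pos_right hh0]
      linarith [ht.2]
    have e3 : (2 + 2 * t / h) ^ 2 ≤ (4 / h) ^ 2 := by
      gcongr
      have := ht.1
      positivity
    have e4 : (2 + 2 * t / h) ^ 2 * δ ≤ (4 / h) ^ 2 * δ := by gcongr
    have e5 : (4 / h) ^ 2 * δ = 16 * δ / h ^ 2 := by field_simp; ring
    have : 0 ≤ h * T := by positivity
    linarith
  -- For h ≥ 1 no curl condition is needed: the translation estimate in BV gives 2Tt ≤ 2hT.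
  · refine ((hT i).setIntegral_sq_sub_le hf hper hb ht.1).trans ?_
    have e2 : T * t ≤ T * 1 := by gcongr; exact ht.2
    have e3 : 1 * T ≤ h * T := by gcongr
    have : 0 ≤ 16 * δ / h ^ 2 := by positivity
    linarith

theorem lintegral_sq_shift_eq {f : Plane → ℝ} (hf : Measurable f) (hb : ∀ x, |f x| ≤ 1)
    (v : Plane) :
    ∫⁻ x in unitSquare, ENNReal.ofReal ((f (x + v) - f x) ^ 2) =
      ENNReal.ofReal (∫ x in unitSquare, (f (x + v) - f x) ^ 2) := by
  rw [ofReal_integral_eq_lintegral_ofReal]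
  · refine Integrable.of_bound (((hf.comp (measurable_add_const _)).sub hf).pow_const
      2).aestronglyMeasurable (2 ^ 2) (.of_forall fun x => ?_)
    rw [norm_pow]
    exact pow_le_pow_left₀ (norm_nonneg _)
      ((abs_sub _ _).trans (by linarith [hb x, hb (x + v)])) 2
  · exact .of_forall fun x => sq_nonneg _

theorem le_mul_phaseEnergy {X : ℝ≥0∞} {c ε : ℝ} (hc : 0 < c) {χ : Fin 3 → Plane → ℝ}
    (h : ∀ u G, IsDeformation u G → X ≤ ENNReal.ofReal c * energy ε G χ) :
    X ≤ ENNReal.ofReal c * phaseEnergy ε χ := by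
  have h0 : ENNReal.ofReal c ≠ 0 := by simpa using hc
  rw [← ENNReal.div_le_iff' h0 ENNReal.ofReal_ne_top]
  exact le_iInf fun u => le_iInf fun G => le_iInf fun hu =>
    (ENNReal.div_le_iff' h0 ENNReal.ofReal_ne_top).2 (h u G hu)

namespace IsPhase

variable {χ : Fin 3 → Plane → ℝ}

/-- The curl-free pair is the second row of the gradient: ∂₂u₂ approximates χ₂₂ and ∂₁u₂
approximates the zero entry. The first row yields `lintegral_diagOne_shift_le` with the coordinates
exchanged. -/
theorem lintegral_diagTwo_shift_le (h : IsPhase χ) {ε : ℝ} (hε : 0 < ε) {t : ℝ}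
    (ht : t ∈ Icc (0 : ℝ) 1) :
    ∫⁻ x in unitSquare, ENNReal.ofReal ((diagTwo χ (x + t • basisVec 0) - diagTwo χ x) ^ 2) ≤
      ENNReal.ofReal (16 * ε ^ (-(2 / 3) : ℝ)) * phaseEnergy ε χ := by
  have hc : 0 < 16 * ε ^ (-(2 / 3) : ℝ) := by positivity
  refine le_mul_phaseEnergy hc fun u G hu => ?_
  rw [energy_eq_ofReal h hu hε.le, ← ENNReal.ofReal_mul hc.le,
    lintegral_sq_shift_eq h.measurable_diagTwo h.abs_diagTwo_le]
  refine ENNReal.ofReal_le_ofReal (shift_le_of_curlFree (i := 0) (j := 1) h.measurable_diagTwo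
    h.diagTwo_periodic h.abs_diagTwo_le (totalTV_nonneg χ) h.derivBound_diagTwo
    (hu.memLp_unitSquare 1 1) (hu.memLp_unitSquare 1 0)
    (fun ψ hψ => hu.setIntegral_mul_fderiv_comm hψ 1 1 0) ?_ ?_ hε ht)
  · have := integral_elastic_term_le h hu 1 1
    simp only [phaseMatrix_one_one] at this
    simpa only [sub_sq_comm] using this
  · have := integral_elastic_term_le h hu 1 0
    simpa only [phaseMatrix_one_zero, sub_zero] using this

theorem lintegral_diagOne_shift_le (h : IsPhase χ) {ε : ℝ} (hε : 0 < ε) {t : ℝ}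
    (ht : t ∈ Icc (0 : ℝ) 1) :
    ∫⁻ x in unitSquare, ENNReal.ofReal ((diagOne χ (x + t • basisVec 1) - diagOne χ x) ^ 2) ≤
      ENNReal.ofReal (16 * ε ^ (-(2 / 3) : ℝ)) * phaseEnergy ε χ := by
  have hc : 0 < 16 * ε ^ (-(2 / 3) : ℝ) := by positivity
  refine le_mul_phaseEnergy hc fun u G hu => ?_
  rw [energy_eq_ofReal h hu hε.le, ← ENNReal.ofReal_mul hc.le,
    lintegral_sq_shift_eq h.measurable_diagOne h.abs_diagOne_le]
  refine ENNReal.ofReal_le_ofReal (shift_le_of_curlFree (i := 1) (j := 0) h.measurable_diagOne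
    h.diagOne_periodic h.abs_diagOne_le (totalTV_nonneg χ) h.derivBound_diagOne
    (hu.memLp_unitSquare 0 0) (hu.memLp_unitSquare 0 1)
    (fun ψ hψ => hu.setIntegral_mul_fderiv_comm hψ 0 0 1) ?_ ?_ hε ht)
  · have := integral_elastic_term_le h hu 0 0
    simp only [phaseMatrix_zero_zero] at this
    simpa only [sub_sq_comm] using this
  · have := integral_elastic_term_le h hu 0 1
    simpa only [phaseMatrix_zero_one, sub_zero] using this

end IsPhase

/-! ### Rigidity -/

theorem lintegral_Icc_add_of_periodic {k : ℝ → ℝ≥0∞} (hk : Function.Periodic k 1) (c : ℝ) :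
    ∫⁻ t in Icc (0 : ℝ) 1, k (c + t) = ∫⁻ t in Icc (0 : ℝ) 1, k t := by
  have h1 := (isAddFundamentalDomain_Ioc one_pos c).setLIntegral_eq
    (isAddFundamentalDomain_Ioc (μ := volume) one_pos (0 : ℝ)) k fun g x => hk.map_vadd_zmultiples g x
  rw [zero_add] at h1
  simp only [restrict_Ioc_eq_restrict_Icc] at h1
  rw [← h1]
  have h2 := (measurePreserving_add_left volume c).setLIntegral_comp_preimage_emb
    (measurableEmbedding_addLeft c) k (Icc c (c + 1))
  rw [← h2]
  congr 2
  simp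

theorem ofReal_sq_add_le (a b : ℝ) : ENNReal.ofReal ((a + b) ^ 2) ≤
    2 * ENNReal.ofReal (a ^ 2) + 2 * ENNReal.ofReal (b ^ 2) := by
  rw [← ENNReal.ofReal_ofNat 2, ← ENNReal.ofReal_mul two_pos.le, ← ENNReal.ofReal_mul two_pos.le,
    ← ENNReal.ofReal_add (by positivity) (by positivity)]
  exact ENNReal.ofReal_le_ofReal (by nlinarith [sq_nonneg (a - b)])

/-- Some slice of a periodic function approximates it as well as its translates do on average. -/
theorem exists_slice_le {f : Plane → ℝ} (hf : Measurable f)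
    (hper : ∀ j x, f (x + basisVec j) = f x) {S : ℝ≥0∞}
    (hS : ∀ t ∈ Icc (0 : ℝ) 1,
      ∫⁻ x in unitSquare, ENNReal.ofReal ((f (x + t • basisVec 0) - f x) ^ 2) ≤ S) :
    ∃ s, ∫⁻ x in unitSquare, ENNReal.ofReal ((f x - f (point (s, x 1))) ^ 2) ≤ S := by
  have : IsProbabilityMeasure (volume.restrict (Icc (0 : ℝ) 1)) := ⟨by simp⟩
  have hx1 : Measurable fun x : Plane => x 1 := by fun_prop
  have hm : Measurable fun p : ℝ × Plane =>
      ENNReal.ofReal ((f p.2 - f (point (p.1, p.2 1))) ^ 2) := by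
    have := continuous_point.measurable
    fun_prop
  -- Some slice is no worse than the average over all slices. By periodicity in x₁, that average
  -- equals the mean of the squared increments over shifts t in [0, 1].
  obtain ⟨s, hs⟩ := exists_le_lintegral (μ := volume.restrict (Icc (0 : ℝ) 1))
    (f := fun s => ∫⁻ x in unitSquare, ENNReal.ofReal ((f x - f (point (s, x 1))) ^ 2))
    hm.lintegral_prod_right'.aemeasurable
  refine ⟨s, hs.trans ?_⟩
  rw [lintegral_lintegral_swap hm.aemeasurable]
  have h1 : ∀ x : Plane, ∫⁻ s in Icc (0 : ℝ) 1, ENNReal.ofReal ((f x - f (point (s, x 1))) ^ 2) =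
      ∫⁻ t in Icc (0 : ℝ) 1, ENNReal.ofReal ((f (x + t • basisVec 0) - f x) ^ 2) := fun x => by
    rw [← lintegral_Icc_add_of_periodic (k := fun s =>
      ENNReal.ofReal ((f x - f (point (s, x 1))) ^ 2)) (fun s => ?_) (x 0)]
    · refine lintegral_congr fun t => ?_
      have : point (x 0 + t, x 1) = x + t • basisVec 0 := by
        ext i; fin_cases i <;> simp [basisVec_apply]
      rw [this, sub_sq_comm]
    · have : point (s + 1, x 1) = point (s, x 1) + basisVec 0 := by
        ext i; fin_cases i <;> simp [basisVec_apply]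
      simp only [this, hper]
  simp only [h1]
  rw [lintegral_lintegral_swap (by fun_prop)]
  calc _ ≤ ∫⁻ t in Icc (0 : ℝ) 1, S := setLIntegral_mono' measurableSet_Icc hS
    _ = S := by simp

namespace IsPhase

variable {χ : Fin 3 → Plane → ℝ}

/-- The shift is split into a horizontal and a vertical step, with a factor 2 for each. The vertical
step is a hypothesis; the horizontal one passes through χ₂₂ at the price of a factor 4. Hence 2 + 8
= 10. -/
theorem lintegral_diagOne_shift_le_of_bounds (h : IsPhase χ) {S : ℝ≥0∞}
    (h2 : ∀ t ∈ Icc (0 : ℝ) 1, ∫⁻ x in unitSquare,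
      ENNReal.ofReal ((diagTwo χ (x + t • basisVec 0) - diagTwo χ x) ^ 2) ≤ S)
    (h1 : ∀ t ∈ Icc (0 : ℝ) 1, ∫⁻ x in unitSquare,
      ENNReal.ofReal ((diagOne χ (x + t • basisVec 1) - diagOne χ x) ^ 2) ≤ S)
    {v : Plane} (hv : v ∈ unitSquare) :
    ∫⁻ x in unitSquare, ENNReal.ofReal ((diagOne χ (x + v) - diagOne χ x) ^ 2) ≤ 10 * S := by
  have hm := h.measurable_diagOne
  have hm2 := h.measurable_diagTwo
  have hv' : ∀ x : Plane, x + v = x + v 0 • basisVec 0 + v 1 • basisVec 1 := fun x => by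
    ext i; fin_cases i <;> simp [basisVec_apply]
  have hb : ∀ x, ENNReal.ofReal ((diagOne χ (x + v) - diagOne χ x) ^ 2) ≤
      2 * ENNReal.ofReal ((diagOne χ (x + v 0 • basisVec 0 + v 1 • basisVec 1) -
        diagOne χ (x + v 0 • basisVec 0)) ^ 2) +
      8 * ENNReal.ofReal ((diagTwo χ (x + v 0 • basisVec 0) - diagTwo χ x) ^ 2) := fun x => by
    have e := ofReal_sq_add_le (diagOne χ (x + v) - diagOne χ (x + v 0 • basisVec 0))
      (diagOne χ (x + v 0 • basisVec 0) - diagOne χ x)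
    rw [sub_add_sub_cancel] at e
    rw [← hv']
    refine e.trans (add_le_add le_rfl ?_)
    have := ENNReal.ofReal_le_ofReal (h.diagOne_sub_sq_le (x + v 0 • basisVec 0) x)
    rw [ENNReal.ofReal_mul (by norm_num)] at this
    calc _ ≤ 2 * (ENNReal.ofReal 4 *
          ENNReal.ofReal ((diagTwo χ (x + v 0 • basisVec 0) - diagTwo χ x) ^ 2)) := by gcongr
      _ = _ := by rw [← mul_assoc, ENNReal.ofReal_ofNat]; norm_num
  calc _ ≤ ∫⁻ x in unitSquare, (2 * ENNReal.ofReal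
        ((diagOne χ (x + v 0 • basisVec 0 + v 1 • basisVec 1) -
          diagOne χ (x + v 0 • basisVec 0)) ^ 2) +
        8 * ENNReal.ofReal ((diagTwo χ (x + v 0 • basisVec 0) - diagTwo χ x) ^ 2)) :=
        lintegral_mono hb
    _ = 2 * (∫⁻ x in unitSquare, ENNReal.ofReal
        ((diagOne χ (x + v 0 • basisVec 0 + v 1 • basisVec 1) -
          diagOne χ (x + v 0 • basisVec 0)) ^ 2)) +
        8 * ∫⁻ x in unitSquare,
          ENNReal.ofReal ((diagTwo χ (x + v 0 • basisVec 0) - diagTwo χ x) ^ 2) := by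
        rw [lintegral_add_left (by fun_prop), lintegral_const_mul _ (by fun_prop),
          lintegral_const_mul _ (by fun_prop)]
    _ ≤ 2 * S + 8 * S := by
        rw [setLIntegral_add_right (f := fun x => ENNReal.ofReal
          ((diagOne χ (x + v 1 • basisVec 1) - diagOne χ x) ^ 2)) fun j x => by
            rw [add_right_comm, h.diagOne_periodic, h.diagOne_periodic]]
        gcongr
        · exact h1 _ (hv 1)
        · exact h2 _ (hv 0)
    _ = 10 * S := by rw [← add_mul]; norm_num

theorem abs_mean_diagOne_le (h : IsPhase χ) : |∫ x in unitSquare, diagOne χ x| ≤ 1 := by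
  have := norm_integral_le_of_norm_le_const (μ := volume.restrict unitSquare)
    (.of_forall h.abs_diagOne_le : ∀ᵐ x ∂volume.restrict unitSquare, ‖diagOne χ x‖ ≤ 1)
  simpa using this

/-- Because χ₁₁² = 1, averaging (χ₁₁(x + v) - χ₁₁(x))² over v gives 2 - 2mχ₁₁(x), which dominates
(χ₁₁(x) - m)² = 1 - 2mχ₁₁(x) + m² as m² ≤ 1. Integrating in x bounds the variance by the mean
increment. -/
theorem variance_diagOne_le (h : IsPhase χ) {S : ℝ≥0∞}
    (hS : ∀ v ∈ unitSquare,
      ∫⁻ x in unitSquare, ENNReal.ofReal ((diagOne χ (x + v) - diagOne χ x) ^ 2) ≤ S) :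
    ∫⁻ x in unitSquare, ENNReal.ofReal
      ((diagOne χ x - ∫ y in unitSquare, diagOne χ y) ^ 2) ≤ S := by
  have hm := h.measurable_diagOne
  set m := ∫ y in unitSquare, diagOne χ y with hmdef
  have hmb := abs_le.1 h.abs_mean_diagOne_le
  have key : ∀ x, ENNReal.ofReal ((diagOne χ x - m) ^ 2) ≤
      ∫⁻ v in unitSquare, ENNReal.ofReal ((diagOne χ (x + v) - diagOne χ x) ^ 2) := fun x => by
    have hs : IntegrableOn (fun v => diagOne χ (x + v)) unitSquare :=
      integrableOn_of_bounded (hm.comp (measurable_const_add _)) fun v => h.abs_diagOne_le _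
    have e1 : ∀ v, (diagOne χ (x + v) - diagOne χ x) ^ 2 =
        2 - 2 * diagOne χ x * diagOne χ (x + v) := fun v => by
      linear_combination h.diagOne_sq (x + v) + h.diagOne_sq x
    have e2 : ∫ v in unitSquare, diagOne χ (x + v) = m := by
      simp only [add_comm x]
      exact setIntegral_add_right h.diagOne_periodic x
    rw [← ofReal_integral_eq_lintegral_ofReal _ (.of_forall fun v => sq_nonneg _)]
    · refine ENNReal.ofReal_le_ofReal ?_
      simp only [e1]
      rw [integral_sub (integrable_const _) (hs.const_mul _), integral_const_mul, e2]
      simp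
      nlinarith [h.diagOne_sq x]
    · simp only [e1]
      exact (integrable_const _).sub (hs.const_mul _)
  calc _ ≤ ∫⁻ x in unitSquare, ∫⁻ v in unitSquare,
        ENNReal.ofReal ((diagOne χ (x + v) - diagOne χ x) ^ 2) := lintegral_mono key
    _ = ∫⁻ v in unitSquare, ∫⁻ x in unitSquare,
        ENNReal.ofReal ((diagOne χ (x + v) - diagOne χ x) ^ 2) :=
        lintegral_lintegral_swap (by fun_prop)
    _ ≤ ∫⁻ v in unitSquare, S := setLIntegral_mono' measurableSet_unitSquare hS
    _ = S := by simp

/-- The constants are 160 = 10·16 for the variance and 176 = 160 + 16 with the slice error. Being a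
slice of χ₂₂, the witness automatically takes values in {0, 1, -1}. -/
theorem rigidity (h : IsPhase χ) {ε : ℝ} (hε : 0 < ε) :
    (∫⁻ x in unitSquare, ENNReal.ofReal ((diagOne χ x - ∫ y in unitSquare, diagOne χ y) ^ 2) ≤
      ENNReal.ofReal (160 * ε ^ (-(2 / 3) : ℝ)) * phaseEnergy ε χ) ∧
    ∃ f : ℝ → ℝ, Measurable f ∧ (∀ t, f t = 0 ∨ f t = 1 ∨ f t = -1) ∧
      rigidityDefect χ f ≤ ENNReal.ofReal (176 * ε ^ (-(2 / 3) : ℝ)) * phaseEnergy ε χ := by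
  have h2 := fun t ht => h.lintegral_diagTwo_shift_le hε (t := t) ht
  have h1 := fun t ht => h.lintegral_diagOne_shift_le hε (t := t) ht
  set R : ℝ := ε ^ (-(2 / 3) : ℝ) with hR
  have hR0 : 0 < R := by positivity
  have hc : ∀ k : ℝ, 0 ≤ k → ENNReal.ofReal (k * R) * phaseEnergy ε χ =
      ENNReal.ofReal k * (ENNReal.ofReal R * phaseEnergy ε χ) := fun k hk => by
    rw [ENNReal.ofReal_mul hk, mul_assoc]
  have hvar : ∫⁻ x in unitSquare,
      ENNReal.ofReal ((diagOne χ x - ∫ y in unitSquare, diagOne χ y) ^ 2) ≤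
      ENNReal.ofReal (160 * R) * phaseEnergy ε χ := by
    refine (h.variance_diagOne_le fun v hv =>
      h.lintegral_diagOne_shift_le_of_bounds h2 h1 hv).trans_eq ?_
    rw [hc _ (by norm_num), hc _ (by norm_num), ← mul_assoc]
    congr 1
    rw [← ENNReal.ofReal_ofNat 10, ← ENNReal.ofReal_mul (by norm_num)]
    norm_num
  refine ⟨hvar, ?_⟩
  obtain ⟨s, hs⟩ := exists_slice_le h.measurable_diagTwo h.diagTwo_periodic h2
  refine ⟨fun y => diagTwo χ (point (s, y)), ?_, fun t => h.diagTwo_cases _, ?_⟩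
  · have := continuous_point.measurable
    have := h.measurable_diagTwo
    fun_prop
  · rw [rigidityDefect]
    simp only [phaseMatrix_zero_zero, phaseMatrix_one_one]
    refine (add_le_add hvar hs).trans_eq ?_
    rw [hc _ (by norm_num), hc _ (by norm_num), hc _ (by norm_num), ← add_mul,
      ← ENNReal.ofReal_add (by norm_num) (by norm_num)]
    norm_num

end IsPhase

/-! ### The volume fraction of the first well and the dichotomy -/

namespace IsPhase

variable {χ : Fin 3 → Plane → ℝ}

theorem mean_diagOne (h : IsPhase χ) : ∫ x in unitSquare, diagOne χ x = 2 * theta1 χ - 1 := by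
  simp only [h.diagOne_eq_two_mul]
  rw [integral_sub ((h.integrableOn 0).const_mul 2) (integrable_const _), integral_const_mul]
  simp [theta1]

theorem theta1_mem_Icc (h : IsPhase χ) : theta1 χ ∈ Icc (0 : ℝ) 1 := by
  have := abs_le.1 h.abs_mean_diagOne_le
  rw [h.mean_diagOne] at this
  constructor <;> linarith [this.1, this.2]

/-- A function with values ±1 can be close to its mean only if the mean is close to ±1. The lower
energy bound exploits this exact value. -/
theorem lintegral_variance_diagOne (h : IsPhase χ) :
    ∫⁻ x in unitSquare, ENNReal.ofReal ((diagOne χ x - ∫ y in unitSquare, diagOne χ y) ^ 2) =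
      ENNReal.ofReal (1 - (∫ y in unitSquare, diagOne χ y) ^ 2) := by
  set m := ∫ y in unitSquare, diagOne χ y
  have e : ∀ x, (diagOne χ x - m) ^ 2 = 1 + m ^ 2 - 2 * m * diagOne χ x := fun x => by
    linear_combination h.diagOne_sq x
  have hi : IntegrableOn (fun x => (diagOne χ x - m) ^ 2) unitSquare := by
    simp only [e]
    exact (integrable_const _).sub (h.integrableOn_diagOne.const_mul _)
  rw [← ofReal_integral_eq_lintegral_ofReal hi (.of_forall fun x => sq_nonneg _)]
  simp only [e]
  rw [integral_sub (integrable_const _) (h.integrableOn_diagOne.const_mul _), integral_const_mul]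
  congr 1
  change (∫ _ in unitSquare, (1 + m ^ 2)) - 2 * m * m = _
  simp
  ring

theorem lintegral_indicator_zero (h : IsPhase χ) :
    ∫⁻ x in unitSquare, ENNReal.ofReal (χ 0 x) = ENNReal.ofReal (theta1 χ) :=
  (ofReal_integral_eq_lintegral_ofReal (h.integrableOn 0) (.of_forall fun x => by
    rcases h.zero_or_one 0 x with h | h <;> simp [h])).symm

/-- The variance is 1 - (2θ₁ - 1)² = 4θ₁(1 - θ₁) ≤ 4(1 - θ₁), and χ₂₂² = 1 - χ₁ contributes another
1 - θ₁. -/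
theorem rigidityDefect_zero_le (h : IsPhase χ) :
    rigidityDefect χ (fun _ => 0) ≤ ENNReal.ofReal (5 * (1 - theta1 χ)) := by
  obtain ⟨h0, h1⟩ := h.theta1_mem_Icc
  rw [rigidityDefect]
  simp only [phaseMatrix_zero_zero, phaseMatrix_one_one, sub_zero]
  rw [h.lintegral_variance_diagOne, h.mean_diagOne]
  have e : ∀ x, diagTwo χ x ^ 2 = 1 - χ 0 x := fun x => by
    linear_combination (h.diagOne_eq x - h.diagOne_eq_two_mul x) / 2
  simp only [e]
  rw [← ofReal_integral_eq_lintegral_ofReal (f := fun x => 1 - χ 0 x)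
    ((integrable_const _).sub (h.integrableOn 0))
    (.of_forall fun x => by rcases h.zero_or_one 0 x with h | h <;> simp [h]),
    integral_sub (integrable_const _) (h.integrableOn 0)]
  have e2 : (∫ _ in unitSquare, (1 : ℝ)) - ∫ x in unitSquare, χ 0 x = 1 - theta1 χ := by
    simp [theta1]
  rw [e2, ← ENNReal.ofReal_add (by nlinarith) (by linarith)]
  exact ENNReal.ofReal_le_ofReal (by nlinarith)

/-- Only points with f = 0 change. Where χ₂₂ = ±1 the squared error was 1 and becomes at most 4,
which explains the factor 4. Where χ₂₂ = 0 it becomes 1, and there χ₁ = 1, so θ₁ pays for it. -/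
theorem rigidityDefect_ite_le (h : IsPhase χ) {f : ℝ → ℝ} (hf : Measurable f)
    (hfv : ∀ t, f t = 0 ∨ f t = 1 ∨ f t = -1) :
    rigidityDefect χ (fun t => if f t = 0 then 1 else f t) ≤
      4 * rigidityDefect χ f + ENNReal.ofReal (theta1 χ) := by
  have hx1 : Measurable fun x : Plane => x 1 := by fun_prop
  have hm := h.measurable_diagTwo
  rw [rigidityDefect, rigidityDefect, ← h.lintegral_indicator_zero]
  simp only [phaseMatrix_zero_zero, phaseMatrix_one_one]
  rw [mul_add, add_assoc]
  refine add_le_add (le_mul_of_one_le_left' (by norm_num)) ?_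
  rw [← lintegral_const_mul _ (by fun_prop), ← lintegral_add_left (by fun_prop)]
  refine lintegral_mono fun x => ?_
  rw [← ENNReal.ofReal_ofNat 4, ← ENNReal.ofReal_mul (by norm_num), ← ENNReal.ofReal_add
    (by positivity) (by rcases h.zero_or_one 0 x with h | h <;> simp [h])]
  refine ENNReal.ofReal_le_ofReal ?_
  rcases h.cases x with ⟨h0, h1, h2⟩ | ⟨h0, h1, h2⟩ | ⟨h0, h1, h2⟩ <;>
    rcases hfv (x 1) with hv | hv | hv <;> norm_num [diagTwo, h0, h1, h2, hv]

end IsPhase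

/-- One constant serves both cases: the first needs 5C₀, the second C₀ + 704 with 704 = 4·176. -/
theorem dichotomy {C₀ : ℝ} (hC₀ : 0 < C₀) {χ : Fin 3 → Plane → ℝ} (h : IsPhase χ) {ε : ℝ}
    (hε : 0 < ε) :
    (ENNReal.ofReal (1 - theta1 χ) ≤
        ENNReal.ofReal (C₀ * ε ^ (-(2 / 3) : ℝ)) * phaseEnergy ε χ →
      rigidityDefect χ (fun _ => 0) ≤
        ENNReal.ofReal ((5 * C₀ + 704) * ε ^ (-(2 / 3) : ℝ)) * phaseEnergy ε χ) ∧
    (ENNReal.ofReal (theta1 χ) ≤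
        ENNReal.ofReal (C₀ * ε ^ (-(2 / 3) : ℝ)) * phaseEnergy ε χ →
      ∃ f : ℝ → ℝ, Measurable f ∧ (∀ t, f t = 1 ∨ f t = -1) ∧
        rigidityDefect χ f ≤
          ENNReal.ofReal ((5 * C₀ + 704) * ε ^ (-(2 / 3) : ℝ)) * phaseEnergy ε χ) := by
  set R : ℝ := ε ^ (-(2 / 3) : ℝ) with hR
  have hR0 : 0 < R := by positivity
  constructor
  · intro h1
    refine h.rigidityDefect_zero_le.trans ?_
    rw [ENNReal.ofReal_mul (by norm_num)]
    calc _ ≤ ENNReal.ofReal 5 * (ENNReal.ofReal (C₀ * R) * phaseEnergy ε χ) := by gcongr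
      _ = ENNReal.ofReal (5 * C₀ * R) * phaseEnergy ε χ := by
        rw [← mul_assoc, ← ENNReal.ofReal_mul (by norm_num), mul_assoc 5]
      _ ≤ _ := by gcongr; linarith
  · intro h1
    obtain ⟨-, f, hf, hfv, hfd⟩ := h.rigidity hε
    refine ⟨fun t => if f t = 0 then 1 else f t,
      Measurable.ite (hf (measurableSet_singleton 0)) measurable_const hf, fun t => ?_, ?_⟩
    · rcases hfv t with hv | hv | hv <;> norm_num [hv]
    · refine (h.rigidityDefect_ite_le hf hfv).trans ?_
      calc _ ≤ 4 * (ENNReal.ofReal (176 * R) * phaseEnergy ε χ) +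
            ENNReal.ofReal (C₀ * R) * phaseEnergy ε χ := by gcongr
        _ = ENNReal.ofReal ((704 + C₀) * R) * phaseEnergy ε χ := by
          rw [← mul_assoc, ← add_mul, ← ENNReal.ofReal_ofNat 4, ← ENNReal.ofReal_mul (by norm_num),
            ← ENNReal.ofReal_add (by positivity) (by positivity)]
          congr 2
          ring
        _ ≤ _ := by
          refine mul_le_mul_left (ENNReal.ofReal_le_ofReal (mul_le_mul_of_nonneg_right ?_ hR0.le)) _
          linarith

/-! ### The lower bound for the energy with prescribed mean -/

/-- This ties the prescribed mean of ∂₁u₁ to the mean of χ₁₁, by Cauchy–Schwarz on a square of area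
one. -/
theorem sq_mean_sub_le_elastic {χ : Fin 3 → Plane → ℝ} (h : IsPhase χ) {u : Plane → Plane}
    {G : Plane → Mat2} (hu : IsDeformation u G) :
    ((∫ x in unitSquare, G x 0 0) - ∫ x in unitSquare, diagOne χ x) ^ 2 ≤ elastic G χ := by
  have hG := hu.memLp_unitSquare 0 0
  have hm := (hG.sub (h.memLp_phaseMatrix 0 0))
  have h1 := abs_setIntegral_mul_le hm (memLp_const (1 : ℝ))
  have h2 := integral_elastic_term_le h hu 0 0
  simp only [Pi.sub_apply, mul_one, phaseMatrix_zero_zero, one_pow, integral_const,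
    probReal_univ, smul_eq_mul, Real.sqrt_one] at h1 h2
  rw [integral_sub (integrableOn_unitSquare_of_memLp hG) h.integrableOn_diagOne] at h1
  refine le_trans ?_ h2
  rw [← sq_abs]
  refine (pow_le_pow_left₀ (abs_nonneg _) h1 2).trans_eq (Real.sq_sqrt ?_)
  exact integral_nonneg fun x => sq_nonneg _

/-- Write s = F₁₁ and m = ⟨χ₁₁⟩. If the bound failed, (s - m)² ≤ E would give |s - m| < (1 - s²)/4,
hence 1 - m² > (1 - s²)/2. Rigidity would give 1 - m² ≤ 160ε^(-2/3)E < (1 - s²)²/2, the constant 320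
being 2·160. These are incompatible since 0 < 1 - s² ≤ 1. -/
theorem meanEnergy_ge {F : Mat2} (hF : F 0 0 ^ 2 < 1) {ε : ℝ} (hε : ε ∈ Ioo (0 : ℝ) 1) :
    ENNReal.ofReal ((1 - F 0 0 ^ 2) ^ 2 / 320 * ε ^ (2 / 3 : ℝ)) ≤ meanEnergy ε F := by
  refine le_iInf fun χ => le_iInf fun h => le_iInf fun u => le_iInf fun G => le_iInf fun hu =>
    le_iInf fun hmean => ?_
  rw [energy_eq_ofReal h hu hε.1.le]
  refine ENNReal.ofReal_le_ofReal ?_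
  set E := elastic G χ + ε * totalTV χ
  have hE : elastic G χ ≤ E := le_add_of_nonneg_right (mul_nonneg hε.1.le (totalTV_nonneg χ))
  have hE0 : 0 ≤ E := (elastic_nonneg G χ).trans hE
  have h1 := (sq_mean_sub_le_elastic h hu).trans hE
  have h2 := (h.rigidity hε.1).1.trans (mul_le_mul_right ((iInf_le _ u).trans
    ((iInf_le _ G).trans (iInf_le _ hu))) _)
  rw [energy_eq_ofReal h hu hε.1.le, h.lintegral_variance_diagOne,
    ← ENNReal.ofReal_mul (by have := hε.1; positivity), ENNReal.ofReal_le_ofReal_iff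
    (by have := hε.1; positivity)] at h2
  rw [hmean] at h1
  have hmb := abs_le.1 h.abs_mean_diagOne_le
  set m := ∫ x in unitSquare, diagOne χ x
  set s := F 0 0
  have hR0 : 0 < ε ^ (2 / 3 : ℝ) := Real.rpow_pos_of_pos hε.1 _
  have hR1 : ε ^ (2 / 3 : ℝ) ≤ 1 := Real.rpow_le_one hε.1.le hε.2.le (by norm_num)
  rw [Real.rpow_neg hε.1.le] at h2
  set R := ε ^ (2 / 3 : ℝ)
  have hk : 0 < 1 - s ^ 2 := by linarith
  by_contra! hlt
  have h3 : 160 * R⁻¹ * E < (1 - s ^ 2) ^ 2 / 2 := by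
    rw [mul_assoc, ← div_eq_inv_mul, ← lt_div_iff₀' (by norm_num), div_lt_iff₀ hR0]
    linarith
  have h4 : (s - m) ^ 2 < ((1 - s ^ 2) / 4) ^ 2 := by
    have : (1 - s ^ 2) ^ 2 / 320 * R ≤ (1 - s ^ 2) ^ 2 / 320 * 1 := by gcongr
    nlinarith
  have h5 := abs_lt.1 (abs_lt_of_sq_lt_sq h4 (by linarith))
  have hs := abs_le.1 ((sq_le_one_iff_abs_le_one s).1 hF.le)
  have h6 : m ^ 2 - s ^ 2 < (1 - s ^ 2) / 2 := by nlinarith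
  nlinarith [sq_nonneg s]

/-! ### Upper bounds for the total variation by one-dimensional sections -/

/-- The total variation of `f` on the torus is at most `B`, in terms of test fields. -/
def TVBound (f : Plane → ℝ) (B : ℝ) : Prop :=
  ∀ φ : Plane → Plane, ContDiff ℝ ∞ φ → (∀ j x, φ (x + basisVec j) = φ x) → (∀ x, ‖φ x‖ ≤ 1) →
    |∫ x in unitSquare, f x * divergence φ x| ≤ B

theorem TVBound.torusTV_le {f : Plane → ℝ} {B : ℝ} (h : TVBound f B) :
    torusTV f ≤ ENNReal.ofReal B :=
  iSup_le fun φ => ENNReal.ofReal_le_ofReal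
    ((le_abs_self _).trans (h φ.1 φ.2.1 φ.2.2.1 φ.2.2.2))

theorem continuous_divergence {φ : Plane → Plane} (hφ : ContDiff ℝ ∞ φ) :
    Continuous (divergence φ) := by
  have := hφ.continuous_fderiv (by simp)
  unfold divergence
  fun_prop

theorem integrableOn_mul_continuous {f g : Plane → ℝ} (hf : IntegrableOn f unitSquare)
    (hg : Continuous g) : IntegrableOn (fun x => f x * g x) unitSquare := by
  obtain ⟨M, hM⟩ := isCompact_unitSquare.exists_bound_of_continuousOn hg.continuousOn
  exact hf.mul_bdd hg.aestronglyMeasurable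
    ((ae_restrict_mem measurableSet_unitSquare).mono fun x hx => hM x hx)

theorem TVBound.sub {f g : Plane → ℝ} {A B : ℝ} (hf : TVBound f A) (hg : TVBound g B)
    (hfi : IntegrableOn f unitSquare) (hgi : IntegrableOn g unitSquare) :
    TVBound (fun x => f x - g x) (A + B) := fun φ hφ hp hb => by
  have hd := continuous_divergence hφ
  simp only [sub_mul]
  rw [integral_sub (integrableOn_mul_continuous hfi hd) (integrableOn_mul_continuous hgi hd)]
  exact (abs_sub _ _).trans (add_le_add (hf φ hφ hp hb) (hg φ hφ hp hb))

/-- Within [0, 1] the set is an interval up to its end points, so the integral of the derivative is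
a difference of two values of ψ. -/
theorem abs_setIntegral_deriv_le_of_ordConnected {A : Set ℝ} (hA : A.OrdConnected) {ψ : ℝ → ℝ}
    (hψ : ContDiff ℝ 1 ψ) (hb : ∀ t, |ψ t| ≤ 1) :
    |∫ t in Icc (0 : ℝ) 1, A.indicator 1 t * deriv ψ t| ≤ 2 := by
  have hAm : MeasurableSet A := hA.measurableSet
  have e1 : ∀ t, A.indicator 1 t * deriv ψ t = A.indicator (deriv ψ) t := fun t => by
    by_cases ht : t ∈ A <;> simp [ht]
  simp only [e1]
  rw [setIntegral_indicator hAm]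
  set B := Icc (0 : ℝ) 1 ∩ A with hB
  rcases B.eq_empty_or_nonempty with hBe | hBne
  · simp [hBe]
  have hBo : B.OrdConnected := ordConnected_Icc.inter hA
  have hbb : BddBelow B := bddBelow_Icc.mono inter_subset_left
  have hba : BddAbove B := bddAbove_Icc.mono inter_subset_left
  have hsub1 : B ⊆ Icc (sInf B) (sSup B) := fun t ht => ⟨csInf_le hbb ht, le_csSup hba ht⟩
  have hsub2 : Ioo (sInf B) (sSup B) ⊆ B := fun t ht => by
    obtain ⟨a, ha, hat⟩ := exists_lt_of_csInf_lt hBne ht.1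
    obtain ⟨b, hb, htb⟩ := exists_lt_of_lt_csSup hBne ht.2
    exact hBo.out ha hb ⟨hat.le, htb.le⟩
  have hle : sInf B ≤ sSup B := csInf_le_csSup hBne hbb hba
  have hae : B =ᵐ[volume] Ioc (sInf B) (sSup B) := by
    refine EventuallyLE.antisymm (hsub1.eventuallyLE.trans Ioc_ae_eq_Icc.symm.le) ?_
    exact Ioo_ae_eq_Ioc.symm.le.trans hsub2.eventuallyLE
  rw [setIntegral_congr_set hae, ← intervalIntegral.integral_of_le hle,
    intervalIntegral.integral_deriv_eq_sub (fun t _ => hψ.differentiable (by simp) t)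
      ((hψ.continuous_deriv (by simp)).intervalIntegrable _ _)]
  exact (abs_sub _ _).trans (by linarith [hb (sInf B), hb (sSup B)])

/-- `g` agrees on `[0, 1)` with the sum of the indicators of `N` intervals. -/
def IsIntervalSum (g : ℝ → ℝ) (N : ℕ) : Prop :=
  ∃ (ι : Type) (s : Finset ι) (A : ι → Set ℝ), s.card ≤ N ∧ (∀ i, (A i).OrdConnected) ∧
    ∀ t ∈ Ico (0 : ℝ) 1, g t = ∑ i ∈ s, (A i).indicator 1 t

theorem IsIntervalSum.abs_setIntegral_le {g : ℝ → ℝ} {N : ℕ} (hg : IsIntervalSum g N)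
    {ψ : ℝ → ℝ} (hψ : ContDiff ℝ 1 ψ) (hb : ∀ t, |ψ t| ≤ 1) :
    |∫ t in Icc (0 : ℝ) 1, g t * deriv ψ t| ≤ 2 * N := by
  obtain ⟨ι, s, A, hs, hA, hsum⟩ := hg
  have e : ∫ t in Icc (0 : ℝ) 1, g t * deriv ψ t =
      ∑ i ∈ s, ∫ t in Icc (0 : ℝ) 1, (A i).indicator 1 t * deriv ψ t := by
    rw [← integral_finsetSum, integral_Icc_eq_integral_Ico, integral_Icc_eq_integral_Ico]
    · refine setIntegral_congr_fun measurableSet_Ico fun t ht => ?_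
      simp only [hsum t ht, Finset.sum_mul]
    · intro i _
      have : IntegrableOn (deriv ψ) (Icc 0 1) :=
        (hψ.continuous_deriv (by simp)).continuousOn.integrableOn_compact isCompact_Icc
      refine (this.indicator (hA i).measurableSet).congr (.of_forall fun t => ?_)
      by_cases ht : t ∈ A i <;> simp [ht]
  rw [e]
  calc _ ≤ ∑ i ∈ s, |∫ t in Icc (0 : ℝ) 1, (A i).indicator 1 t * deriv ψ t| :=
        Finset.abs_sum_le_sum_abs _ _
    _ ≤ ∑ i ∈ s, 2 := Finset.sum_le_sum fun i _ =>
        abs_setIntegral_deriv_le_of_ordConnected (hA i) hψ hb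
    _ ≤ 2 * N := by
        rw [Finset.sum_const, nsmul_eq_mul, mul_comm]
        gcongr

theorem point_add_smul_zero (s t r : ℝ) :
    point (s, t) + r • basisVec 0 = point (s + r, t) := by
  ext i; fin_cases i <;> simp [basisVec_apply]

theorem point_add_smul_one (s t r : ℝ) :
    point (s, t) + r • basisVec 1 = point (s, t + r) := by
  ext i; fin_cases i <;> simp [basisVec_apply]

/-- A function whose sections are sums of indicators of intervals has total variation at most twice
the average number of these intervals. -/
theorem tvBound_of_sections {f : Plane → ℝ} (hf : Measurable f) {M : ℝ} (hb : ∀ x, |f x| ≤ M)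
    {N : ℝ → ℕ} {K : ℕ} {I : ℝ} (hNi : IntegrableOn (fun s => (N s : ℝ)) (Icc 0 1))
    (hI : ∫ s in Icc (0 : ℝ) 1, (N s : ℝ) ≤ I)
    (hy : ∀ s ∈ Icc (0 : ℝ) 1, IsIntervalSum (fun t => f (point (s, t))) (N s))
    (hx : ∀ t ∈ Icc (0 : ℝ) 1, IsIntervalSum (fun s => f (point (s, t))) K) :
    TVBound f (2 * I + 2 * K) := by
  intro φ hφ hp hφb
  have hfi := integrableOn_of_bounded hf hb
  have hφi : ∀ i, ContDiff ℝ ∞ fun x => φ x i := fun i => by fun_prop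
  have hφib : ∀ i x, |φ x i| ≤ 1 := fun i x =>
    (PiLp.norm_apply_le (p := 2) (φ x) i).trans (hφb x)
  have hc : ∀ i, Continuous fun x => fderiv ℝ φ x (basisVec i) i := fun i => by
    have := hφ.continuous_fderiv (by simp)
    fun_prop
  have hdiv : ∀ x, divergence φ x =
      fderiv ℝ φ x (basisVec 0) 0 + fderiv ℝ φ x (basisVec 1) 1 := fun x => by
    simp [divergence, Fin.sum_univ_two]
  have hline : ∀ i (x v : Plane) (r : ℝ),
      HasDerivAt (fun r : ℝ => φ (x + r • v) i) (fderiv ℝ φ (x + r • v) v i) r := fun i x v r => by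
    have h1 : HasDerivAt (fun r : ℝ => x + r • v) v r := by
      simpa using ((hasDerivAt_id r).smul_const v).const_add x
    have h2 := (hφ.differentiable (by simp) (x + r • v)).hasFDerivAt.comp_hasDerivAt r h1
    exact (PiLp.hasStrictFDerivAt_apply (𝕜 := ℝ) 2 (φ (x + r • v)) i).hasFDerivAt.comp_hasDerivAt r h2
  have hsec1 : ∀ s, ContDiff ℝ 1 fun t : ℝ => φ (point (s, t)) 1 := fun s => by
    have : ContDiff ℝ 1 fun t : ℝ => φ (point (s, 0) + t • basisVec 1) 1 :=
      ((hφi 1).of_le (by simp)).comp (by fun_prop)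
    simpa [point_add_smul_one] using this
  have hsec0 : ∀ t, ContDiff ℝ 1 fun s : ℝ => φ (point (s, t)) 0 := fun t => by
    have : ContDiff ℝ 1 fun s : ℝ => φ (point (0, t) + s • basisVec 0) 0 :=
      ((hφi 0).of_le (by simp)).comp (by fun_prop)
    simpa [point_add_smul_zero] using this
  have hd1 : ∀ s t, deriv (fun t : ℝ => φ (point (s, t)) 1) t =
      fderiv ℝ φ (point (s, t)) (basisVec 1) 1 := fun s t => by
    have := (hline 1 (point (s, 0)) (basisVec 1) t).deriv
    simpa [point_add_smul_one] using this
  have hd0 : ∀ s t, deriv (fun s : ℝ => φ (point (s, t)) 0) s =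
      fderiv ℝ φ (point (s, t)) (basisVec 0) 0 := fun s t => by
    have := (hline 0 (point (0, t)) (basisVec 0) s).deriv
    simpa [point_add_smul_zero] using this
  have hint : ∀ i, IntegrableOn (fun x => f x * fderiv ℝ φ x (basisVec i) i) unitSquare := fun i =>
    integrableOn_mul_continuous hfi (hc i)
  simp only [hdiv, mul_add]
  -- Each partial derivative is integrated first along its own direction. Horizontal sections have
  -- the uniform count `K`, while for vertical sections only the mean of the counts `N s` matters.
  rw [integral_add (hint 0) (hint 1), setIntegral_unitSquare (hint 0),
    setIntegral_unitSquare (hint 1), integral_integral_swap (integrable_point (hint 0))]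
  have b0 : |∫ t in Icc (0 : ℝ) 1, ∫ s in Icc (0 : ℝ) 1,
      f (point (s, t)) * fderiv ℝ φ (point (s, t)) (basisVec 0) 0| ≤ 2 * K := by
    have := norm_setIntegral_le_of_norm_le_const (μ := volume) (s := Icc (0 : ℝ) 1) (C := 2 * K)
      (f := fun t => ∫ s in Icc (0 : ℝ) 1,
        f (point (s, t)) * fderiv ℝ φ (point (s, t)) (basisVec 0) 0) (by simp) fun t ht => by
        simp only [← hd0]
        exact (hx t ht).abs_setIntegral_le (hsec0 t) fun s => hφib 0 _
    simpa using this
  have b1 : |∫ s in Icc (0 : ℝ) 1, ∫ t in Icc (0 : ℝ) 1,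
      f (point (s, t)) * fderiv ℝ φ (point (s, t)) (basisVec 1) 1| ≤ 2 * I := by
    calc _ ≤ ∫ s in Icc (0 : ℝ) 1, 2 * (N s : ℝ) := by
          rw [← Real.norm_eq_abs]
          refine norm_integral_le_of_norm_le (hNi.const_mul 2) ?_
          filter_upwards [ae_restrict_mem measurableSet_Icc] with s hs
          simp only [← hd1]
          exact (hy s hs).abs_setIntegral_le (hsec1 s) fun t => hφib 1 _
      _ ≤ 2 * I := by rw [integral_const_mul]; linarith
  exact (abs_add_le _ _).trans (by linarith)

/-! ### The sawtooth function -/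

/-- The distance of `y` to the lattice `hℤ`. -/
noncomputable def saw (h y : ℝ) : ℝ := |y - h * round (y / h)|

section Saw

variable {h : ℝ}

theorem saw_nonneg (h y : ℝ) : 0 ≤ saw h y := abs_nonneg _

theorem saw_le (hh : 0 < h) (y : ℝ) (m : ℤ) : saw h y ≤ |y - h * m| := by
  have e : ∀ k : ℤ, |y - h * k| = h * |y / h - k| := fun k => by
    rw [← abs_of_pos hh, ← abs_mul, abs_of_pos hh, mul_sub, mul_div_cancel₀ _ hh.ne']
  rw [saw, e, e]
  exact mul_le_mul_of_nonneg_left (round_le _ _) hh.le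

theorem saw_eq_min (hh : 0 < h) {y : ℝ} {m : ℤ} (h1 : h * m ≤ y) (h2 : y ≤ h * (m + 1)) :
    saw h y = min (y - h * m) (h * (m + 1) - y) := by
  refine le_antisymm (le_min ?_ ?_) ?_
  · exact (saw_le hh y m).trans_eq (abs_of_nonneg (by linarith))
  · refine (saw_le hh y (m + 1)).trans_eq ?_
    rw [abs_of_nonpos (by push_cast; linarith)]; push_cast; ring
  · rw [saw]
    rcases le_or_gt (round (y / h)) m with hr | hr
    · have : (round (y / h) : ℝ) ≤ m := by exact_mod_cast hr
      exact (min_le_left _ _).trans (le_trans (by nlinarith) (le_abs_self _))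
    · have : ((m : ℝ) + 1) ≤ round (y / h) := by exact_mod_cast hr
      exact (min_le_right _ _).trans (le_trans (by nlinarith) (neg_le_abs _))

theorem floor_bounds (hh : 0 < h) (y : ℝ) : h * ⌊y / h⌋ ≤ y ∧ y < h * (⌊y / h⌋ + 1) :=
  ⟨by rw [← le_div_iff₀' hh]; exact Int.floor_le _,
    by rw [← div_lt_iff₀' hh]; exact Int.lt_floor_add_one _⟩

theorem saw_le_half (hh : 0 < h) (y : ℝ) : saw h y ≤ h / 2 := by
  obtain ⟨h1, h2⟩ := floor_bounds hh y
  rw [saw_eq_min hh h1 h2.le]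
  rcases le_total (y - h * ⌊y / h⌋) (h / 2) with h | h
  · exact (min_le_left _ _).trans h
  · exact (min_le_right _ _).trans (by linarith)

/-- Folding a tooth at half its height produces the teeth of half the period. This self-similarity
links consecutive generations of the branching. -/
theorem saw_half (hh : 0 < h) (y : ℝ) : saw (h / 2) y = min (saw h y) (h / 2 - saw h y) := by
  obtain ⟨h1, h2⟩ := floor_bounds hh y
  rw [saw_eq_min hh h1 h2.le]
  set m := ⌊y / h⌋
  rcases le_total (y - h * m) (h / 2) with h3 | h3
  · rw [saw_eq_min (m := 2 * m) (half_pos hh) (by push_cast; linarith) (by push_cast; linarith),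
      min_eq_left (a := y - h * m) (by linarith)]
    push_cast
    congr 1 <;> ring
  · rw [saw_eq_min (m := 2 * m + 1) (half_pos hh) (by push_cast; linarith)
      (by push_cast; linarith), min_eq_right (a := y - h * m) (by linarith), min_comm]
    push_cast
    congr 1 <;> ring

theorem saw_sub_le (hh : 0 < h) (y y' : ℝ) : |saw h y - saw h y'| ≤ |y - y'| := by
  have key : ∀ y y', saw h y - saw h y' ≤ |y - y'| := fun y y' => by
    have h1 := saw_le hh y (round (y' / h))
    have h2 := abs_add_le (y - y') (y' - h * round (y' / h))
    rw [sub_add_sub_cancel] at h2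
    have h3 : saw h y' = |y' - h * round (y' / h)| := rfl
    linarith
  exact abs_sub_le_iff.2 ⟨key y y', by rw [abs_sub_comm]; exact key y' y⟩

theorem continuous_saw (hh : 0 < h) : Continuous (saw h) :=
  (LipschitzWith.of_dist_le_mul (K := 1) fun y y' => by
    simpa [Real.dist_eq] using saw_sub_le hh y y').continuous

theorem saw_periodic (hh : 0 < h) (k : ℤ) (y : ℝ) : saw h (y + h * k) = saw h y := by
  rw [saw, add_div, mul_div_cancel_left₀ _ hh.ne', round_add_intCast, saw]
  push_cast
  congr 1; ring

theorem saw_of_fract_le (hh : 0 < h) {y : ℝ} (hz : Int.fract (y / h) ≤ 1 / 2) :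
    saw h y = h * Int.fract (y / h) := by
  obtain ⟨h1, h2⟩ := floor_bounds hh y
  have e : h * Int.fract (y / h) = y - h * ⌊y / h⌋ := by
    rw [Int.fract, mul_sub, mul_div_cancel₀ _ hh.ne']
  rw [saw_eq_min hh h1 h2.le, min_eq_left, e]
  nlinarith

theorem saw_of_le_fract (hh : 0 < h) {y : ℝ} (hz : 1 / 2 ≤ Int.fract (y / h)) :
    saw h y = h * (1 - Int.fract (y / h)) := by
  obtain ⟨h1, h2⟩ := floor_bounds hh y
  have e : h * Int.fract (y / h) = y - h * ⌊y / h⌋ := by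
    rw [Int.fract, mul_sub, mul_div_cancel₀ _ hh.ne']
  rw [saw_eq_min hh h1 h2.le, min_eq_right] <;> nlinarith

theorem hasDerivAt_saw_one (hh : 0 < h) {y : ℝ} (h0 : 0 < Int.fract (y / h))
    (hz : Int.fract (y / h) < 1 / 2) : HasDerivAt (saw h) 1 y := by
  have e : h * Int.fract (y / h) = y - h * ⌊y / h⌋ := by
    rw [Int.fract, mul_sub, mul_div_cancel₀ _ hh.ne']
  set m := ⌊y / h⌋
  have hn : Ioo (h * m) (h * m + h / 2) ∈ 𝓝 y := Ioo_mem_nhds (by nlinarith) (by nlinarith)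
  refine ((hasDerivAt_id y).sub_const (h * m)).congr_of_eventuallyEq ?_
  filter_upwards [hn] with t ht
  rw [saw_eq_min (m := m) hh ht.1.le (by linarith [ht.2]), min_eq_left (by linarith [ht.2])]
  rfl

theorem hasDerivAt_saw_neg_one (hh : 0 < h) {y : ℝ} (hz : 1 / 2 < Int.fract (y / h)) :
    HasDerivAt (saw h) (-1) y := by
  have e : h * Int.fract (y / h) = y - h * ⌊y / h⌋ := by
    rw [Int.fract, mul_sub, mul_div_cancel₀ _ hh.ne']
  have h1 := Int.fract_lt_one (y / h)
  set m := ⌊y / h⌋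
  have hn : Ioo (h * m + h / 2) (h * (m + 1)) ∈ 𝓝 y := Ioo_mem_nhds (by nlinarith) (by nlinarith)
  refine ((hasDerivAt_id y).const_sub (h * (m + 1))).congr_of_eventuallyEq ?_
  filter_upwards [hn] with t ht
  rw [saw_eq_min (m := m) hh (by linarith [ht.1]) ht.2.le, min_eq_right (by linarith [ht.1])]
  rfl

/-- The derivative of a truncated sawtooth. -/
theorem hasDerivAt_min_saw (hh : 0 < h) {β y : ℝ} (hβ : β ≤ 1 / 2)
    (hz : Int.fract (y / h) ∉ ({0, β, 1 / 2, 1 - β} : Set ℝ)) :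
    HasDerivAt (fun y => min (saw h y) (2 * h * β - saw h y))
      (if Int.fract (y / h) < β ∨ (1 / 2 ≤ Int.fract (y / h) ∧ Int.fract (y / h) < 1 - β)
        then 1 else -1) y := by
  simp only [mem_insert_iff, mem_singleton_iff, not_or] at hz
  obtain ⟨z0, zb, zh, z1⟩ := hz
  -- The entry attaining the minimum depends on whether the sawtooth is below or above `hβ`. The
  -- excluded relative positions are the kinks of the sawtooth, 0 and 1/2, and the crossings of this
  -- level, β and 1 - β.
  have hlow : saw h y < h * β →
      (fun y => min (saw h y) (2 * h * β - saw h y)) =ᶠ[𝓝 y] saw h := fun hlt => by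
    filter_upwards [(continuous_saw hh).continuousAt.eventually (gt_mem_nhds hlt)] with t ht
    exact min_eq_left (by linarith)
  have hhigh : h * β < saw h y →
      (fun y => min (saw h y) (2 * h * β - saw h y)) =ᶠ[𝓝 y] fun y => 2 * h * β - saw h y :=
    fun hlt => by
    filter_upwards [(continuous_saw hh).continuousAt.eventually (lt_mem_nhds hlt)] with t ht
    exact min_eq_right (by linarith)
  have z0' : 0 < Int.fract (y / h) := lt_of_le_of_ne (Int.fract_nonneg _) (Ne.symm z0)
  rcases lt_or_gt_of_ne zh with hz | hz
  · have hd := hasDerivAt_saw_one hh z0' hz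
    have hs := saw_of_fract_le hh hz.le
    rcases lt_or_gt_of_ne zb with hb | hb
    · rw [if_pos (Or.inl hb)]
      exact hd.congr_of_eventuallyEq (hlow (by rw [hs]; gcongr))
    · rw [if_neg (by rintro (h | ⟨h, h'⟩) <;> linarith)]
      exact (hd.const_sub _).congr_of_eventuallyEq (hhigh (by rw [hs]; gcongr))
  · have hd := hasDerivAt_saw_neg_one hh hz
    have hs := saw_of_le_fract hh hz.le
    rcases lt_or_gt_of_ne z1 with hb | hb
    · rw [if_pos (Or.inr ⟨hz.le, hb⟩)]
      simpa using (hd.const_sub (2 * h * β)).congr_of_eventuallyEq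
        (hhigh (by rw [hs]; gcongr; linarith))
    · rw [if_neg (by rintro (h | ⟨h, h'⟩) <;> linarith)]
      exact hd.congr_of_eventuallyEq (hlow (by rw [hs]; gcongr; linarith))

end Saw

/-! ### The branching profile -/

/-- The running minimum of a sequence. -/
noncomputable def runMin (T : ℕ → ℝ) : ℕ → ℝ
  | 0 => T 0
  | j + 1 => min (runMin T j) (T (j + 1))

theorem runMin_eq_of_antitone {T : ℕ → ℝ} {k : ℕ} (h : ∀ j < k, T (j + 1) ≤ T j) :
    runMin T k = T k := by
  induction k with
  | zero => rfl
  | succ k ih =>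
    rw [runMin, ih fun j hj => h j (by omega)]
    exact min_eq_right (h k (by omega))

/-- A sequence that decreases up to index `k` and increases from `k + 1` on has its minimum at one
of these two. In each layer this leaves only two generations in competition. -/
theorem runMin_eq_min {T : ℕ → ℝ} {k m : ℕ} (h1 : ∀ j < k, T (j + 1) ≤ T j) (hm : k + 1 ≤ m)
    (h2 : ∀ j, k + 1 ≤ j → j < m → T j ≤ T (j + 1)) : runMin T m = min (T k) (T (k + 1)) := by
  have h3 : ∀ j, k + 1 ≤ j → j ≤ m → T (k + 1) ≤ T j := fun j hj => by
    induction j, hj using Nat.le_induction with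
    | base => exact fun _ => le_rfl
    | succ j hj ih => exact fun hjm => (ih (by omega)).trans (h2 j hj (by omega))
  induction m, hm using Nat.le_induction with
  | base => rw [runMin, runMin_eq_of_antitone h1]
  | succ m hm ih =>
    rw [runMin, ih (fun j hj hjm => h2 j hj (by omega)) fun j hj hjm => h3 j hj (by omega)]
    exact min_eq_left ((min_le_right _ _).trans (h3 _ (by omega) le_rfl))

theorem abs_runMin_sub_le {S T : ℕ → ℝ} {c : ℝ} (h : ∀ j, |S j - T j| ≤ c) (m : ℕ) :
    |runMin S m - runMin T m| ≤ c := by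
  induction m with
  | zero => exact h 0
  | succ m ih => exact (abs_min_sub_min_le_max _ _ _ _).trans (max_le ih (h _))

theorem exists_lipschitzWith_runMin {α : Type*} [PseudoEMetricSpace α] {T : ℕ → α → ℝ}
    (h : ∀ j, ∃ K, LipschitzWith K (T j)) (m : ℕ) :
    ∃ K, LipschitzWith K fun x => runMin (fun j => T j x) m := by
  induction m with
  | zero => exact h 0
  | succ m ih =>
    obtain ⟨K, hK⟩ := ih
    obtain ⟨K', hK'⟩ := h (m + 1)
    exact ⟨_, hK.min hK'⟩

/-- The period of the `k`-th generation of the branching construction. -/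
noncomputable def mesh (n k : ℕ) : ℝ := (1 / 2) ^ (n + k)

/-- The rate at which the `k`-th generation of the branching construction is introduced. -/
noncomputable def slope (L : ℝ) (n k : ℕ) : ℝ := (1 / 2) ^ n * (3 / 2) ^ k / L

/-- The distance to the boundary below which the `k`-th generation is fully developed. -/
noncomputable def thr (L : ℝ) (J k : ℕ) : ℝ := if k ≤ J then L / 2 * (1 / 3) ^ k else 0

/-- The competing profiles, whose minimum is the branching profile. -/
noncomputable def branchTerm (L : ℝ) (n J j : ℕ) (d y : ℝ) : ℝ :=
  slope L n j * max 0 (d - thr L J j) + if j ≤ J then saw (mesh n j) y else 0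

/-- The branching profile at distance `d` from the boundary. -/
noncomputable def profile (L : ℝ) (n J : ℕ) (d y : ℝ) : ℝ :=
  runMin (fun j => branchTerm L n J j d y) (J + 1)

theorem mesh_pos (n k : ℕ) : 0 < mesh n k := by unfold mesh; positivity

theorem mesh_succ (n k : ℕ) : mesh n (k + 1) = mesh n k / 2 := by
  rw [mesh, mesh, ← add_assoc, pow_succ]; ring

theorem two_pow_mul_mesh (n k : ℕ) : 2 ^ (n + k) * mesh n k = 1 := by
  rw [mesh, ← mul_pow]; norm_num

section Profile

variable {L : ℝ} {n J : ℕ}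

theorem slope_pos (hL : 0 < L) (k : ℕ) : 0 < slope L n k := by unfold slope; positivity

theorem thr_nonneg (hL : 0 < L) (k : ℕ) : 0 ≤ thr L J k := by
  unfold thr; split_ifs <;> positivity

theorem thr_of_le {k : ℕ} (hk : k ≤ J) : thr L J k = L / 2 * (1 / 3) ^ k := if_pos hk

theorem thr_last : thr L J (J + 1) = 0 := if_neg (by omega)

theorem thr_zero : thr L J 0 = L / 2 := by simp [thr]

theorem thr_succ_lt (hL : 0 < L) {k : ℕ} (hk : k ≤ J) : thr L J (k + 1) < thr L J k := by
  have : 0 < L / 2 * (1 / 3 : ℝ) ^ k := by positivity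
  rw [thr_of_le hk]
  unfold thr
  split_ifs
  · rw [pow_succ]; linarith
  · exact this

theorem thr_antitone (hL : 0 < L) : Antitone (thr L J) := antitone_nat_of_succ_le fun k => by
  rcases le_or_gt k J with hk | hk
  · exact (thr_succ_lt hL hk).le
  · rw [thr, thr, if_neg (by omega), if_neg (by omega)]

/-- The offset of generation `k + 1` must reach the tooth height `mesh n k / 2` within layer `k`.
The slope ratio 3/2 and width ratio 1/3 multiply to 1/2, the ratio of the periods, so equality holds
for k < J (`slope_mul_sub_thr`). In the last layer the lower threshold is 0 and the offset reaches
3/4 of the mesh. -/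
theorem half_mesh_le (hL : 0 < L) {k : ℕ} (hk : k ≤ J) :
    mesh n k / 2 ≤ slope L n (k + 1) * (thr L J k - thr L J (k + 1)) := by
  have hm := mesh_pos n k
  have e : slope L n (k + 1) * (L / 2 * (1 / 3) ^ k) = 3 / 4 * mesh n k := by
    have e1 : (3 / 2 : ℝ) ^ k * (1 / 3) ^ k = (1 / 2) ^ k := by rw [← mul_pow]; norm_num
    have : slope L n (k + 1) * (L / 2 * (1 / 3) ^ k) =
        3 / 4 * ((1 / 2) ^ n * ((3 / 2 : ℝ) ^ k * (1 / 3) ^ k)) := by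
      unfold slope; rw [pow_succ]; field_simp; ring
    rw [this, e1, mesh, pow_add]
  rw [mul_sub, thr_of_le hk, e]
  unfold thr
  split_ifs with h
  · have : slope L n (k + 1) * (L / 2 * (1 / 3) ^ (k + 1)) =
        (slope L n (k + 1) * (L / 2 * (1 / 3) ^ k)) / 3 := by rw [pow_succ]; ring
    rw [this, e]; linarith
  · linarith

theorem slope_mul_sub_thr (hL : 0 < L) {k : ℕ} (hk : k < J) :
    slope L n (k + 1) * (thr L J k - thr L J (k + 1)) = mesh n k / 2 := by
  have e1 : (3 / 2 : ℝ) ^ k * (1 / 3) ^ k = (1 / 2) ^ k := by rw [← mul_pow]; norm_num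
  have : slope L n (k + 1) * (L / 2 * (1 / 3) ^ k - L / 2 * (1 / 3) ^ (k + 1)) =
      1 / 2 * ((1 / 2) ^ n * ((3 / 2 : ℝ) ^ k * (1 / 3) ^ k)) := by
    unfold slope; rw [pow_succ, pow_succ]; field_simp; ring
  rw [thr_of_le hk.le, thr_of_le (by omega), this, e1, mesh, pow_add]
  ring

theorem slope_le_succ (hL : 0 < L) (k : ℕ) : slope L n k ≤ slope L n (k + 1) := by
  unfold slope
  gcongr
  · norm_num
  · omega

/-- Close to the boundary the finer generation has no offset yet, and finer teeth lie below coarser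
ones. -/
theorem branchTerm_succ_le (hL : 0 < L) {j : ℕ} (hj : j + 1 ≤ J) {d : ℝ}
    (hd : d ≤ thr L J (j + 1)) (y : ℝ) : branchTerm L n J (j + 1) d y ≤ branchTerm L n J j d y := by
  have h1 := slope_pos (n := n) hL j
  rw [branchTerm, branchTerm, max_eq_left (by linarith), if_pos hj, if_pos (by omega), mesh_succ,
    saw_half (mesh_pos n j), mul_zero, zero_add]
  exact (min_le_left _ _).trans (le_add_of_nonneg_left (by positivity))

/-- From the threshold of generation `j` inwards, the offset of the finer one exceeds that of
generation `j` by at least a full coarse tooth, and increasing slopes preserve this gap. -/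
theorem branchTerm_le_succ (hL : 0 < L) {j : ℕ} (hj : j ≤ J) {d : ℝ}
    (hd : thr L J j ≤ d) (y : ℝ) : branchTerm L n J j d y ≤ branchTerm L n J (j + 1) d y := by
  have h1 := slope_le_succ (n := n) hL j
  have h2 := half_mesh_le (n := n) hL hj
  have h3 := (thr_succ_lt hL hj).le
  have hm := mesh_pos n j
  have h4 : saw (mesh n j) y - mesh n j / 2 ≤
      if j + 1 ≤ J then saw (mesh n (j + 1)) y else 0 := by
    split_ifs
    · rw [mesh_succ, saw_half hm]
      have := saw_le_half hm y
      have := saw_nonneg (mesh n j) y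
      exact le_min (by linarith) (by linarith)
    · linarith [saw_le_half hm y]
  rw [branchTerm, branchTerm, max_eq_right (by linarith), max_eq_right (by linarith), if_pos hj]
  have h5 : slope L n j * (d - thr L J j) ≤ slope L n (j + 1) * (d - thr L J j) :=
    mul_le_mul_of_nonneg_right h1 (by linarith)
  have h6 : slope L n (j + 1) * (d - thr L J (j + 1)) = slope L n (j + 1) * (d - thr L J j) +
      slope L n (j + 1) * (thr L J j - thr L J (j + 1)) := by ring
  linarith

/-- In each layer the profile is the minimum of two consecutive competitors. -/
theorem profile_eq_min (hL : 0 < L) {k : ℕ} (hk : k ≤ J) {d : ℝ}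
    (h1 : thr L J (k + 1) ≤ d) (h2 : d ≤ thr L J k) (y : ℝ) :
    profile L n J d y =
      min (saw (mesh n k) y) (slope L n (k + 1) * (d - thr L J (k + 1)) +
        if k + 1 ≤ J then saw (mesh n (k + 1)) y else 0) := by
  rw [profile, runMin_eq_min (k := k)]
  · rw [branchTerm, branchTerm, max_eq_left (by linarith), max_eq_right (by linarith), if_pos hk,
      mul_zero, zero_add]
  · exact fun j hj => branchTerm_succ_le hL (by omega) (h2.trans (thr_antitone hL (by omega))) y
  · omega
  · exact fun j hj hjm => branchTerm_le_succ hL (by omega)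
      ((thr_antitone hL (by omega)).trans h1) y

/-- The extra competitor with index `J + 1` carries no sawtooth and vanishes at d = 0. It closes the
profile, which can then be continued by 0 outside the strip. -/
theorem profile_zero (hL : 0 < L) (y : ℝ) : profile L n J 0 y = 0 := by
  rw [profile_eq_min hL le_rfl (by rw [thr_last]) (thr_nonneg hL J), thr_last, if_neg (by omega)]
  simp [saw_nonneg]

theorem abs_profile_sub_le_right (d y y' : ℝ) :
    |profile L n J d y - profile L n J d y'| ≤ |y - y'| := by
  refine abs_runMin_sub_le (fun j => ?_) _
  unfold branchTerm
  split_ifs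
  · rw [add_sub_add_left_eq_sub]
    exact saw_sub_le (mesh_pos n j) y y'
  · simp

/-- Within layer `k` only the offset of generation `k + 1` depends on the depth. -/
theorem abs_profile_sub_le_left (hL : 0 < L) {k : ℕ} (hk : k ≤ J) {d d' : ℝ}
    (h1 : thr L J (k + 1) ≤ d) (h2 : d ≤ thr L J k) (h1' : thr L J (k + 1) ≤ d')
    (h2' : d' ≤ thr L J k) (y : ℝ) :
    |profile L n J d y - profile L n J d' y| ≤ slope L n (k + 1) * |d - d'| := by
  have h0 := slope_pos (n := n) hL (k + 1)
  rw [profile_eq_min hL hk h1 h2, profile_eq_min hL hk h1' h2']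
  refine (abs_min_sub_min_le_max _ _ _ _).trans (max_le (by simp; positivity) ?_)
  rw [add_sub_add_right_eq_sub, ← mul_sub, sub_sub_sub_cancel_right, abs_mul, abs_of_pos h0]

theorem exists_lipschitzWith_profile :
    ∃ K, LipschitzWith K fun p : ℝ × ℝ => profile L n J p.1 p.2 := by
  refine exists_lipschitzWith_runMin (T := fun j (p : ℝ × ℝ) => branchTerm L n J j p.1 p.2)
    (fun j => ?_) _
  have h1 : LipschitzWith _ fun p : ℝ × ℝ => slope L n j * max 0 (p.1 - thr L J j) :=
    (lipschitzWith_smul (slope L n j)).comp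
      ((LipschitzWith.prod_fst.sub (LipschitzWith.const (thr L J j))).const_max 0)
  have h2 : LipschitzWith 1 fun p : ℝ × ℝ => saw (mesh n j) p.2 :=
    LipschitzWith.of_dist_le_mul fun p q => by
      rw [NNReal.coe_one, one_mul]
      exact (saw_sub_le (mesh_pos n j) p.2 q.2).trans (le_max_right |p.1 - q.1| _)
  by_cases hj : j ≤ J
  · simp only [branchTerm, if_pos hj]
    exact ⟨_, h1.add h2⟩
  · simp only [branchTerm, if_neg hj, add_zero]
    exact ⟨_, h1⟩

theorem profile_add_one (d y : ℝ) : profile L n J d (y + 1) = profile L n J d y := by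
  unfold profile
  congr 1
  funext j
  have := saw_periodic (mesh_pos n j) (2 ^ (n + j)) y
  push_cast at this
  rw [mul_comm, two_pow_mul_mesh] at this
  rw [branchTerm, branchTerm, this]

/-- The relative position at which the profile starts to decrease within a period. -/
noncomputable def turn (L : ℝ) (n J k : ℕ) (d : ℝ) : ℝ :=
  (slope L n (k + 1) * (d - thr L J (k + 1)) + mesh n k / 2) / (2 * mesh n k)

/-- The part of the period on which the profile increases. -/
def Increasing (L : ℝ) (n J k : ℕ) (d y : ℝ) : Prop :=
  Int.fract (y / mesh n k) < turn L n J k d ∨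
    (1 / 2 ≤ Int.fract (y / mesh n k) ∧ Int.fract (y / mesh n k) < 1 - turn L n J k d)

-- By `saw_half` the competitor of generation `k + 1` is the offset plus the minimum of the coarse
-- tooth and its reflection. The branch with the unreflected tooth never beats the coarse tooth
-- itself, so a truncated sawtooth remains. Its slope is exactly ±1, so the second diagonal entry
-- carries no elastic energy in these layers.
open Classical in
theorem hasDerivAt_profile (hL : 0 < L) {k : ℕ} (hk : k < J) {d : ℝ}
    (h1 : thr L J (k + 1) ≤ d) (h2 : d ≤ thr L J k) {y : ℝ}
    (hz : Int.fract (y / mesh n k) ∉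
      ({0, turn L n J k d, 1 / 2, 1 - turn L n J k d} : Set ℝ)) :
    HasDerivAt (profile L n J d) (if Increasing L n J k d y then 1 else -1) y := by
  have hm := mesh_pos n k
  have h0 := slope_pos (n := n) hL (k + 1)
  have hw : slope L n (k + 1) * (d - thr L J (k + 1)) ≤ mesh n k / 2 := by
    rw [← slope_mul_sub_thr hL hk]
    gcongr
  have hw0 : 0 ≤ slope L n (k + 1) * (d - thr L J (k + 1)) :=
    mul_nonneg h0.le (by linarith)
  have hβ : turn L n J k d ≤ 1 / 2 := by
    rw [turn, div_le_iff₀ (by positivity)]; linarith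
  have he : profile L n J d = fun y =>
      min (saw (mesh n k) y) (2 * mesh n k * turn L n J k d - saw (mesh n k) y) := by
    funext y
    rw [profile_eq_min hL hk.le h1 h2, if_pos (by omega), mesh_succ, saw_half hm, turn,
      mul_div_cancel₀ _ (by positivity), ← min_add_add_left, ← min_assoc,
      min_eq_left (a := saw (mesh n k) y) (by linarith), add_sub_assoc]
  rw [he]
  convert hasDerivAt_min_saw hm hβ hz using 1
  unfold Increasing
  congr

end Profile

/-! ### Lipschitz deformations -/

theorem integral_mul_fderiv_of_lipschitz {v φ : Plane → ℝ} (hv : ∃ K, LipschitzWith K v)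
    (hφ : ContDiff ℝ ∞ φ) (hc : HasCompactSupport φ) (w : Plane) :
    ∫ x, v x * fderiv ℝ φ x w = -∫ x, lineDeriv ℝ v x w * φ x := by
  obtain ⟨K, hK⟩ := hv
  obtain ⟨K', hK'⟩ := hφ.lipschitzWith_of_hasCompactSupport hc (by simp)
  rw [hK.integral_lineDeriv_mul_eq hK' hc w, ← integral_neg]
  refine integral_congr_ae (.of_forall fun x => ?_)
  simp only [(hφ.differentiable (by simp) x).lineDeriv_eq_fderiv, map_neg]
  ring

theorem lineDeriv_add_of_quasiperiodic {v : Plane → ℝ} {e : Plane} {c : ℝ}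
    (h : ∀ x, v (x + e) = v x + c) (x w : Plane) :
    lineDeriv ℝ v (x + e) w = lineDeriv ℝ v x w := by
  simp only [lineDeriv, add_right_comm x e, h, deriv_add_const]

theorem memLp_lineDeriv_restrict {v : Plane → ℝ} (hv : ∃ K, LipschitzWith K v) {S : Set Plane}
    (hS : IsCompact S) (w : Plane) :
    MemLp (fun x => lineDeriv ℝ v x w) 2 (volume.restrict S) := by
  obtain ⟨K, hK⟩ := hv
  have := isFiniteMeasure_restrict.2 (hS.measure_lt_top (μ := volume)).ne
  exact (hK.memLp_lineDeriv w).mono_exponent le_top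

/-- For Lipschitz maps the pointwise directional derivatives are weak derivatives, and periodicity
up to additive constants suffices for a periodic gradient. The constants allow a nonzero mean
gradient. -/
theorem isDeformation_of_lipschitz {v : Fin 2 → Plane → ℝ} (hv : ∀ i, ∃ K, LipschitzWith K (v i))
    {c : Fin 2 → Fin 2 → ℝ} (hper : ∀ i j x, v i (x + basisVec j) = v i x + c i j) :
    IsDeformation (fun x => WithLp.toLp 2 fun i => v i x)
      fun x => Matrix.of fun i j => lineDeriv ℝ (v i) x (basisVec j) where
  memLp S hS := by
    have hc : Continuous fun x => (WithLp.toLp 2 fun i => v i x : Plane) :=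
      (PiLp.continuous_toLp 2 _).comp (continuous_pi fun i => (hv i).choose_spec.continuous)
    have := isFiniteMeasure_restrict.2 (hS.measure_lt_top (μ := volume)).ne
    obtain ⟨M, hM⟩ := hS.exists_bound_of_continuousOn hc.continuousOn
    exact .of_bound hc.aestronglyMeasurable M ((ae_restrict_mem hS.measurableSet).mono hM)
  grad_memLp S hS i j := memLp_lineDeriv_restrict (hv i) hS _
  weakGradient i j φ hφ hc := integral_mul_fderiv_of_lipschitz (hv i) hφ hc _
  periodic j := .of_forall fun x => by
    ext i k
    exact lineDeriv_add_of_quasiperiodic (hper i j) x _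

theorem setIntegral_lineDeriv_eq_zero {v : Plane → ℝ} (hv : ∃ K, LipschitzWith K v)
    (hper : ∀ j x, v (x + basisVec j) = v x) (w : Plane) :
    ∫ x in unitSquare, lineDeriv ℝ v x w = 0 := by
  -- The test function is a periodization of the constant 1, whose derivative vanishes on the torus.
  obtain ⟨θ, hθs, hθc, hθ⟩ :=
    SmoothPeriodic.exists_periodization (ψ := fun _ => 1) ⟨contDiff_const, fun _ _ => rfl⟩
  have h1 := integral_mul_fderiv_of_lipschitz hv hθs hθc w
  obtain ⟨K, hK⟩ := hv
  rw [(hθ _ hK.continuous.locallyIntegrable fun j => .of_forall (hper j)).2 w,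
    (hθ _ (hK.locallyIntegrable_lineDeriv w) fun j => .of_forall fun x =>
      lineDeriv_add_of_quasiperiodic (c := 0) (by simpa using hper j) x w).1] at h1
  simpa using h1

/-! ### The distance to the boundary of the periodic strip -/

/-- The distance of `s` to the complement of the periodic strip `(0, L) + ℤ`. -/
noncomputable def depth (L s : ℝ) : ℝ := max 0 (L / 2 - saw 1 (s - L / 2))

section Depth

variable {L : ℝ}

theorem depth_le (hL : 0 < L) (s : ℝ) : depth L s ≤ L / 2 :=
  max_le (by positivity) (by linarith [saw_nonneg 1 (s - L / 2)])

theorem lipschitzWith_depth (L : ℝ) : LipschitzWith 1 (depth L) :=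
  LipschitzWith.of_dist_le_mul fun s t => by
    have h1 := abs_max_sub_max_le_max (0 : ℝ) (L / 2 - saw 1 (s - L / 2)) 0
      (L / 2 - saw 1 (t - L / 2))
    have h2 := saw_sub_le one_pos (t - L / 2) (s - L / 2)
    rw [Real.dist_eq, Real.dist_eq, NNReal.coe_one, one_mul]
    refine h1.trans (max_le (by simp) ?_)
    rw [sub_sub_sub_cancel_left, abs_sub_comm s]
    refine h2.trans_eq ?_
    congr 1; ring

theorem depth_add_one (L s : ℝ) : depth L (s + 1) = depth L s := by
  have := saw_periodic one_pos 1 (s - L / 2)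
  rw [depth, depth, ← this]
  congr 3; push_cast; ring

theorem depth_of_le_half (hL : L < 1) {s : ℝ} (h0 : 0 ≤ s) (h1 : s ≤ L / 2) : depth L s = s := by
  rw [depth, saw_eq_min one_pos (m := -1) (by push_cast; linarith) (by push_cast; linarith)]
  push_cast
  rw [min_eq_right (by linarith), max_eq_right (by linarith)]
  ring

theorem depth_of_half_le (hL : L < 1) {s : ℝ} (h0 : L / 2 ≤ s) (h1 : s ≤ L) :
    depth L s = L - s := by
  rw [depth, saw_eq_min one_pos (m := 0) (by push_cast; linarith) (by push_cast; linarith)]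
  push_cast
  rw [min_eq_left (by linarith), max_eq_right (by linarith)]
  ring

theorem depth_of_ge (hL0 : 0 < L) {s : ℝ} (h0 : L ≤ s) (h1 : s ≤ 1) : depth L s = 0 := by
  refine max_eq_left ?_
  rw [saw_eq_min one_pos (m := 0) (by push_cast; linarith) (by push_cast; linarith)]
  push_cast
  linarith [le_min (c := L / 2) (a := s - L / 2 - 1 * 0) (b := 1 * (0 + 1) - (s - L / 2))
    (by linarith) (by linarith)]

theorem depth_pos_iff (hL0 : 0 < L) (hL : L < 1) {s : ℝ} (hs : s ∈ Icc (0 : ℝ) 1) :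
    0 < depth L s ↔ s ∈ Ioo 0 L := by
  rcases le_total s (L / 2) with h | h
  · rw [depth_of_le_half hL hs.1 h]
    exact ⟨fun h0 => ⟨h0, by linarith⟩, fun h => h.1⟩
  · rcases le_total s L with h' | h'
    · rw [depth_of_half_le hL h h']
      exact ⟨fun h0 => ⟨by linarith, by linarith⟩, fun h => by linarith [h.2]⟩
    · rw [depth_of_ge hL0 h' hs.2]
      simp only [lt_irrefl, false_iff]
      exact fun h => absurd h.2 (not_lt.2 h')

/-- The points at which the depth takes a given value form a finite set. -/
theorem depth_eq_iff (hL0 : 0 < L) (hL : L < 1) {s c : ℝ} (hs : s ∈ Icc (0 : ℝ) 1) (hc : 0 < c)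
    (h : depth L s = c) : s = c ∨ s = L - c := by
  have hs' := (depth_pos_iff hL0 hL hs).1 (h ▸ hc)
  rcases le_total s (L / 2) with h2 | h2
  · rw [depth_of_le_half hL hs.1 h2] at h; exact Or.inl h
  · rw [depth_of_half_le hL h2 hs'.2.le] at h; right; linarith

/-- The factor 2 counts the two sides of the strip. -/
theorem volume_depth_le (hL0 : 0 < L) (hL : L < 1) (c : ℝ) :
    volume {s | s ∈ Icc (0 : ℝ) 1 ∧ 0 < depth L s ∧ depth L s ≤ c} ≤ ENNReal.ofReal (2 * c) := by
  rcases le_or_gt c 0 with hc | hc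
  · have : {s | s ∈ Icc (0 : ℝ) 1 ∧ 0 < depth L s ∧ depth L s ≤ c} = ∅ :=
      eq_empty_of_forall_notMem fun s hs => by linarith [hs.2.1, hs.2.2]
    rw [this, measure_empty]
    exact zero_le
  have hsub : {s | s ∈ Icc (0 : ℝ) 1 ∧ 0 < depth L s ∧ depth L s ≤ c} ⊆
      Icc 0 c ∪ Icc (L - c) L := fun s ⟨hs, h0, h1⟩ => by
    have hs' := (depth_pos_iff hL0 hL hs).1 h0
    rcases le_total s (L / 2) with h2 | h2
    · rw [depth_of_le_half hL hs.1 h2] at h1; exact Or.inl ⟨hs.1, h1⟩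
    · rw [depth_of_half_le hL h2 hs'.2.le] at h1; exact Or.inr ⟨by linarith, hs'.2.le⟩
  refine (measure_mono hsub).trans ((measure_union_le _ _).trans ?_)
  rw [Real.volume_Icc, Real.volume_Icc, ← ENNReal.ofReal_add (by linarith) (by linarith)]
  exact ENNReal.ofReal_le_ofReal (by linarith)

end Depth

/-! ### The phases of the branching construction -/

open Classical in
/-- The indicator of a proposition. -/
noncomputable def ind (P : Prop) : ℝ := if P then 1 else 0

theorem ind_of {P : Prop} (h : P) : ind P = 1 := if_pos h

theorem ind_of_not {P : Prop} (h : ¬ P) : ind P = 0 := if_neg h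

theorem abs_ind_le (P : Prop) : |ind P| ≤ 1 := by
  unfold ind; split_ifs <;> simp

theorem measurable_ind {α : Type*} [MeasurableSpace α] {P : α → Prop}
    (h : MeasurableSet {x | P x}) : Measurable fun x => ind (P x) := by
  classical exact Measurable.ite h measurable_const measurable_const

theorem IsIntervalSum.mono {g : ℝ → ℝ} {N N' : ℕ} (h : IsIntervalSum g N) (hN : N ≤ N') :
    IsIntervalSum g N' := by
  obtain ⟨ι, s, A, hs, h⟩ := h
  exact ⟨ι, s, A, hs.trans hN, h⟩

theorem isIntervalSum_ite {ι : Type} (s : Finset ι) {A : ι → Set ℝ} (hA : ∀ i, (A i).OrdConnected)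
    {P : ℝ → Prop} (hP : ∀ t ∈ Ico (0 : ℝ) 1, P t ↔ ∃ i ∈ s, t ∈ A i)
    (hu : ∀ t ∈ Ico (0 : ℝ) 1, ∀ i ∈ s, ∀ j ∈ s, t ∈ A i → t ∈ A j → i = j) :
    IsIntervalSum (fun t => ind (P t)) s.card := by
  refine ⟨ι, s, A, le_rfl, hA, fun t ht => ?_⟩
  dsimp only
  by_cases h : P t
  · rw [ind_of h]
    obtain ⟨i, hi, hit⟩ := (hP t ht).1 h
    rw [Finset.sum_eq_single_of_mem i hi fun j hj hji =>
      indicator_of_notMem (fun hjt => hji (hu t ht j hj i hi hjt hit)) _]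
    simp [hit]
  · rw [ind_of_not h]
    exact (Finset.sum_eq_zero fun i hi =>
      indicator_of_notMem (fun hit => h ((hP t ht).2 ⟨i, hi, hit⟩)) _).symm

theorem isIntervalSum_zero (N : ℕ) : IsIntervalSum (fun _ => 0) N :=
  ⟨ℕ, ∅, fun _ => ∅, by simp, fun _ => ordConnected_empty, by simp⟩

theorem isIntervalSum_of_ordConnected {A : Set ℝ} (hA : A.OrdConnected) :
    IsIntervalSum (fun t => ind (t ∈ A)) 1 :=
  isIntervalSum_ite (ι := Unit) {()} (A := fun _ => A) (fun _ => hA) (by simp) (by simp)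

theorem isIntervalSum_one : IsIntervalSum (fun _ => 1) 1 := by
  simpa [ind] using isIntervalSum_of_ordConnected ordConnected_univ

section Phase

variable {L : ℝ} {n J k : ℕ}

theorem turn_mono (hL : 0 < L) : Monotone (turn L n J k) := fun d d' h => by
  have := slope_pos (n := n) hL (k + 1)
  have := mesh_pos n k
  unfold turn
  gcongr

theorem turn_le_half (hL : 0 < L) (hk : k < J) {d : ℝ} (hd : d ≤ thr L J k) :
    turn L n J k d ≤ 1 / 2 := by
  have hm := mesh_pos n k
  have h1 := slope_mul_sub_thr (n := n) hL hk
  have h2 : slope L n (k + 1) * (d - thr L J (k + 1)) ≤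
      slope L n (k + 1) * (thr L J k - thr L J (k + 1)) := by
    have := slope_pos (n := n) hL (k + 1)
    gcongr
  rw [turn, div_le_iff₀ (by positivity)]; linarith

theorem turn_nonneg (hL : 0 < L) {d : ℝ} (hd : thr L J (k + 1) ≤ d) :
    0 ≤ turn L n J k d := by
  have hm := mesh_pos n k
  have := slope_pos (n := n) hL (k + 1)
  have : 0 ≤ slope L n (k + 1) * (d - thr L J (k + 1)) := mul_nonneg this.le (by linarith)
  unfold turn; positivity

/-- Each of the 2^(n+k) periods contains two ascending intervals, one in each half, which the
Boolean index tells apart. -/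
theorem isIntervalSum_increasing (hL : 0 < L) (hk : k < J) {d : ℝ}
    (h1 : thr L J (k + 1) < d) (h2 : d ≤ thr L J k) :
    IsIntervalSum (fun t => ind (Increasing L n J k d t)) (2 * 2 ^ (n + k)) := by
  have hm := mesh_pos n k
  have hβ := turn_le_half (n := n) hL hk h2
  have hβ0 := turn_nonneg (n := n) hL h1.le
  have hmono : Monotone fun t : ℝ => t / mesh n k := fun a b h => by dsimp only; gcongr
  let A : ℕ × Bool → Set ℝ := fun i => (fun t : ℝ => t / mesh n k) ⁻¹'
    (if i.2 then Ico (i.1 + 1 / 2 : ℝ) (i.1 + 1 - turn L n J k d)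
      else Ico (i.1 : ℝ) (i.1 + turn L n J k d))
  have hfl : ∀ t : ℝ, ∀ i : ℕ × Bool, t ∈ A i → ⌊t / mesh n k⌋ = i.1 := by
    rintro t ⟨m, b⟩ ht
    rw [Int.floor_eq_iff]
    rcases b with _ | _ <;> simp only [A, mem_preimage, if_true, Bool.false_eq_true, if_false,
      mem_Ico] at ht <;> push_cast <;> constructor <;> linarith
  have hc : (Finset.range (2 ^ (n + k)) ×ˢ (Finset.univ : Finset Bool)).card = 2 * 2 ^ (n + k) := by
    simp [mul_comm]
  rw [← hc]
  refine isIntervalSum_ite _ (A := A) (fun i => ?_) (fun t ht => ?_) fun t ht i hi j hj hit hjt => ?_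
  · refine OrdConnected.preimage_mono ?_ hmono
    split_ifs <;> exact ordConnected_Ico
  · have hz0 : 0 ≤ t / mesh n k := div_nonneg ht.1 hm.le
    have hz1 : t / mesh n k < 2 ^ (n + k) := by
      rw [div_lt_iff₀ hm, two_pow_mul_mesh]; exact ht.2
    constructor
    · intro h
      have hfr := Int.self_sub_floor (t / mesh n k)
      obtain ⟨m, hm'⟩ := Int.eq_ofNat_of_zero_le (Int.floor_nonneg.2 hz0)
      have hle := Int.floor_le (t / mesh n k)
      rw [hm'] at hfr hle
      push_cast at hfr hle
      have hmr : m ∈ Finset.range (2 ^ (n + k)) := by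
        rw [Finset.mem_range]
        exact_mod_cast hle.trans_lt hz1
      rcases h with h | ⟨h, h'⟩
      · refine ⟨(m, false), by simpa using hmr, ?_⟩
        simp only [A, mem_preimage, Bool.false_eq_true, if_false, mem_Ico]
        constructor <;> linarith
      · refine ⟨(m, true), by simpa using hmr, ?_⟩
        simp only [A, mem_preimage, if_true, mem_Ico]
        constructor <;> linarith
    · rintro ⟨i, -, hi⟩
      have hfr := Int.self_sub_floor (t / mesh n k)
      rw [hfl t i hi] at hfr
      push_cast at hfr
      obtain ⟨m, b⟩ := i
      rcases b with _ | _ <;> simp only [A, mem_preimage, if_true, Bool.false_eq_true, if_false,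
        mem_Ico] at hi
      · exact Or.inl (by linarith)
      · exact Or.inr ⟨by linarith, by linarith⟩
  · have h := (hfl t i hit).symm.trans (hfl t j hjt)
    obtain ⟨m, b⟩ := i
    obtain ⟨m', b'⟩ := j
    have hmm : m = m' := by exact_mod_cast h
    subst hmm
    rcases b with _ | _ <;> rcases b' with _ | _ <;>
      simp only [A, mem_preimage, if_true, Bool.false_eq_true, if_false, mem_Ico] at hit hjt
    · rfl
    · linarith
    · linarith
    · rfl

/-- The region of the third well in terms of the distance `d` to the boundary of the laminated
strip. -/
def Branch (L : ℝ) (n J : ℕ) (d y : ℝ) : Prop :=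
  ∃ k < J, thr L J (k + 1) < d ∧ d ≤ thr L J k ∧ Increasing L n J k d y

/-- Layers are half-open in the depth and the thresholds decrease, so distinct layers are disjoint.
-/
theorem layer_unique (hL : 0 < L) {d : ℝ} {k k' : ℕ} (h1 : thr L J (k + 1) < d)
    (h2 : d ≤ thr L J k) (h1' : thr L J (k' + 1) < d) (h2' : d ≤ thr L J k') : k = k' := by
  by_contra hne
  rcases Nat.lt_or_gt_of_ne hne with h | h
  · linarith [thr_antitone (J := J) hL (show k + 1 ≤ k' from h)]
  · linarith [thr_antitone (J := J) hL (show k' + 1 ≤ k from h)]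

theorem branch_iff (hL : 0 < L) {d y : ℝ} (hk : k < J) (h1 : thr L J (k + 1) < d)
    (h2 : d ≤ thr L J k) : Branch L n J d y ↔ Increasing L n J k d y := by
  refine ⟨fun ⟨k', _, h1', h2', h⟩ => ?_, fun h => ⟨k, hk, h1, h2, h⟩⟩
  rwa [layer_unique hL h1 h2 h1' h2']

theorem Branch.pos (hL : 0 < L) {d y : ℝ} (h : Branch L n J d y) : 0 < d := by
  obtain ⟨k, -, h, -⟩ := h
  exact (thr_nonneg hL _).trans_lt h

theorem increasing_add_one (d y : ℝ) :
    Increasing L n J k d (y + 1) ↔ Increasing L n J k d y := by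
  have hm := mesh_pos n k
  have : (y + 1) / mesh n k = y / mesh n k + (2 ^ (n + k) : ℕ) := by
    rw [add_div]; congr 1
    rw [div_eq_iff hm.ne']; push_cast; exact (two_pow_mul_mesh n k).symm
  rw [Increasing, Increasing, this, Int.fract_add_natCast]

theorem branch_add_one (d y : ℝ) : Branch L n J d (y + 1) ↔ Branch L n J d y := by
  simp only [Branch, increasing_add_one]

/-- The range of distances to the boundary for which a point with relative position `z` in its
period lies in the ascending part of generation `k`. -/
def layerRange (L : ℝ) (n J k : ℕ) (z : ℝ) (b : Bool) : Set ℝ :=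
  {d | thr L J (k + 1) < d ∧ d ≤ thr L J k ∧
    if b then 1 / 2 ≤ z ∧ z < 1 - turn L n J k d else z < turn L n J k d}

/-- The turning position is monotone in the depth, so a horizontal line crosses each ascending piece
of a layer in a single interval of depths. This keeps the number of horizontal crossings linear in
`J`. -/
theorem ordConnected_layerRange (hL : 0 < L) (z : ℝ) (b : Bool) :
    (layerRange L n J k z b).OrdConnected := by
  refine ⟨fun x hx y hy w hw => ?_⟩
  have h1 := turn_mono (n := n) (J := J) (k := k) hL hw.1
  have h2 := turn_mono (n := n) (J := J) (k := k) hL hw.2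
  refine ⟨hx.1.trans_le hw.1, hw.2.trans hy.2.1, ?_⟩
  have hx3 := hx.2.2
  have hy3 := hy.2.2
  cases b <;> simp only [if_true, Bool.false_eq_true, if_false] at hx3 hy3 ⊢
  · linarith
  · exact ⟨hx3.1, by linarith⟩

theorem branch_iff_layerRange (d y : ℝ) :
    Branch L n J d y ↔ ∃ k < J, ∃ b, d ∈ layerRange L n J k (Int.fract (y / mesh n k)) b := by
  constructor
  · rintro ⟨k, hk, h1, h2, h | h⟩
    · exact ⟨k, hk, false, h1, h2, by simpa using h⟩
    · exact ⟨k, hk, true, h1, h2, by simpa using h⟩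
  · rintro ⟨k, hk, b, h1, h2, h⟩
    refine ⟨k, hk, h1, h2, ?_⟩
    cases b
    · exact Or.inl (by simpa using h)
    · exact Or.inr (by simpa using h)

/-- The count 4J is J layers, times two sides of the strip, times two ascending pieces per period.
-/
theorem isIntervalSum_branch_left (hL0 : 0 < L) (hL : L < 1) (y : ℝ) :
    IsIntervalSum (fun s => ind (Branch L n J (depth L s) y)) (4 * J) := by
  let D : ℕ → Bool → Set ℝ := fun k => layerRange L n J k (Int.fract (y / mesh n k))
  let A : ℕ × Bool × Bool → Set ℝ := fun i =>
    if i.2.1 then Ioo (L / 2) L ∩ (fun s => L - s) ⁻¹' D i.1 i.2.2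
    else Icc 0 (L / 2) ∩ D i.1 i.2.2
  have hA : ∀ s ∈ Ico (0 : ℝ) 1, ∀ i, s ∈ A i → depth L s ∈ D i.1 i.2.2 ∧
      (i.2.1 = true ↔ L / 2 < s) := by
    rintro s hs ⟨k, a, b⟩ h
    cases a <;> simp only [A, if_true, Bool.false_eq_true, if_false] at h
    · rw [depth_of_le_half hL h.1.1 h.1.2]
      exact ⟨h.2, by simpa using h.1.2⟩
    · rw [depth_of_half_le hL h.1.1.le h.1.2.le]
      exact ⟨h.2, by simpa using h.1.1⟩
  have hc : (Finset.range J ×ˢ (Finset.univ : Finset (Bool × Bool))).card = 4 * J := by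
    simp [mul_comm]
  rw [← hc]
  refine isIntervalSum_ite _ (A := A) (fun i => ?_) (fun s hs => ?_) fun s hs i hi j hj his hjs => ?_
  · have h := ordConnected_layerRange (n := n) (J := J) (k := i.1) hL0
      (Int.fract (y / mesh n i.1)) i.2.2
    simp only [A]
    split_ifs
    · exact ordConnected_Ioo.inter (h.preimage_anti fun a b hab => sub_le_sub_left hab L)
    · exact ordConnected_Icc.inter h
  · rw [branch_iff_layerRange]
    constructor
    · rintro ⟨k, hk, b, h⟩
      have hpos : 0 < depth L s := (thr_nonneg hL0 _).trans_lt h.1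
      have hs' := (depth_pos_iff hL0 hL ⟨hs.1, hs.2.le⟩).1 hpos
      rcases le_or_gt s (L / 2) with h' | h'
      · refine ⟨(k, false, b), by simpa using hk, ?_⟩
        rw [depth_of_le_half hL hs.1 h'] at h
        exact ⟨⟨hs.1, h'⟩, h⟩
      · refine ⟨(k, true, b), by simpa using hk, ?_⟩
        rw [depth_of_half_le hL h'.le hs'.2.le] at h
        exact ⟨⟨h', hs'.2⟩, h⟩
    · rintro ⟨i, hi, his⟩
      exact ⟨i.1, by simpa using hi, i.2.2, (hA s hs i his).1⟩
  · obtain ⟨h1, h2⟩ := hA s hs i his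
    obtain ⟨h1', h2'⟩ := hA s hs j hjs
    obtain ⟨k, a, b⟩ := i
    obtain ⟨k', a', b'⟩ := j
    obtain rfl : k = k' := layer_unique hL0 h1.1 h1.2.1 h1'.1 h1'.2.1
    obtain rfl : a = a' := by
      rw [Bool.eq_iff_iff]; exact h2.trans h2'.symm
    have hk : k < J := by simpa using hi
    have hβ := turn_le_half (n := n) hL0 hk h1.2.1
    have e1 := h1.2.2
    have e2 := h1'.2.2
    cases b <;> cases b' <;> simp only [if_true, Bool.false_eq_true, if_false] at e1 e2
    · rfl
    · linarith
    · linarith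
    · rfl

end Phase

section Phase

variable {L : ℝ} {n J k : ℕ}

/-- The phases of the branching construction: the first well outside the strip, the other two wells
in its branching fine mixture. -/
noncomputable def branchingPhase (L : ℝ) (n J : ℕ) : Fin 3 → Plane → ℝ :=
  ![fun x => 1 - ind (0 < depth L (x 0)),
    fun x => (ind (0 < depth L (x 0))) - ind (Branch L n J (depth L (x 0)) (x 1)),
    fun x => ind (Branch L n J (depth L (x 0)) (x 1))]

theorem measurable_turn : Measurable (turn L n J k) := by unfold turn; fun_prop

theorem measurableSet_branch :
    MeasurableSet {x : Plane | Branch L n J (depth L (x 0)) (x 1)} := by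
  have hd : Measurable fun x : Plane => depth L (x 0) :=
    (lipschitzWith_depth L).continuous.measurable.comp (by fun_prop)
  have : {x : Plane | Branch L n J (depth L (x 0)) (x 1)} = ⋃ k, ⋃ _ : k < J,
      {x : Plane | thr L J (k + 1) < depth L (x 0) ∧ depth L (x 0) ≤ thr L J k ∧
        Increasing L n J k (depth L (x 0)) (x 1)} := by
    ext x; simp only [Branch, mem_ofPred_eq, mem_iUnion, exists_prop]
  rw [this]
  refine .iUnion fun k => .iUnion fun _ => ?_
  have hf : Measurable fun x : Plane => Int.fract (x 1 / mesh n k) :=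
    measurable_fract.comp (by fun_prop)
  have ht : Measurable fun x : Plane => turn L n J k (depth L (x 0)) := measurable_turn.comp hd
  exact (measurableSet_lt measurable_const hd).inter ((measurableSet_le hd measurable_const).inter
    ((measurableSet_lt hf ht).union ((measurableSet_le measurable_const hf).inter
      (measurableSet_lt hf (measurable_const.sub ht)))))

theorem measurableSet_strip : MeasurableSet {x : Plane | 0 < depth L (x 0)} :=
  measurableSet_lt measurable_const
    ((lipschitzWith_depth L).continuous.measurable.comp (by fun_prop))

theorem measurable_strip : Measurable fun x : Plane => ind (0 < depth L (x 0)) :=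
  measurable_ind measurableSet_strip

theorem measurable_branch :
    Measurable fun x : Plane => ind (Branch L n J (depth L (x 0)) (x 1)) :=
  measurable_ind measurableSet_branch

theorem tvBound_one : TVBound (fun _ => 1) 4 := by
  have h := tvBound_of_sections (f := fun _ => 1) (M := 1) (N := fun _ => 1) (K := 1) (I := 1)
    measurable_const (by simp) (by simp) (by simp)
    (fun _ _ => isIntervalSum_one) fun _ _ => isIntervalSum_one
  norm_num at h
  exact h

theorem tvBound_strip (hL0 : 0 < L) (hL : L < 1) :
    TVBound (fun x : Plane => ind (0 < depth L (x 0))) 4 := by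
  have h := tvBound_of_sections (f := fun x : Plane => ind (0 < depth L (x 0))) (M := 1)
    (N := fun _ => 1) (K := 1) (I := 1) measurable_strip
    (fun _ => abs_ind_le _) (by simp) (by simp) (fun s _ => ?_) fun t _ => ?_
  · norm_num at h
    exact h
  · simp only [point_zero]
    by_cases h : 0 < depth L s
    · simpa only [ind_of h] using isIntervalSum_one
    · simpa only [ind_of_not h] using isIntervalSum_zero 1
  · simp only [point_zero]
    have h := isIntervalSum_ite (ι := Unit) {()} (A := fun _ => Ioo 0 L)
      (P := fun s => 0 < depth L s) (fun _ => ordConnected_Ioo)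
      (fun s hs => by simpa using depth_pos_iff hL0 hL ⟨hs.1, hs.2.le⟩) (by simp)
    exact h

/-- The number of intervals in the section of the third phase at depth `d`. -/
noncomputable def layerCount (L : ℝ) (n J : ℕ) (s : ℝ) : ℕ :=
  ∑ k ∈ Finset.range J, {s | thr L J (k + 1) < depth L s ∧ depth L s ≤ thr L J k}.indicator
    (fun _ => 2 * 2 ^ (n + k)) s

theorem measurableSet_layer (k : ℕ) :
    MeasurableSet {s | thr L J (k + 1) < depth L s ∧ depth L s ≤ thr L J k} := by
  have hd : Measurable (depth L) := (lipschitzWith_depth L).continuous.measurable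
  exact (measurableSet_lt measurable_const hd).inter (measurableSet_le hd measurable_const)

theorem volume_layer_le (hL0 : 0 < L) (hL : L < 1) (k : ℕ) :
    volume ({s | thr L J (k + 1) < depth L s ∧ depth L s ≤ thr L J k} ∩ Icc 0 1) ≤
      ENNReal.ofReal (2 * thr L J k) :=
  (measure_mono fun s hs => show s ∈ {s | s ∈ Icc (0 : ℝ) 1 ∧ 0 < depth L s ∧ depth L s ≤ thr L J k}
    from ⟨hs.2, (thr_nonneg hL0 _).trans_lt hs.1.1, hs.1.2⟩).trans (volume_depth_le hL0 hL _)

theorem cast_layerCount (s : ℝ) : (layerCount L n J s : ℝ) = ∑ k ∈ Finset.range J,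
    {s | thr L J (k + 1) < depth L s ∧ depth L s ≤ thr L J k}.indicator
      (fun _ => (2 * 2 ^ (n + k) : ℝ)) s := by
  rw [layerCount, Nat.cast_sum]
  refine Finset.sum_congr rfl fun k _ => ?_
  by_cases h : s ∈ {s | thr L J (k + 1) < depth L s ∧ depth L s ≤ thr L J k}
  · rw [indicator_of_mem h, indicator_of_mem h]; push_cast; rfl
  · rw [indicator_of_notMem h, indicator_of_notMem h, Nat.cast_zero]

theorem integrable_layer (c : ℝ) (k : ℕ) : IntegrableOn
    ({s | thr L J (k + 1) < depth L s ∧ depth L s ≤ thr L J k}.indicator fun _ => c) (Icc 0 1) :=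
  (integrable_const c).indicator (measurableSet_layer k)

theorem integrableOn_layerCount :
    IntegrableOn (fun s => (layerCount L n J s : ℝ)) (Icc 0 1) := by
  simp only [cast_layerCount]
  exact integrable_finsetSum _ fun k _ => integrable_layer _ k

/-- Layer `k` has measure at most L·3^(-k) and its sections have 2·2^(n+k) intervals. The series in
2/3 has sum 3, whence 6·2^n. -/
theorem integral_layerCount_le (hL0 : 0 < L) (hL : L < 1) :
    ∫ s in Icc (0 : ℝ) 1, (layerCount L n J s : ℝ) ≤ 6 * 2 ^ n := by
  simp only [cast_layerCount]
  rw [integral_finsetSum _ fun k _ => integrable_layer _ k]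
  have h1 : ∀ k ∈ Finset.range J, ∫ s in Icc (0 : ℝ) 1,
      {s | thr L J (k + 1) < depth L s ∧ depth L s ≤ thr L J k}.indicator
        (fun _ => (2 * 2 ^ (n + k) : ℝ)) s ≤ 2 * 2 ^ n * (2 / 3) ^ k := fun k hk => by
    rw [integral_indicator_const _ (measurableSet_layer k), measureReal_def,
      Measure.restrict_apply (measurableSet_layer k), smul_eq_mul]
    have h2 := ENNReal.toReal_mono ENNReal.ofReal_ne_top (volume_layer_le (J := J) hL0 hL k)
    rw [ENNReal.toReal_ofReal (by linarith [thr_nonneg (J := J) hL0 k])] at h2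
    calc _ ≤ 2 * thr L J k * (2 * 2 ^ (n + k)) := by gcongr
      _ = 2 * (L / 2 * (1 / 3) ^ k) * (2 * 2 ^ (n + k)) := by
        rw [thr_of_le (Finset.mem_range.1 hk).le]
      _ = L * (2 * 2 ^ n * (2 ^ k * (1 / 3) ^ k)) := by rw [pow_add]; ring
      _ = L * (2 * 2 ^ n * (2 / 3) ^ k) := by rw [← mul_pow]; norm_num
      _ ≤ 1 * (2 * 2 ^ n * (2 / 3) ^ k) := by gcongr
      _ = _ := one_mul _
  refine (Finset.sum_le_sum h1).trans ?_
  rw [← Finset.mul_sum, geom_sum_eq (by norm_num)]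
  have : (0 : ℝ) ≤ 2 ^ n * (2 / 3) ^ J := by positivity
  have e : ((2 / 3 : ℝ) ^ J - 1) / (2 / 3 - 1) = 3 * (1 - (2 / 3) ^ J) := by norm_num; ring
  rw [e]
  linarith

theorem isIntervalSum_branch_right (hL0 : 0 < L) (s : ℝ) :
    IsIntervalSum (fun t => ind (Branch L n J (depth L s) t)) (layerCount L n J s) := by
  by_cases h : ∃ k < J, thr L J (k + 1) < depth L s ∧ depth L s ≤ thr L J k
  · obtain ⟨k, hk, h1, h2⟩ := h
    simp only [branch_iff hL0 hk h1 h2]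
    refine (isIntervalSum_increasing hL0 hk h1 h2).mono ?_
    refine le_trans ?_ (Finset.single_le_sum (fun _ _ => Nat.zero_le _) (Finset.mem_range.2 hk))
    rw [indicator_of_mem (show s ∈ {s | thr L J (k + 1) < depth L s ∧ depth L s ≤ thr L J k} from
      ⟨h1, h2⟩)]
  · have : ∀ t, ¬ Branch L n J (depth L s) t := fun t ⟨k, hk, h1, h2, _⟩ => h ⟨k, hk, h1, h2⟩
    simp only [ind_of_not (this _)]
    exact isIntervalSum_zero _

theorem tvBound_branch (hL0 : 0 < L) (hL : L < 1) :
    TVBound (fun x : Plane => ind (Branch L n J (depth L (x 0)) (x 1)))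
      (12 * 2 ^ n + 8 * J) := by
  have h := tvBound_of_sections (I := 6 * 2 ^ n) (K := 4 * J) (M := 1)
    (measurable_branch (L := L) (n := n) (J := J))
    (fun _ => abs_ind_le _) (integrableOn_layerCount (L := L) (n := n) (J := J))
    (integral_layerCount_le hL0 hL) (fun s _ => ?_) fun t _ => ?_
  · convert h using 1
    push_cast; ring
  · simpa only [point_zero, point_one] using isIntervalSum_branch_right hL0 s
  · simpa only [point_zero, point_one] using isIntervalSum_branch_left hL0 hL t

theorem torusTV_branchingPhase_le (hL0 : 0 < L) (hL : L < 1) (j : Fin 3) :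
    torusTV (branchingPhase L n J j) ≤ ENNReal.ofReal (20 * 2 ^ n + 8 * J) := by
  have hb := tvBound_branch (n := n) (J := J) hL0 hL
  have hs := tvBound_strip hL0 hL
  have hsi := integrableOn_of_bounded (measurable_strip (L := L)) (M := 1)
    fun _ => abs_ind_le _
  have hbi := integrableOn_of_bounded (measurable_branch (L := L) (n := n) (J := J)) (M := 1)
    fun _ => abs_ind_le _
  have h1 : (1 : ℝ) ≤ 2 ^ n := one_le_pow₀ (by norm_num)
  have h2 : (0 : ℝ) ≤ J := Nat.cast_nonneg J
  fin_cases j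
  · exact (tvBound_one.sub hs (integrable_const 1) hsi).torusTV_le.trans
      (ENNReal.ofReal_le_ofReal (by linarith))
  · exact (hs.sub hb hsi hbi).torusTV_le.trans (ENNReal.ofReal_le_ofReal (by linarith))
  · exact hb.torusTV_le.trans (ENNReal.ofReal_le_ofReal (by linarith))

theorem isPhase_branchingPhase (hL0 : 0 < L) (hL : L < 1) : IsPhase (branchingPhase L n J) where
  measurable j := by
    fin_cases j
    · exact measurable_const.sub measurable_strip
    · exact measurable_strip.sub measurable_branch
    · exact measurable_branch
  periodic j i x := by
    have h0 : depth L ((x + basisVec i) 0) = depth L (x 0) := by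
      rw [PiLp.add_apply, basisVec_apply]
      split_ifs
      · exact depth_add_one _ _
      · rw [add_zero]
    have h1 : ∀ d, Branch L n J d ((x + basisVec i) 1) ↔ Branch L n J d (x 1) := fun d => by
      rw [PiLp.add_apply, basisVec_apply]
      split_ifs
      · exact branch_add_one _ _
      · rw [add_zero]
    fin_cases j <;> simp only [branchingPhase, Fin.zero_eta, Fin.mk_one, Fin.reduceFinMk,
      Matrix.cons_val, h0, h1]
  zero_or_one j x := by
    have := Branch.pos (n := n) (J := J) (d := depth L (x 0)) (y := x 1) hL0
    fin_cases j <;> by_cases h : 0 < depth L (x 0) <;>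
      by_cases h' : Branch L n J (depth L (x 0)) (x 1) <;>
        (simp [branchingPhase, ind, h, h']; try tauto)
  sum_eq_one x := by
    simp [branchingPhase, Fin.sum_univ_three]
  finite_tv j := (torusTV_branchingPhase_le hL0 hL j).trans_lt ENNReal.ofReal_lt_top

theorem diagOne_branchingPhase (x : Plane) : diagOne (branchingPhase L n J) x =
    1 - 2 * ind (0 < depth L (x 0)) := by
  simp only [diagOne, branchingPhase, Matrix.cons_val]
  ring

theorem diagTwo_branchingPhase (x : Plane) : diagTwo (branchingPhase L n J) x =
    2 * (ind (Branch L n J (depth L (x 0)) (x 1))) -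
      ind (0 < depth L (x 0)) := by
  simp only [diagTwo, branchingPhase, Matrix.cons_val]
  ring

end Phase

/-! ### The deformation of the branching construction -/

theorem lineDeriv_point_zero (F : ℝ → ℝ → ℝ) (s t : ℝ) :
    lineDeriv ℝ (fun x : Plane => F (x 0) (x 1)) (point (s, t)) (basisVec 0) =
      deriv (fun r => F r t) s := by
  simp only [lineDeriv, point_add_smul_zero, point_zero, point_one]
  rw [deriv_comp_const_add (f := fun r => F r t), add_zero]

theorem lineDeriv_point_one (F : ℝ → ℝ → ℝ) (s t : ℝ) :
    lineDeriv ℝ (fun x : Plane => F (x 0) (x 1)) (point (s, t)) (basisVec 1) = deriv (F s) t := by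
  simp only [lineDeriv, point_add_smul_one, point_zero, point_one]
  rw [deriv_comp_const_add, add_zero]

section Deformation

variable {L : ℝ} {n J k : ℕ}

/-- The slope of the coarse laminate. -/
noncomputable def coarseSlope (L t : ℝ) : ℝ := 1 - 2 * ind (0 < depth L t)

/-- The coarse laminate. -/
noncomputable def coarse (L t : ℝ) : ℝ := ∫ r in (0 : ℝ)..t, coarseSlope L r

theorem abs_coarseSlope_le (L t : ℝ) : |coarseSlope L t| ≤ 1 := by
  by_cases h : 0 < depth L t
  · rw [coarseSlope, ind_of h]; norm_num
  · rw [coarseSlope, ind_of_not h]; norm_num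

theorem measurable_coarseSlope : Measurable (coarseSlope L) :=
  measurable_const.sub ((measurable_ind (measurableSet_lt measurable_const
    (lipschitzWith_depth L).continuous.measurable)).const_mul 2)

theorem intervalIntegrable_coarseSlope (a b : ℝ) :
    IntervalIntegrable (coarseSlope L) volume a b :=
  (intervalIntegrable_const (c := (1 : ℝ))).mono_fun
    measurable_coarseSlope.aestronglyMeasurable
    (.of_forall fun t => by simpa using abs_coarseSlope_le L t)

theorem lipschitzWith_coarse (L : ℝ) : LipschitzWith 1 (coarse L) :=
  LipschitzWith.of_dist_le_mul fun s t => by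
    rw [Real.dist_eq, coarse, coarse, intervalIntegral.integral_interval_sub_left
      (intervalIntegrable_coarseSlope _ _) (intervalIntegrable_coarseSlope _ _), Real.dist_eq]
    simpa using intervalIntegral.norm_integral_le_of_norm_le_const (f := coarseSlope L) (C := 1)
      (a := t) (b := s) fun r _ => abs_coarseSlope_le L r

theorem integral_coarseSlope (hL0 : 0 < L) (hL : L < 1) :
    ∫ t in Icc (0 : ℝ) 1, coarseSlope L t = 1 - 2 * L := by
  have h : ∀ t ∈ Icc (0 : ℝ) 1, coarseSlope L t = 1 - (Ioo 0 L).indicator (fun _ => 2) t :=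
    fun t ht => by
      by_cases h : t ∈ Ioo 0 L
      · rw [coarseSlope, ind_of ((depth_pos_iff hL0 hL ht).2 h), indicator_of_mem h]; norm_num
      · rw [coarseSlope, ind_of_not (mt (depth_pos_iff hL0 hL ht).1 h), indicator_of_notMem h]
        norm_num
  rw [setIntegral_congr_fun measurableSet_Icc h,
    integral_sub (integrable_const _) ((integrable_const _).indicator measurableSet_Ioo),
    integral_indicator_const _ measurableSet_Ioo, measureReal_def,
    Measure.restrict_apply measurableSet_Ioo, inter_eq_left.2 (Ioo_subset_Icc_self.trans
      (Icc_subset_Icc_right hL.le)), Real.volume_Ioo, ENNReal.toReal_ofReal (by linarith)]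
  simp
  ring

/-- The slope is -1 on a fraction `L` of each period and +1 elsewhere, which produces the mean 1 -
2L. -/
theorem coarse_add_one (hL0 : 0 < L) (hL : L < 1) (t : ℝ) :
    coarse L (t + 1) = coarse L t + (1 - 2 * L) := by
  have hp : Function.Periodic (coarseSlope L) 1 := fun t => by
    rw [coarseSlope, coarseSlope, depth_add_one]
  rw [coarse, ← intervalIntegral.integral_add_adjacent_intervals
    (intervalIntegrable_coarseSlope 0 t) (intervalIntegrable_coarseSlope t (t + 1)),
    hp.intervalIntegral_add_eq t 0, zero_add,
    intervalIntegral.integral_of_le zero_le_one, ← integral_Icc_eq_integral_Ioc,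
    integral_coarseSlope hL0 hL, coarse]

theorem deriv_coarse (hL0 : 0 < L) (hL : L < 1) {s : ℝ} (h0 : 0 < s) (h1 : s < 1) (hs : s ≠ L) :
    deriv (coarse L) s = coarseSlope L s := by
  refine (intervalIntegral.integral_hasDerivAt_right (intervalIntegrable_coarseSlope 0 s)
    ⟨univ, univ_mem, measurable_coarseSlope.aestronglyMeasurable⟩ ?_).deriv
  refine ContinuousAt.congr continuousAt_const (f := fun _ => coarseSlope L s) ?_
  rcases lt_or_gt_of_ne hs with h | h
  · filter_upwards [Ioo_mem_nhds h0 h] with r hr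
    rw [coarseSlope, coarseSlope, ind_of ((depth_pos_iff hL0 hL ⟨h0.le, h1.le⟩).2 ⟨h0, h⟩),
      ind_of ((depth_pos_iff hL0 hL ⟨hr.1.le, (hr.2.trans hL).le⟩).2 hr)]
  · filter_upwards [Ioo_mem_nhds h h1] with r hr
    rw [coarseSlope, coarseSlope, depth_of_ge hL0 h.le h1.le, depth_of_ge hL0 hr.1.le hr.2.le]

/-- The deformation of the branching construction. -/
noncomputable def branchingMap (L : ℝ) (n J : ℕ) : Fin 2 → Plane → ℝ :=
  ![fun x => coarse L (x 0), fun x => profile L n J (depth L (x 0)) (x 1)]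

theorem exists_lipschitzWith_branchingMap (L : ℝ) (n J : ℕ) (i : Fin 2) :
    ∃ K, LipschitzWith K (branchingMap L n J i) := by
  have hp : ∀ i : Fin 2, LipschitzWith 1 fun x : Plane => x i := fun i =>
    LipschitzWith.of_dist_le_mul fun x y => by
      rw [NNReal.coe_one, one_mul, dist_eq_norm, dist_eq_norm]
      exact PiLp.norm_apply_le (p := 2) (x - y) i
  fin_cases i
  · exact ⟨_, (lipschitzWith_coarse L).comp (hp 0)⟩
  · obtain ⟨K, hK⟩ := exists_lipschitzWith_profile (L := L) (n := n) (J := J)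
    have h : LipschitzWith (max (1 * 1) 1) fun x : Plane => (depth L (x 0), x 1) :=
      ((lipschitzWith_depth L).comp (hp 0)).prodMk (hp 1)
    have e : branchingMap L n J 1 = (fun p : ℝ × ℝ => profile L n J p.1 p.2) ∘
        fun x : Plane => (depth L (x 0), x 1) := by
      funext x
      simp only [branchingMap, Matrix.cons_val, Function.comp_apply]
    simp only [Fin.mk_one, e]
    exact ⟨_, hK.comp h⟩

theorem profile_add_basisVec (x : Plane) (j : Fin 2) :
    branchingMap L n J 1 (x + basisVec j) = branchingMap L n J 1 x := by
  simp only [branchingMap, Matrix.cons_val, PiLp.add_apply, basisVec_apply]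
  fin_cases j <;> simp [depth_add_one, profile_add_one]

theorem coarse_add_basisVec (hL0 : 0 < L) (hL : L < 1) (x : Plane) (j : Fin 2) :
    branchingMap L n J 0 (x + basisVec j) =
      branchingMap L n J 0 x + if j = 0 then 1 - 2 * L else 0 := by
  simp only [branchingMap, Matrix.cons_val, PiLp.add_apply, basisVec_apply]
  fin_cases j <;> simp [coarse_add_one hL0 hL]

/-- The gradient of the branching construction. -/
noncomputable def branchingGrad (L : ℝ) (n J : ℕ) (x : Plane) : Mat2 :=
  Matrix.of fun i j => lineDeriv ℝ (branchingMap L n J i) x (basisVec j)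

theorem isDeformation_branchingMap (hL0 : 0 < L) (hL : L < 1) :
    IsDeformation (fun x => WithLp.toLp 2 fun i => branchingMap L n J i x)
      (branchingGrad L n J) := by
  refine isDeformation_of_lipschitz (exists_lipschitzWith_branchingMap L n J)
    (c := fun i j => if i = 0 then if j = 0 then 1 - 2 * L else 0 else 0) fun i j x => ?_
  fin_cases i
  · exact coarse_add_basisVec hL0 hL x j
  · simpa using profile_add_basisVec x j

theorem branchingGrad_zero_one (x : Plane) : branchingGrad L n J x 0 1 = 0 := by
  simp [branchingGrad, branchingMap, lineDeriv, basisVec_apply]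

theorem branchingGrad_zero_zero (hL0 : 0 < L) (hL : L < 1) {s : ℝ} (h0 : 0 < s) (h1 : s < 1)
    (hs : s ≠ L) (t : ℝ) : branchingGrad L n J (point (s, t)) 0 0 = coarseSlope L s :=
  (lineDeriv_point_zero (fun s _ => coarse L s) s t).trans (deriv_coarse hL0 hL h0 h1 hs)

theorem ae_mem_Ioo_ne (c : ℝ) :
    ∀ᵐ s ∂volume.restrict (Icc (0 : ℝ) 1), s ∈ Ioo (0 : ℝ) 1 ∧ s ≠ c := by
  filter_upwards [ae_restrict_mem measurableSet_Icc,
    ((countable_insert.2 (countable_insert.2 (countable_singleton c))).ae_notMem _ :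
      ∀ᵐ s ∂volume.restrict (Icc (0 : ℝ) 1), s ∉ ({0, 1, c} : Set ℝ))] with s hs h
  simp only [mem_insert_iff, mem_singleton_iff, not_or] at h
  exact ⟨⟨hs.1.lt_of_ne' h.1, hs.2.lt_of_ne h.2.1⟩, h.2.2⟩

theorem integral_branchingGrad (hL0 : 0 < L) (hL : L < 1) (i j : Fin 2) :
    ∫ x in unitSquare, branchingGrad L n J x i j = !![1 - 2 * L, 0; 0, 0] i j := by
  fin_cases i
  · fin_cases j
    · have hi : IntegrableOn (fun x => branchingGrad L n J x 0 0) unitSquare := by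
        have := (isDeformation_branchingMap (n := n) (J := J) hL0 hL).memLp_unitSquare 0 0
        exact this.integrable one_le_two
      simp only [Fin.zero_eta, Matrix.of_apply, Matrix.cons_val]
      rw [setIntegral_unitSquare hi, ← integral_coarseSlope hL0 hL]
      refine integral_congr_ae ?_
      filter_upwards [ae_mem_Ioo_ne L] with s hs
      simp [branchingGrad_zero_zero hL0 hL hs.1.1 hs.1.2 hs.2]
    · simp [branchingGrad_zero_one]
  · have h := setIntegral_lineDeriv_eq_zero (exists_lipschitzWith_branchingMap L n J 1)
      (fun j x => profile_add_basisVec x j) (basisVec j)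
    fin_cases j <;> simpa [branchingGrad] using h

/-! ### The energy of the branching construction -/

theorem branchingGrad_one_zero (s t : ℝ) : branchingGrad L n J (point (s, t)) 1 0 =
    deriv (fun r => profile L n J (depth L r) t) s :=
  lineDeriv_point_zero (fun s t => profile L n J (depth L s) t) s t

theorem branchingGrad_one_one (s t : ℝ) : branchingGrad L n J (point (s, t)) 1 1 =
    deriv (profile L n J (depth L s)) t :=
  lineDeriv_point_one (fun s t => profile L n J (depth L s) t) s t

/-- Strict inequalities at both thresholds keep a neighbourhood of `s` in one layer, and the depth
is 1-Lipschitz. -/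
theorem abs_branchingGrad_one_zero_le (hL : 0 < L) (hk : k ≤ J) {s : ℝ}
    (h1 : thr L J (k + 1) < depth L s) (h2 : depth L s < thr L J k) (t : ℝ) :
    |branchingGrad L n J (point (s, t)) 1 0| ≤ slope L n (k + 1) := by
  have hc := (lipschitzWith_depth L).continuous
  rw [branchingGrad_one_zero, ← Real.norm_eq_abs]
  refine norm_deriv_le_of_lip' (slope_pos hL _).le ?_
  filter_upwards [hc.continuousAt.eventually_const_lt h1, hc.continuousAt.eventually_lt_const h2]
    with r hr1 hr2
  refine (abs_profile_sub_le_left hL hk hr1.le hr2.le h1.le h2.le t).trans ?_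
  have := slope_pos (n := n) hL (k + 1)
  have h3 := (lipschitzWith_depth L).dist_le_mul r s
  rw [NNReal.coe_one, one_mul] at h3
  exact mul_le_mul_of_nonneg_left h3 this.le

theorem abs_branchingGrad_one_one_le (s t : ℝ) :
    |branchingGrad L n J (point (s, t)) 1 1| ≤ 1 := by
  rw [branchingGrad_one_one, ← Real.norm_eq_abs]
  refine norm_deriv_le_of_lip' zero_le_one (.of_forall fun r => ?_)
  rw [one_mul]
  exact abs_profile_sub_le_right (depth L s) r t

theorem branchingGrad_one_of_gt (hL0 : 0 < L) {s : ℝ} (h : L < s) (h1 : s < 1) (t : ℝ) :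
    branchingGrad L n J (point (s, t)) 1 0 = 0 ∧ branchingGrad L n J (point (s, t)) 1 1 = 0 := by
  rw [branchingGrad_one_zero, branchingGrad_one_one, depth_of_ge hL0 h.le h1.le]
  constructor
  · have : (fun r => profile L n J (depth L r) t) =ᶠ[𝓝 s] fun _ => 0 := by
      filter_upwards [Ioo_mem_nhds h h1] with r hr
      rw [depth_of_ge hL0 hr.1.le hr.2.le, profile_zero hL0]
    rw [this.deriv_eq, deriv_const]
  · have : profile L n J 0 = fun _ => 0 := funext fun y => profile_zero hL0 y
    rw [this, deriv_const]

theorem ae_fract_notMem (h : ℝ) (S : Set ℝ) (hS : S.Countable) (hh : 0 < h) :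
    ∀ᵐ t : ℝ, Int.fract (t / h) ∉ S := by
  have hc : {t : ℝ | Int.fract (t / h) ∈ S}.Countable := by
    refine ((hS.prod (countable_univ (α := ℤ))).image fun p => h * (p.1 + p.2)).mono fun t ht => ?_
    refine ⟨(Int.fract (t / h), ⌊t / h⌋), ⟨ht, mem_univ _⟩, ?_⟩
    dsimp only
    rw [Int.fract_add_floor]
    field_simp
  exact hc.ae_notMem volume

theorem ae_branchingGrad_one_one_eq (hL : 0 < L) (hk : k < J) {s : ℝ}
    (h1 : thr L J (k + 1) < depth L s) (h2 : depth L s ≤ thr L J k) :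
    ∀ᵐ t : ℝ, branchingGrad L n J (point (s, t)) 1 1 =
      diagTwo (branchingPhase L n J) (point (s, t)) := by
  filter_upwards [ae_fract_notMem (mesh n k)
    {0, turn L n J k (depth L s), 1 / 2, 1 - turn L n J k (depth L s)}
    (Set.toFinite _).countable (mesh_pos n k)] with t ht
  rw [branchingGrad_one_one, (hasDerivAt_profile hL hk h1.le h2 ht).deriv, diagTwo_branchingPhase,
    point_zero, point_one, ind_of ((thr_nonneg hL _).trans_lt h1)]
  by_cases h : Increasing L n J k (depth L s) t
  · rw [if_pos h, ind_of ((branch_iff hL hk h1 h2).2 h)]; norm_num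
  · rw [if_neg h, ind_of_not (mt (branch_iff hL hk h1 h2).1 h)]; norm_num

end Deformation

section Energy

variable {L : ℝ} {n J : ℕ}

theorem exists_layer {d : ℝ} (h0 : 0 < d) (h1 : d ≤ thr L J 0) :
    ∃ k ≤ J, thr L J (k + 1) < d ∧ d ≤ thr L J k := by
  classical
  have h : ∃ k, thr L J (k + 1) < d := ⟨J, by rwa [thr_last]⟩
  refine ⟨Nat.find h, Nat.find_min' h (by rwa [thr_last]), Nat.find_spec h, ?_⟩
  rcases hk : Nat.find h with _ | k
  · exact h1
  · exact not_lt.1 (Nat.find_min h (by omega : k < Nat.find h))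

/-- The bound for the elastic energy density in the `k`-th layer. -/
noncomputable def layerBound (L : ℝ) (n J k : ℕ) : ℝ :=
  slope L n (k + 1) ^ 2 + if k = J then 4 else 0

theorem layerBound_nonneg (k : ℕ) : 0 ≤ layerBound L n J k := by
  unfold layerBound; split_ifs <;> positivity

/-- The first row matches exactly, and so does ∂₂u₂ in every layer with k < J. What remains is the
x₁-slope of the profile, plus a crude bound in the last layer. -/
theorem ae_elasticDensity_le (hL0 : 0 < L) (hL : L < 1) :
    ∀ᵐ s ∂volume.restrict (Icc (0 : ℝ) 1), ∀ᵐ t : ℝ,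
      ∑ i, ∑ j, (branchingGrad L n J (point (s, t)) i j -
        phaseMatrix (branchingPhase L n J) (point (s, t)) i j) ^ 2 ≤
      ∑ k ∈ Finset.range (J + 1), {s | thr L J (k + 1) < depth L s ∧ depth L s ≤ thr L J k}.indicator
        (fun _ => layerBound L n J k) s := by
  -- Positions whose depth equals a threshold are discarded; they form a countable set.
  have hthr : ∀ᵐ s ∂volume.restrict (Icc (0 : ℝ) 1), ∀ k, s ≠ thr L J k ∧ s ≠ L - thr L J k :=
    ae_all_iff.2 fun k => by
      filter_upwards [ae_mem_Ioo_ne (thr L J k), ae_mem_Ioo_ne (L - thr L J k)] with s h1 h2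
      exact ⟨h1.2, h2.2⟩
  filter_upwards [ae_mem_Ioo_ne L, hthr] with s ⟨hs, hsL⟩ hst
  have hs' : s ∈ Icc (0 : ℝ) 1 := Ioo_subset_Icc_self hs
  have hnn : ∀ k ∈ Finset.range (J + 1),
      0 ≤ {s | thr L J (k + 1) < depth L s ∧ depth L s ≤ thr L J k}.indicator
        (fun _ => layerBound L n J k) s := fun k _ =>
    indicator_nonneg (fun _ _ => layerBound_nonneg k) s
  have hQ : ∀ t, ∑ i, ∑ j, (branchingGrad L n J (point (s, t)) i j -
        phaseMatrix (branchingPhase L n J) (point (s, t)) i j) ^ 2 =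
      branchingGrad L n J (point (s, t)) 1 0 ^ 2 + (branchingGrad L n J (point (s, t)) 1 1 -
        diagTwo (branchingPhase L n J) (point (s, t))) ^ 2 := fun t => by
    simp only [Fin.sum_univ_two, phaseMatrix_zero_zero, phaseMatrix_one_one, phaseMatrix_zero_one,
      phaseMatrix_one_zero, branchingGrad_zero_zero hL0 hL hs.1 hs.2 hsL, branchingGrad_zero_one,
      diagOne_branchingPhase, point_zero, coarseSlope]
    ring
  simp only [hQ]
  rcases lt_or_gt_of_ne hsL with h | h
  · have hd := (depth_pos_iff hL0 hL hs').2 ⟨hs.1, h⟩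
    obtain ⟨k, hk, h1, h2⟩ := exists_layer (J := J) hd (by rw [thr_zero]; exact depth_le hL0 s)
    have h2' : depth L s < thr L J k := h2.lt_of_ne fun e => by
      rcases depth_eq_iff hL0 hL hs' (e ▸ hd) e with e | e
      · exact (hst k).1 e
      · exact (hst k).2 e
    have hk' : k ∈ Finset.range (J + 1) := Finset.mem_range.2 (by omega)
    have hsum := Finset.single_le_sum hnn hk'
    rw [indicator_of_mem (show s ∈ {s | thr L J (k + 1) < depth L s ∧ depth L s ≤ thr L J k} from
      ⟨h1, h2⟩)] at hsum
    have h10 : ∀ t, branchingGrad L n J (point (s, t)) 1 0 ^ 2 ≤ slope L n (k + 1) ^ 2 := fun t =>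
      sq_le_sq' (by linarith [abs_le.1 (abs_branchingGrad_one_zero_le (n := n) hL0 hk h1 h2' t)])
        (abs_le.1 (abs_branchingGrad_one_zero_le (n := n) hL0 hk h1 h2' t)).2
    rcases hk.lt_or_eq with hkJ | rfl
    · filter_upwards [ae_branchingGrad_one_one_eq (n := n) hL0 hkJ h1 h2] with t ht
      refine le_trans ?_ hsum
      rw [ht, sub_self, layerBound, if_neg hkJ.ne]
      simpa using h10 t
    -- In the last layer `Branch` never holds, so ∂₂u₂ need not match χ₂₂. Both have modulus at most
    -- 1, hence the squared error is at most 4.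
    · refine .of_forall fun t => le_trans ?_ hsum
      rw [layerBound, if_pos rfl]
      have h3 := abs_le.1 (abs_branchingGrad_one_one_le (L := L) (n := n) (J := k) s t)
      have h4 := abs_le.1 ((isPhase_branchingPhase (n := n) (J := k) hL0 hL).abs_diagTwo_le
        (point (s, t)))
      nlinarith [h10 t]
  · refine .of_forall fun t => le_trans (le_of_eq ?_) (Finset.sum_nonneg hnn)
    have hd := depth_of_ge hL0 h.le hs.2.le
    obtain ⟨e1, e2⟩ := branchingGrad_one_of_gt (n := n) (J := J) hL0 h hs.2 t
    have hb : ¬ Branch L n J (depth L s) t := fun hb => by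
      linarith [hb.pos hL0]
    rw [e1, e2, diagTwo_branchingPhase, point_zero, point_one, ind_of_not hb,
      ind_of_not (by rw [hd]; exact lt_irrefl 0)]
    norm_num

/-- Squared slope times width scales like (9/4)^k·3^(-k) = (3/4)^k, with sum at most 4. The choice J
= 2n makes the last layer of order 9^(-n), which is dominated by 4^(-n). -/
theorem sum_layerBound_le (hL0 : 0 < L) (hL : L < 1) :
    ∑ k ∈ Finset.range (2 * n + 1), layerBound L n (2 * n) k * (2 * thr L (2 * n) k) ≤
      (9 / L + 4) * (1 / 4) ^ n := by
  have h1 : ∀ k ∈ Finset.range (2 * n + 1), layerBound L n (2 * n) k * (2 * thr L (2 * n) k) =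
      9 / 4 / L * (1 / 4) ^ n * (3 / 4) ^ k +
        if k = 2 * n then 4 * L * (1 / 9) ^ n else 0 := fun k hk => by
    have e1 : ((1 / 2 : ℝ) ^ n) ^ 2 = (1 / 4) ^ n := by rw [← pow_mul, mul_comm, pow_mul]; norm_num
    have e2 : ((3 / 2 : ℝ) ^ k) ^ 2 * (1 / 3) ^ k = (3 / 4) ^ k := by
      rw [← pow_mul, mul_comm k, pow_mul, ← mul_pow]; norm_num
    have e3 : slope L n (k + 1) ^ 2 * (2 * (L / 2 * (1 / 3) ^ k)) =
        9 / 4 / L * ((1 / 2 : ℝ) ^ n) ^ 2 * (((3 / 2 : ℝ) ^ k) ^ 2 * (1 / 3) ^ k) := by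
      unfold slope; rw [pow_succ]; field_simp; ring
    rw [thr_of_le (Nat.lt_succ_iff.1 (Finset.mem_range.1 hk)), layerBound, add_mul, e3, e1, e2]
    split_ifs with h
    · rw [h, pow_mul (1 / 3 : ℝ)]; norm_num; ring
    · rw [zero_mul]
  rw [Finset.sum_congr rfl h1, Finset.sum_add_distrib, ← Finset.mul_sum,
    Finset.sum_ite_eq' , if_pos (by simp), geom_sum_eq (by norm_num)]
  have e : ((3 / 4 : ℝ) ^ (2 * n + 1) - 1) / (3 / 4 - 1) ≤ 4 := by
    have : (0 : ℝ) ≤ (3 / 4) ^ (2 * n + 1) := by positivity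
    rw [div_le_iff_of_neg (by norm_num)]; linarith
  calc _ ≤ 9 / 4 / L * (1 / 4) ^ n * 4 + 4 * 1 * (1 / 4) ^ n := by (gcongr; norm_num)
    _ = _ := by ring

theorem lintegral_elasticDensity_le (hL0 : 0 < L) (hL : L < 1) :
    ∫⁻ x in unitSquare, ENNReal.ofReal (∑ i, ∑ j, (branchingGrad L n (2 * n) x i j -
      phaseMatrix (branchingPhase L n (2 * n)) x i j) ^ 2) ≤
      ENNReal.ofReal ((9 / L + 4) * (1 / 4) ^ n) := by
  have hm : Measurable fun x : Plane => ENNReal.ofReal (∑ i, ∑ j,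
      (branchingGrad L n (2 * n) x i j - phaseMatrix (branchingPhase L n (2 * n)) x i j) ^ 2) := by
    refine ENNReal.measurable_ofReal.comp (Finset.measurable_fun_sum _ fun i _ =>
      Finset.measurable_fun_sum _ fun j _ => Measurable.pow_const (Measurable.sub ?_ ?_) 2)
    · exact measurable_lineDeriv (exists_lipschitzWith_branchingMap L n (2 * n) i).choose_spec.continuous
    · have h := isPhase_branchingPhase (n := n) (J := 2 * n) hL0 hL
      fin_cases i <;> fin_cases j <;>
        simp only [Fin.zero_eta, Fin.mk_one, phaseMatrix_zero_zero, phaseMatrix_one_one,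
          phaseMatrix_zero_one, phaseMatrix_one_zero]
      · exact h.measurable_diagOne
      · exact measurable_const
      · exact measurable_const
      · exact h.measurable_diagTwo
  have hml := fun k => measurableSet_layer (L := L) (J := 2 * n) k
  rw [setLIntegral_unitSquare hm]
  calc _ ≤ ∫⁻ s in Icc (0 : ℝ) 1, ∑ k ∈ Finset.range (2 * n + 1),
        {s | thr L (2 * n) (k + 1) < depth L s ∧ depth L s ≤ thr L (2 * n) k}.indicator
          (fun _ => ENNReal.ofReal (layerBound L n (2 * n) k)) s := by
        refine lintegral_mono_ae ?_
        filter_upwards [ae_elasticDensity_le (n := n) (J := 2 * n) hL0 hL] with s hs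
        refine (lintegral_mono_ae (ae_restrict_of_ae (hs.mono fun t ht =>
          ENNReal.ofReal_le_ofReal ht))).trans_eq ?_
        rw [setLIntegral_const, Real.volume_Icc, sub_zero, ENNReal.ofReal_one, mul_one,
          ENNReal.ofReal_sum_of_nonneg fun k _ =>
            indicator_nonneg (fun _ _ => layerBound_nonneg k) s]
        refine Finset.sum_congr rfl fun k _ => ?_
        by_cases h : s ∈ {s | thr L (2 * n) (k + 1) < depth L s ∧ depth L s ≤ thr L (2 * n) k}
        · rw [indicator_of_mem h, indicator_of_mem h]
        · rw [indicator_of_notMem h, indicator_of_notMem h, ENNReal.ofReal_zero]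
    _ = ∑ k ∈ Finset.range (2 * n + 1), ENNReal.ofReal (layerBound L n (2 * n) k) *
        volume ({s | thr L (2 * n) (k + 1) < depth L s ∧ depth L s ≤ thr L (2 * n) k} ∩
          Icc 0 1) := by
        rw [lintegral_finsetSum _ fun k _ => measurable_const.indicator (hml k)]
        refine Finset.sum_congr rfl fun k _ => ?_
        rw [lintegral_indicator_const (hml k), Measure.restrict_apply (hml k)]
    _ ≤ ∑ k ∈ Finset.range (2 * n + 1),
        ENNReal.ofReal (layerBound L n (2 * n) k * (2 * thr L (2 * n) k)) := by
        refine Finset.sum_le_sum fun k _ => ?_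
        rw [ENNReal.ofReal_mul (layerBound_nonneg k)]
        gcongr
        exact volume_layer_le hL0 hL k
    _ ≤ _ := by
        rw [← ENNReal.ofReal_sum_of_nonneg fun k _ => mul_nonneg (layerBound_nonneg k)
          (mul_nonneg zero_le_two (thr_nonneg hL0 k))]
        exact ENNReal.ofReal_le_ofReal (sum_layerBound_le hL0 hL)

theorem energy_branching_le (hL0 : 0 < L) (hL : L < 1) {ε : ℝ} (hε : 0 ≤ ε) :
    energy ε (branchingGrad L n (2 * n)) (branchingPhase L n (2 * n)) ≤
      ENNReal.ofReal ((9 / L + 4) * (1 / 4) ^ n + ε * (108 * 2 ^ n)) := by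
  -- With J = 2n the term 8J = 16n is at most 16·2^n, so each phase has variation at most 36·2^n and
  -- all three together 108·2^n.
  have hn : (n : ℝ) ≤ 2 ^ n := by exact_mod_cast (Nat.lt_two_pow_self (n := n)).le
  have h : ∑ j, torusTV (branchingPhase L n (2 * n) j) ≤ ENNReal.ofReal (108 * 2 ^ n) := by
    calc _ ≤ ∑ _j : Fin 3, ENNReal.ofReal (36 * 2 ^ n) := by
          refine Finset.sum_le_sum fun j _ => (torusTV_branchingPhase_le hL0 hL j).trans
            (ENNReal.ofReal_le_ofReal ?_)
          push_cast; linarith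
      _ = _ := by
          rw [← ENNReal.ofReal_sum_of_nonneg fun _ _ => by positivity]
          congr 1
          rw [Finset.sum_const, Finset.card_univ, Fintype.card_fin, nsmul_eq_mul]
          push_cast; ring
  rw [ENNReal.ofReal_add (by positivity) (by positivity), ENNReal.ofReal_mul hε, energy]
  gcongr
  exact lintegral_elasticDensity_le hL0 hL

/-- Choosing 8^(-(n+1)) < ε ≤ 8^(-n) makes 2^(-n) comparable to ε^(1/3), which balances 4^(-n)
against ε2^n. -/
theorem exists_scale {ε : ℝ} (hε : ε ∈ Ioo (0 : ℝ) 1) :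
    ∃ n : ℕ, (1 / 4 : ℝ) ^ n ≤ 4 * ε ^ (2 / 3 : ℝ) ∧ ε * 2 ^ n ≤ ε ^ (2 / 3 : ℝ) := by
  obtain ⟨n, h1, h2⟩ := exists_nat_pow_near_of_lt_one (y := (1 / 8 : ℝ)) hε.1 hε.2.le
    (by norm_num) (by norm_num)
  set δ : ℝ := ε ^ (1 / 3 : ℝ) with hδ
  have hδ0 : 0 < δ := Real.rpow_pos_of_pos hε.1 _
  have e3 : δ ^ 3 = ε := by
    rw [hδ, ← Real.rpow_natCast, ← Real.rpow_mul hε.1.le]; norm_num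
  have e2 : ε ^ (2 / 3 : ℝ) = δ ^ 2 := by
    rw [hδ, ← Real.rpow_natCast, ← Real.rpow_mul hε.1.le]; norm_num
  have h3 : (1 / 2 : ℝ) ^ (n + 1) < δ := by
    refine lt_of_pow_lt_pow_left₀ 3 hδ0.le ?_
    rw [e3, ← pow_mul, mul_comm, pow_mul]; norm_num at h1 ⊢; exact h1
  have h4 : δ ≤ (1 / 2 : ℝ) ^ n := by
    refine le_of_pow_le_pow_left₀ (n := 3) (by norm_num) (by positivity) ?_
    rw [e3, ← pow_mul, mul_comm, pow_mul]; norm_num at h2 ⊢; exact h2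
  have h5 : (1 / 2 : ℝ) ^ n * 2 ^ n = 1 := by rw [← mul_pow]; norm_num
  refine ⟨n, ?_, ?_⟩
  · rw [e2, show (1 / 4 : ℝ) ^ n = ((1 / 2) ^ n) ^ 2 by
      rw [← pow_mul, mul_comm, pow_mul]; norm_num]
    rw [pow_succ] at h3
    have : (0 : ℝ) < (1 / 2) ^ n := by positivity
    nlinarith
  · rw [e2, ← e3]
    calc δ ^ 3 * 2 ^ n = δ ^ 2 * (δ * 2 ^ n) := by ring
      _ ≤ δ ^ 2 * ((1 / 2) ^ n * 2 ^ n) := by gcongr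
      _ = δ ^ 2 := by rw [h5, mul_one]

theorem meanEnergy_le (hL0 : 0 < L) (hL : L < 1) {ε : ℝ} (hε : ε ∈ Ioo (0 : ℝ) 1) :
    meanEnergy ε !![1 - 2 * L, 0; 0, 0] ≤ ENNReal.ofReal ((36 / L + 124) * ε ^ (2 / 3 : ℝ)) := by
  obtain ⟨n, h1, h2⟩ := exists_scale hε
  refine (iInf₂_le (branchingPhase L n (2 * n)) (isPhase_branchingPhase hL0 hL)).trans
    ((iInf₂_le _ (branchingGrad L n (2 * n))).trans
    ((iInf₂_le (isDeformation_branchingMap hL0 hL) (integral_branchingGrad hL0 hL)).trans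
    ((energy_branching_le hL0 hL hε.1.le).trans (ENNReal.ofReal_le_ofReal ?_))))
  calc (9 / L + 4) * (1 / 4) ^ n + ε * (108 * 2 ^ n)
      = (9 / L + 4) * (1 / 4) ^ n + 108 * (ε * 2 ^ n) := by ring
    _ ≤ (9 / L + 4) * (4 * ε ^ (2 / 3 : ℝ)) + 108 * ε ^ (2 / 3 : ℝ) := by gcongr
    _ = _ := by ring

end Energy

/-! ### The laminates of the three wells -/

/-- A vanishing determinant is all that is needed to rule out rank-one connections below. -/
theorem det_eq_zero_of_rank_eq_one {A : Mat2} (h : A.rank = 1) : A.det = 0 := by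
  by_contra hd
  have := Matrix.rank_of_isUnit A ((Matrix.isUnit_iff_isUnit_det A).2 (isUnit_iff_ne_zero.2 hd))
  rw [h, Fintype.card_fin] at this
  omega

theorem well_mem_K3 (j : Fin 3) : well j ∈ K3 := mem_range_self j

theorem diagonal_eq_combination (a b c d t : ℝ) :
    t • (!![a, 0; 0, b] : Mat2) + (1 - t) • !![c, 0; 0, d] =
      !![t * a + (1 - t) * c, 0; 0, t * b + (1 - t) * d] := by
  ext i j; fin_cases i <;> fin_cases j <;> simp

theorem det_diagonal_sub (a b c d : ℝ) :
    ((!![a, 0; 0, b] : Mat2) - !![c, 0; 0, d]).det = (a - c) * (b - d) := by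
  simp [Matrix.det_fin_two]

theorem rank_diagonal_zero {b : ℝ} (hb : b ≠ 0) : (!![0, 0; 0, b] : Mat2).rank = 1 := by
  have h : (!![0, 0; 0, b] : Mat2) = Matrix.diagonal ![0, b] := by
    ext i j; fin_cases i <;> fin_cases j <;> simp
  rw [h, Matrix.rank_diagonal, Fintype.card_eq_one_iff]
  refine ⟨⟨1, by simpa using hb⟩, fun ⟨i, hi⟩ => ?_⟩
  fin_cases i
  · simp at hi
  · rfl

theorem well_zero_mem_laminates (j : ℕ) : (!![1, 0; 0, 0] : Mat2) ∈ laminates K3 j := by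
  induction j with
  | zero => exact well_mem_K3 0
  | succ j ih => exact Or.inl ih

theorem segment_mem_laminates_one {t : ℝ} (ht : t ∈ Icc (-1 : ℝ) 1) :
    (!![-1, 0; 0, t] : Mat2) ∈ laminates K3 1 := by
  refine Or.inr ⟨!![-1, 0; 0, 1], well_mem_K3 2, !![-1, 0; 0, -1], well_mem_K3 1, ?_,
    (1 + t) / 2, ⟨by linarith [ht.1], by linarith [ht.2]⟩, ?_⟩
  · have : (!![-1, 0; 0, 1] : Mat2) - !![-1, 0; 0, -1] = !![0, 0; 0, 2] := by
      ext i j; fin_cases i <;> fin_cases j <;> norm_num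
    rw [this]
    exact rank_diagonal_zero two_ne_zero
  · rw [diagonal_eq_combination]
    congr <;> ring_nf

/-- First-order laminates are diagonal matrices of one of two kinds. -/
theorem eq_of_mem_laminates_one {M : Mat2} (hM : M ∈ laminates K3 1) :
    M = !![1, 0; 0, 0] ∨ ∃ t ∈ Icc (-1 : ℝ) 1, M = !![-1, 0; 0, t] := by
  have h0 : ∀ A ∈ laminates K3 0, A = !![1, 0; 0, 0] ∨ A = !![-1, 0; 0, -1] ∨
      A = !![-1, 0; 0, 1] := by
    rintro _ ⟨j, rfl⟩
    fin_cases j <;> simp [well]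
  have hpm : ∀ A, (A = (!![-1, 0; 0, -1] : Mat2) ∨ A = !![-1, 0; 0, 1]) →
      ∃ t ∈ Icc (-1 : ℝ) 1, A = !![-1, 0; 0, t] := by
    rintro A (rfl | rfl)
    · exact ⟨-1, by norm_num, rfl⟩
    · exact ⟨1, by norm_num, rfl⟩
  rcases hM with hM | ⟨A, hA, B, hB, hr, t, ht, rfl⟩
  · rcases h0 M hM with h | h
    · exact Or.inl h
    · exact Or.inr (hpm M h)
  have hd := det_eq_zero_of_rank_eq_one hr
  rcases h0 A hA with rfl | hA' <;> rcases h0 B hB with rfl | hB'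
  · left; rw [diagonal_eq_combination]; congr <;> ring_nf
  -- The determinant of the difference is ±2, so the first well is not rank-one connected to either
  -- of the others.
  · rcases hB' with rfl | rfl <;> rw [det_diagonal_sub] at hd <;> norm_num at hd
  · rcases hA' with rfl | rfl <;> rw [det_diagonal_sub] at hd <;> norm_num at hd
  · obtain ⟨a, ha, rfl⟩ := hpm A hA'
    obtain ⟨b, hb, rfl⟩ := hpm B hB'
    refine Or.inr ⟨t * a + (1 - t) * b, ?_, ?_⟩
    · exact (convex_Icc (-1 : ℝ) 1) ha hb ht.1 (by linarith [ht.2]) (by ring)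
    · rw [diagonal_eq_combination]; congr; ring_nf

/-- The second-order laminates of order exactly two. -/
theorem eq_of_mem_laminates_two {F : Mat2} (hF : F ∈ laminates K3 2 \ laminates K3 1) :
    ∃ L ∈ Ioo (0 : ℝ) 1, F = !![1 - 2 * L, 0; 0, 0] := by
  obtain ⟨h2, h1⟩ := hF
  rcases h2 with h2 | ⟨A, hA, B, hB, hr, t, ht, rfl⟩
  · exact absurd h2 h1
  have hd := det_eq_zero_of_rank_eq_one hr
  -- The end points are excluded because L = 0 is the first well and L = 1 is diag(-1, 0), a
  -- laminate of first order.
  have key : ∀ L ∈ Icc (0 : ℝ) 1, (!![1 - 2 * L, 0; 0, 0] : Mat2) ∉ laminates K3 1 →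
      L ∈ Ioo (0 : ℝ) 1 := fun L hL h => by
    refine ⟨hL.1.lt_of_ne fun e => h ?_, hL.2.lt_of_ne fun e => h ?_⟩
    · rw [← e]; simpa using well_zero_mem_laminates 1
    · rw [e]; convert segment_mem_laminates_one (t := 0) (by norm_num) using 3; norm_num
  rcases eq_of_mem_laminates_one hA with rfl | ⟨a, ha, rfl⟩ <;>
    rcases eq_of_mem_laminates_one hB with rfl | ⟨b, hb, rfl⟩
  · refine absurd ?_ h1
    rw [diagonal_eq_combination]
    convert well_zero_mem_laminates 1 using 3 <;> ring_nf
  -- A rank-one connection between diag(1, 0) and diag(-1, b) requires 2(0 - b) = 0, which singles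
  -- out b = 0 on the segment.
  · rw [det_diagonal_sub] at hd
    obtain rfl : b = 0 := by linarith
    have e : t • (!![1, 0; 0, 0] : Mat2) + (1 - t) • !![-1, 0; 0, 0] =
        !![1 - 2 * (1 - t), 0; 0, 0] := by
      rw [diagonal_eq_combination]
      ext i j; fin_cases i <;> fin_cases j <;> (simp; try ring)
    rw [e] at h1 ⊢
    exact ⟨1 - t, key _ ⟨by linarith [ht.2], by linarith [ht.1]⟩ h1, rfl⟩
  · rw [det_diagonal_sub] at hd
    obtain rfl : a = 0 := by linarith
    have e : t • (!![-1, 0; 0, 0] : Mat2) + (1 - t) • !![1, 0; 0, 0] =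
        !![1 - 2 * t, 0; 0, 0] := by
      rw [diagonal_eq_combination]
      ext i j; fin_cases i <;> fin_cases j <;> (simp; try ring)
    rw [e] at h1 ⊢
    exact ⟨t, key _ ht h1, rfl⟩
  · refine absurd ?_ h1
    rw [diagonal_eq_combination]
    convert segment_mem_laminates_one (t := t * a + (1 - t) * b)
      ((convex_Icc (-1 : ℝ) 1) ha hb ht.1 (by linarith [ht.2]) (by ring)) using 3
    ring_nf

end ThreeWell

/-! ### Scaling, rigidity and dichotomy combined -/

theorem mainTheorem5 :
    -- energy scaling for second-order laminates as prescribed mean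
    (∀ F ∈ ThreeWell.laminates ThreeWell.K3 2 \ ThreeWell.laminates ThreeWell.K3 1,
      ∃ c > (0 : ℝ), ∃ C > (0 : ℝ), ∀ ε ∈ Set.Ioo (0 : ℝ) 1,
        ENNReal.ofReal (c * ε ^ (2 / 3 : ℝ)) ≤ ThreeWell.meanEnergy ε F ∧
        ThreeWell.meanEnergy ε F ≤ ENNReal.ofReal (C * ε ^ (2 / 3 : ℝ))) ∧
    -- quantitative rigidity
    (∃ C > (0 : ℝ), ∀ χ : Fin 3 → ThreeWell.Plane → ℝ, ThreeWell.IsPhase χ → ∀ ε > (0 : ℝ),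
      ∃ f : ℝ → ℝ, Measurable f ∧ (∀ t, f t = 0 ∨ f t = 1 ∨ f t = -1) ∧
        ThreeWell.rigidityDefect χ f ≤
          ENNReal.ofReal (C * ε ^ (-(2 / 3) : ℝ)) * ThreeWell.phaseEnergy ε χ) ∧
    -- dichotomy: one may take `f = 0`, or `f` with values `±1`
    (∀ C₀ > (0 : ℝ), ∃ C > (0 : ℝ),
      ∀ χ : Fin 3 → ThreeWell.Plane → ℝ, ThreeWell.IsPhase χ → ∀ ε > (0 : ℝ),
        (ENNReal.ofReal (1 - ThreeWell.theta1 χ) ≤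
            ENNReal.ofReal (C₀ * ε ^ (-(2 / 3) : ℝ)) * ThreeWell.phaseEnergy ε χ →
          ThreeWell.rigidityDefect χ (fun _ => 0) ≤
            ENNReal.ofReal (C * ε ^ (-(2 / 3) : ℝ)) * ThreeWell.phaseEnergy ε χ) ∧
        (ENNReal.ofReal (ThreeWell.theta1 χ) ≤
            ENNReal.ofReal (C₀ * ε ^ (-(2 / 3) : ℝ)) * ThreeWell.phaseEnergy ε χ →
          ∃ f : ℝ → ℝ, Measurable f ∧ (∀ t, f t = 1 ∨ f t = -1) ∧
            ThreeWell.rigidityDefect χ f ≤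
              ENNReal.ofReal (C * ε ^ (-(2 / 3) : ℝ)) * ThreeWell.phaseEnergy ε χ)) := by
  refine ⟨fun F hF => ?_, ⟨176, by norm_num, fun χ h ε hε => (h.rigidity hε).2⟩, fun C₀ hC₀ =>
    ⟨5 * C₀ + 704, by linarith, fun χ h ε hε => ThreeWell.dichotomy hC₀ h hε⟩⟩
  obtain ⟨L, ⟨hL0, hL⟩, rfl⟩ := ThreeWell.eq_of_mem_laminates_two hF
  have hs : (1 - 2 * L) ^ 2 < 1 := by nlinarith
  refine ⟨(1 - (1 - 2 * L) ^ 2) ^ 2 / 320, ?_, 36 / L + 124, by positivity, fun ε hε =>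
    ⟨ThreeWell.meanEnergy_ge (by simpa using hs) hε, ThreeWell.meanEnergy_le hL0 hL hε⟩⟩
  have : 0 < 1 - (1 - 2 * L) ^ 2 := by linarith
  positivity
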